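/- Let $d\ge 2$ and let $\hat f(\zeta)=\mathcal F f(\zeta)=\int_{\mathbb R^d}e^{-2\pi i x\cdot\zeta}f(x)\,dx$. Let $\mathfrak K:\mathbb R^d\to\mathbb R$ be a radially symmetric, smooth, compactly supported function with $\int_{\mathbb R^d}\mathfrak K(x)^2\,dx=1$, and write $\hat{\mathfrak K}(t)$ for the value of the radial function $\hat{\mathfrak K}$ at points of norm $t$. Then the function $$\sigma(\zeta)=\sqrt{\frac{2\pi^{d/2}}{\Gamma(d/2)}\int_{|\zeta|}^{\infty}t^{d-1}\,|\hat{\mathfrak K}(t)|^2\,dt},\qquad \zeta\in\mathbb R^d,$$ is integrable, and $\mathsf K=\mathcal F^{-1}(\sigma)$ is a radially symmetric, real-valued, integrable function with $\int_{\mathbb R^d}\mathsf K(x)\,dx=1$ and $$\sup_{x\in\mathbb R^d}\max\{|\mathsf K(x)|,\ |x|^{2d-1}|\mathsf K(x)|\}<\infty .$$ If $d$ is even, $\mathsf K$ is a Schwartz function. Moreover, let $h$ be a whole-space log-correlated Gaussian field, that is, a random element of the dual of the space $\mathcal S_0(\mathbb R^d)$ of real Schwartz functions with zero integral, such that the $(h,\varphi)$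 are centred Gaussian with $\mathrm{Cov}[(h,\varphi),(h,\psi)]=\iint\varphi(x)\psi(y)\log\frac1{|x-y|}\,dx\,dy$. Let $W$ be a space-time white noise on $\mathbb R^d\times(0,\infty)$, possibly on another probability space. For $\epsilon>0$ let $\mathsf K_\epsilon(x)=\epsilon^{-d}\mathsf K(x/\epsilon)$ and $$\mathfrak h_\epsilon(x)=\int_{\mathbb R^d}\int_\epsilon^\infty \mathfrak K\Big(\frac{x-y}{t}\Big)t^{-\frac{d+1}{2}}\,W(dy,dt),\qquad (h*\mathsf K_\epsilon)(x)=\int_{\mathbb R^d}h(w)\,\mathsf K_\epsilon(x-w)\,dw .$$ Both are understood modulo a global additive constant, i.e. through increments: $\mathfrak h_\epsilon(x)-\mathfrak h_\epsilon(x')$ is the white-noise integral of the difference of the two integrands, which lies in $L^2(\mathbb R^d\times(0,\infty))$, and $(h*\mathsf K_\epsilon)(x)-(h*\mathsf K_\epsilon)(x')$ is the pairing of $h$ with $\mathsf K_\epsilon(x-\cdot)-\mathsf K_\epsilon(x'-\cdot)$, where $h$ is extended by $L^2$-continuity from $\mathcal S_0(\mathbb R^d)$ to its closure under the norm $\|f\|^2=\frac{1}{k_d}\int(2\pi|\xi|)^{-d}|\hat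 f(\xi)|^2\,d\xi$, with $k_d=2^{1-d}\pi^{-d/2}/\Gamma(d/2)$. Then, for every $\epsilon>0$, $\mathfrak h_\epsilon$ and $h*\mathsf K_\epsilon$ both exist as random continuous functions on $\mathbb R^d$ modulo a global additive constant, and any two such versions have the same law, as random elements of the quotient of $C(\mathbb R^d)$, with the topology of locally uniform convergence, by the constant functions. -/

import Mathlib

open MeasureTheory ProbabilityTheory Filter Topology
open scoped FourierTransform SchwartzMap ENNReal

universe u v

noncomputable section

/-- Euclidean space `ℝ^d`. -/
abbrev Rd (d : ℕ) : Type := EuclideanSpace ℝ (Fin d)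

/-- A function on `ℝ^d` is radial if its value at `x` depends on `‖x‖` only. -/
def IsRadial {d : ℕ} (f : Rd d → ℝ) : Prop :=
  ∀ x y : Rd d, ‖x‖ = ‖y‖ → f x = f y

/-- The standing assumption on the kernel `𝔎`: radial, smooth, compactly supported, and
with `L²` norm one. -/
structure IsAdmissibleKernel {d : ℕ} (k : Rd d → ℝ) : Prop where
  radial : IsRadial k
  smooth : ContDiff ℝ (⊤ : ℕ∞) k
  compact_support : HasCompactSupport k
  integral_sq : (∫ x, k x ^ 2) = 1

/-- The Fourier transform `f̂(ζ) = ∫ e^{-2π i x·ζ} f(x) dx` of a real function. -/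
def fourierReal {d : ℕ} (f : Rd d → ℝ) : Rd d → ℂ :=
  𝓕 (fun x => (f x : ℂ))

/-- The radial profile of the Fourier transform of a radial function:
the value `f̂(t)` is the value of `f̂` at the point `t e₁`, which has norm `t` for `0 ≤ t`. -/
def fourierProfile {d : ℕ} [NeZero d] (f : Rd d → ℝ) (t : ℝ) : ℂ :=
  fourierReal f (t • EuclideanSpace.single (0 : Fin d) (1 : ℝ))

/-- The symbol
`ζ ↦ √( (2 π^{d/2} / Γ(d/2)) ∫_{‖ζ‖}^∞ t^{d-1} |𝔎̂(t)|² dt )`. -/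
def kernelSymbol {d : ℕ} [NeZero d] (k : Rd d → ℝ) (ζ : Rd d) : ℝ :=
  √(2 * Real.pi ^ ((d : ℝ) / 2) / Real.Gamma ((d : ℝ) / 2) *
    ∫ t in Set.Ioi ‖ζ‖, t ^ (d - 1) * ‖fourierProfile k t‖ ^ 2)

/-- The rescaled kernel `K_ε(x) = ε^{-d} K(x/ε)`. -/
def rescale {d : ℕ} (K : Rd d → ℝ) (ε : ℝ) (x : Rd d) : ℝ :=
  (ε ^ d)⁻¹ * K (ε⁻¹ • x)

/-! ### Continuous functions modulo constants -/

/-- The subspace of constant functions in `C(ℝ^d, ℝ)`. -/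
def constFunctions (d : ℕ) : Submodule ℝ C(Rd d, ℝ) where
  carrier := {f | ∃ c : ℝ, ∀ x, f x = c}
  add_mem' := by
    rintro f g ⟨a, ha⟩ ⟨b, hb⟩
    exact ⟨a + b, fun x => by simp [ha x, hb x]⟩
  zero_mem' := ⟨0, fun x => rfl⟩
  smul_mem' := by
    rintro r f ⟨a, ha⟩
    exact ⟨r * a, fun x => by simp [ha x]⟩

/-- Continuous functions on `ℝ^d` modulo additive constants, with the quotient of the topology
of locally uniform convergence (the compact-open topology). -/
abbrev ContModConst (d : ℕ) : Type := C(Rd d, ℝ) ⧸ constFunctions d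

/-- The Borel `σ`-algebra on continuous functions modulo constants. -/
instance instMeasurableSpaceContModConst (d : ℕ) : MeasurableSpace (ContModConst d) :=
  borel (ContModConst d)

/-- The increment `f(x) - f(y)`, well defined on functions modulo constants. -/
def incr {d : ℕ} (x y : Rd d) : ContModConst d →ₗ[ℝ] ℝ :=
  (constFunctions d).liftQ
    { toFun := fun f => f x - f y
      map_add' := fun f g => by simp only [ContinuousMap.add_apply]; ring
      map_smul' := fun r f => by
        simp only [ContinuousMap.smul_apply, smul_eq_mul, RingHom.id_apply]; ring }
    (by
      rintro f ⟨c, hc⟩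
      simp [hc x, hc y])

/-! ### White noise and the field `𝔥_ε` -/

/-- Lebesgue measure on space-time `ℝ^d × (0, ∞)`. -/
def spaceTime (d : ℕ) : Measure (Rd d × ℝ) :=
  (volume : Measure (Rd d)).prod ((volume : Measure ℝ).restrict (Set.Ioi 0))

/-- `W` is a space-time white noise on `ℝ^d × (0, ∞)`: a centred Gaussian process indexed by
`L²(ℝ^d × (0, ∞))` with covariance the `L²` inner product. One writes
`W g = ∫ g(y, t) W(dy, dt)`. -/
structure IsWhiteNoise {d : ℕ} {Ω : Type*} [MeasurableSpace Ω] (P : Measure Ω)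
    (W : Lp ℝ 2 (spaceTime d) → Ω → ℝ) : Prop where
  gaussian : IsGaussianProcess W P
  mean_zero : ∀ g, ∫ ω, W g ω ∂P = 0
  cov_eq : ∀ f g : Lp ℝ 2 (spaceTime d),
    covariance (W f) (W g) P = ∫ p, f p * g p ∂(spaceTime d)

/-- The integrand defining the increment `𝔥_ε(x) - 𝔥_ε(y)`:
`(y', t) ↦ 1_{t > ε} (𝔎((x - y')/t) - 𝔎((y - y')/t)) t^{-(d+1)/2}`. -/
def whiteNoiseIntegrand {d : ℕ} (k : Rd d → ℝ) (ε : ℝ) (x y : Rd d) : Rd d × ℝ → ℝ :=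
  Set.indicator {p | ε < p.2} fun p =>
    (k (p.2⁻¹ • (x - p.1)) - k (p.2⁻¹ • (y - p.1))) * p.2 ^ (-((d : ℝ) + 1) / 2)

/-- `A` is the field
`𝔥_ε(x) = ∫ ∫_ε^∞ 𝔎((x - y)/t) t^{-(d+1)/2} W(dy, dt)` as a random continuous function modulo
a global additive constant: its increments are the white-noise integrals of the differences of
the integrands, which are in `L²` (the integrand itself is not). -/
def IsWhiteNoiseField {d : ℕ} {Ω : Type*} [MeasurableSpace Ω] (P : Measure Ω)
    (W : Lp ℝ 2 (spaceTime d) → Ω → ℝ) (k : Rd d → ℝ) (ε : ℝ)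
    (A : Ω → ContModConst d) : Prop :=
  ∀ x y : Rd d, ∃ hg : MemLp (whiteNoiseIntegrand k ε x y) 2 (spaceTime d),
    (fun ω => incr x y (A ω)) =ᵐ[P] W hg.toLp

/-! ### The whole-space log-correlated Gaussian field and its mollification -/

/-- `𝓢₀(ℝ^d)`: real Schwartz functions with zero integral. -/
def schwartzZero (d : ℕ) : Submodule ℝ 𝓢(Rd d, ℝ) where
  carrier := {φ | ∫ x, φ x = 0}
  add_mem' := by
    intro f g hf hg
    simp only [Set.mem_ofPred_eq, add_apply] at *
    rw [integral_add f.integrable g.integrable, hf, hg, add_zero]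
  zero_mem' := by simp
  smul_mem' := by
    intro r f hf
    simp only [Set.mem_ofPred_eq, smul_apply] at *
    rw [integral_smul, hf, smul_zero]

/-- `𝓢₀'(ℝ^d)`: generalized functions modulo additive constants, the topological dual of
`𝓢₀(ℝ^d)`. -/
abbrev GenFunModConst (d : ℕ) : Type := schwartzZero d →L[ℝ] ℝ

/-- `h` is a whole-space log-correlated Gaussian field: a random generalized function modulo
additive constants such that `(h, φ)` is a centred Gaussian for every `φ ∈ 𝓢₀(ℝ^d)` and
`Cov[(h, φ), (h, ψ)] = ∬ φ(x) ψ(y) log (1/|x-y|) dx dy`. -/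
structure IsWholeSpaceLGF {d : ℕ} {Ω : Type*} [MeasurableSpace Ω] (P : Measure Ω)
    (h : Ω → GenFunModConst d) : Prop where
  gaussian : ∀ φ : schwartzZero d, HasGaussianLaw (fun ω => h ω φ) P
  mean_zero : ∀ φ : schwartzZero d, ∫ ω, h ω φ ∂P = 0
  cov_eq : ∀ φ ψ : schwartzZero d,
    covariance (fun ω => h ω φ) (fun ω => h ω ψ) P =
      ∫ x : Rd d, ∫ y : Rd d,
        (φ : 𝓢(Rd d, ℝ)) x * (ψ : 𝓢(Rd d, ℝ)) y * Real.log (1 / ‖x - y‖)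

/-- The squared norm of `ℋ^{-d/2}(ℝ^d)`,
`‖f‖² = k_d⁻¹ ∫ (2π|ξ|)^{-d} |f̂(ξ)|² dξ` with `k_d = 2^{1-d} π^{-d/2} / Γ(d/2)`,
for an integrable function `f`, as an extended nonnegative number. -/
def normSqHNeg {d : ℕ} (f : Rd d → ℝ) : ℝ≥0∞ :=
  ENNReal.ofReal (2 ^ (1 - (d : ℝ)) * Real.pi ^ (-(d : ℝ) / 2) / Real.Gamma ((d : ℝ) / 2))⁻¹ *
    ∫⁻ ξ : Rd d, ENNReal.ofReal (‖fourierReal f ξ‖ ^ 2 / (2 * Real.pi * ‖ξ‖) ^ d)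

/-- The random variable `Y` is the pairing `(h, f)` of the random generalized function `h` with
an integrable function `f` in the closure `ℋ^{-d/2}(ℝ^d)` of `𝓢₀(ℝ^d)`: it is the limit in
`L²(P)` of `(h, φ_n)` for a sequence `φ_n ∈ 𝓢₀(ℝ^d)` that converges to `f` in
`ℋ^{-d/2}(ℝ^d)`. -/
def IsPairing {d : ℕ} {Ω : Type*} [MeasurableSpace Ω] (P : Measure Ω)
    (h : Ω → GenFunModConst d) (f : Rd d → ℝ) (Y : Ω → ℝ) : Prop :=
  Integrable f ∧ MemLp Y 2 P ∧ ∃ φ : ℕ → schwartzZero d,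
    Tendsto (fun n => normSqHNeg fun x => f x - (φ n : 𝓢(Rd d, ℝ)) x) atTop (𝓝 0) ∧
    Tendsto (fun n => eLpNorm (fun ω => h ω (φ n) - Y ω) 2 P) atTop (𝓝 0)

/-- `B` is the convolution `h * K`, `(h * K)(x) = ∫ h(w) K(x - w) dw`, as a random continuous
function modulo a global additive constant: its increment between `x` and `y` is the pairing of
`h` with `w ↦ K(x - w) - K(y - w)`. -/
def IsConvolution {d : ℕ} {Ω : Type*} [MeasurableSpace Ω] (P : Measure Ω)
    (h : Ω → GenFunModConst d) (K : Rd d → ℝ) (B : Ω → ContModConst d) : Prop :=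
  ∀ x y : Rd d, IsPairing P h (fun w => K (x - w) - K (y - w)) fun ω => incr x y (B ω)

end

/-! Write `σ(ζ)² = γ(|ζ|)`. For both fields the variance of a linear combination of increments, with
Fourier multiplier `T(ξ) = ∑ a_i (e^{-2πi x_i·ξ} - e^{-2πi y_i·ξ})`, equals `∫ |T(ξ)|² σ(εξ)² / (S
|ξ|^d) dξ`, where `S` is the area of the unit sphere. For the white noise field, apply Plancherel at
each fixed `t` and then integrate over `t > ε`: the substitution `u = t|ξ|` produces exactly the
tail integral that defines `σ²` (`lintegral_slice`, `lintegral_fourierProfile`). For the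
log-correlated field, the logarithmic energy of a mean-zero function is `∫ |f̂|² / (S |ξ|^d)`
(`ofReal_logEnergy`, by writing the logarithm as a superposition of Gaussians), and the mollifier
multiplies `f̂` by `σ(ε·)`. Since `|T(ξ)| = O(|ξ|)`, the integral converges and increments have
variance `O(|x-y|²)`, so a Kolmogorov argument gives continuous versions. Laws on continuous
functions modulo constants are determined by the increments along a dense sequence, whose
finite-dimensional laws are centred Gaussian with matching variances.

The analytic difficulty is the regularity of `σ = √γ`. At infinity both `γ` and its derivatives are
tiny, and smoothness and rapid decay of `γ` alone do not control derivatives of the square root.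
Compact support of the kernel helps: `γ` extends to an entire function `g` of exponential type.
Being positive and decreasing on the half-line, `γ` cannot decay faster than exponentially, and by
the three lines theorem `|g| ≤ A γ(r)` on a disc of radius of order `r⁻²` about `r`. The Schwarz
lemma then keeps `g` within `γ(r)/2` of `γ(r)` on a smaller such disc, so `√g` is holomorphic there
and Cauchy's estimates bound the derivatives of `√γ` by powers of `r` times `√γ`
(`exists_abs_iteratedDeriv_le`). Hence `σ` is Schwartz away from the origin.

At the origin `σ² = 1 - |ζ|^d m(ζ)` with `m` smooth. For even `d` this is smooth and `σ` is
Schwartz. In general `σ - 1` has a singularity modelled on `|ζ|^d`; a dyadic decomposition, in which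
the rescaled pieces form a smooth family with common compact support, gives the decay
`|x|^{-(2d-1)}` of the transform (`exists_fourier_low_le`). This is integrable because `2d - 1 > d`
for `d ≥ 2`. -/

/-! ### Entire functions of exponential type, positive and decreasing on a half-line -/

theorem norm_cos_le_cosh_im (w : ℂ) : ‖Complex.cos w‖ ≤ Real.cosh w.im := by
  rw [Complex.cos, Real.cosh_eq]
  calc ‖(Complex.exp (w * Complex.I) + Complex.exp (-w * Complex.I)) / 2‖
      = ‖Complex.exp (w * Complex.I) + Complex.exp (-w * Complex.I)‖ / 2 := by simp
    _ ≤ (‖Complex.exp (w * Complex.I)‖ + ‖Complex.exp (-w * Complex.I)‖) / 2 := by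
        gcongr; exact norm_add_le _ _
    _ = _ := by simp [Complex.norm_exp]; ring

/-- The modulus is exactly `cosh (Im w) - cos (Re w)`, and `cosh v ≥ 1 + v²/2`. Under `z = r + 1 -
cos w` this turns the distance of `z` from the endpoint `r` into a bound on the height of `w` in the
strip. -/
theorem sq_im_div_two_le_norm_one_sub_cos (w : ℂ) : w.im ^ 2 / 2 ≤ ‖1 - Complex.cos w‖ := by
  have h1 : ‖1 - Complex.cos w‖ ^ 2 = (Real.cosh w.im - Real.cos w.re) ^ 2 := by
    rw [Complex.sq_norm, Complex.normSq_apply]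
    simp only [Complex.sub_re, Complex.one_re, Complex.sub_im, Complex.one_im, Complex.cos_eq w,
      Complex.mul_re, Complex.mul_im, Complex.I_re, Complex.I_im, ← Complex.ofReal_cos,
      ← Complex.ofReal_sin, ← Complex.ofReal_cosh, ← Complex.ofReal_sinh, Complex.ofReal_re,
      Complex.ofReal_im]
    have e1 := Real.cos_sq_add_sin_sq w.re
    have e2 := Real.cosh_sq w.im
    have e3 : Real.sin w.re ^ 2 = 1 - Real.cos w.re ^ 2 := by linarith
    have e4 : Real.sinh w.im ^ 2 = Real.cosh w.im ^ 2 - 1 := by linarith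
    ring_nf
    rw [e3, e4]; ring
  have hc : 1 + w.im ^ 2 / 2 ≤ Real.cosh w.im := by
    have e1 := Real.cosh_two_mul (w.im / 2)
    have e2 := Real.cosh_sq (w.im / 2)
    have e3 : (w.im / 2) ^ 2 ≤ Real.sinh (w.im / 2) ^ 2 := by
      rw [sq_le_sq, Real.abs_sinh]
      exact Real.self_le_sinh_iff.2 (abs_nonneg _)
    rw [mul_div_cancel₀ _ (two_ne_zero' ℝ)] at e1
    nlinarith
  have hc' := Real.cos_le_one w.re
  have h2 : 0 ≤ Real.cosh w.im - Real.cos w.re := by linarith [sq_nonneg w.im]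
  rw [(pow_left_inj₀ (norm_nonneg _) h2 two_ne_zero).1 h1]
  linarith

/-- The three lines theorem of Hadamard for an entire function, transplanted by `w ↦ r + a - a cos w`
to a neighbourhood of the segment `[r, r + 2 a]`. -/
theorem norm_le_rpow_mul_rpow_of_segment {g : ℂ → ℂ} (hg : Differentiable ℂ g) {r a L M B : ℝ}
    (hr : 0 ≤ r) (ha : 0 ≤ a) (hL : 0 < L)
    (hM : ∀ x : ℝ, r ≤ x → ‖g x‖ ≤ M)
    (hB : ∀ z : ℂ, ‖z‖ ≤ r + a + a * Real.cosh L → ‖g z‖ ≤ B)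
    {w : ℂ} (h0 : 0 ≤ w.im) (h1 : w.im ≤ L) :
    ‖g (r + a - a * Complex.cos w)‖ ≤ M ^ (1 - w.im / L) * B ^ (w.im / L) := by
  -- The line `Re s = 0` corresponds to real `w`, hence to the segment `[r, r + 2a]`, where the
  -- bound is `M`. The line `Re s = 1` corresponds to `Im w = L`, where only the crude bound `B` is
  -- available.
  set f : ℂ → ℂ := fun s => g (r + a - a * Complex.cos (Complex.I * L * s)) with hf
  have hLc : (L : ℂ) ≠ 0 := by exact_mod_cast hL.ne'
  have him : ∀ s : ℂ, (Complex.I * L * s).im = L * s.re := by intro s; simp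
  have hfd : Differentiable ℂ f := by
    have : Differentiable ℂ fun s : ℂ => (r + a - a * Complex.cos (Complex.I * L * s) : ℂ) := by
      fun_prop
    exact hg.comp this
  have hbound : ∀ s : ℂ, 0 ≤ s.re → s.re ≤ 1 → ‖f s‖ ≤ B := by
    intro s hs0 hs1
    apply hB
    calc ‖(r + a - a * Complex.cos (Complex.I * L * s) : ℂ)‖
        ≤ ‖(r + a : ℂ)‖ + ‖(a * Complex.cos (Complex.I * L * s) : ℂ)‖ := norm_sub_le _ _
      _ ≤ r + a + a * Real.cosh L := by
        gcongr
        · rw [← Complex.ofReal_add, Complex.norm_real, Real.norm_of_nonneg (by positivity)]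
        · rw [norm_mul, Complex.norm_real, Real.norm_of_nonneg ha]
          gcongr
          refine (norm_cos_le_cosh_im _).trans ?_
          rw [him, Real.cosh_le_cosh, abs_of_nonneg (by positivity), abs_of_nonneg hL.le]
          nlinarith
  have key := Complex.HadamardThreeLines.norm_le_interp_of_mem_verticalClosedStrip₀₁' f
    (z := w / (Complex.I * L)) (a := M) (b := B) ?_ hfd.diffContOnCl ?_ ?_ ?_
  · have hre : (w / (Complex.I * L)).re = w.im / L := by
      rw [div_mul_eq_div_div, Complex.div_I]; simp [Complex.div_ofReal_re]
    rw [hre] at key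
    simpa only [hf, mul_div_cancel₀ w (mul_ne_zero Complex.I_ne_zero hLc)] using key
  · have hre : (w / (Complex.I * L)).re = w.im / L := by
      rw [div_mul_eq_div_div, Complex.div_I]; simp [Complex.div_ofReal_re]
    simp only [Complex.HadamardThreeLines.verticalClosedStrip, Set.mem_preimage, Set.mem_Icc, hre]
    exact ⟨by positivity, by rw [div_le_one hL]; exact h1⟩
  · refine ⟨B, ?_⟩
    rintro _ ⟨s, hs, rfl⟩
    simp only [Complex.HadamardThreeLines.verticalClosedStrip, Set.mem_preimage, Set.mem_Icc] at hs
    exact hbound s hs.1 hs.2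
  · intro s hs
    simp only [Set.mem_preimage, Set.mem_singleton_iff] at hs
    have hcos : Complex.cos (Complex.I * L * s) = (Real.cos (-(L * s.im)) : ℝ) := by
      rw [Complex.ofReal_cos]; congr 1
      apply Complex.ext <;> simp [hs]
    have : f s = g ((r + a - a * Real.cos (-(L * s.im)) : ℝ) : ℂ) := by
      simp only [hf, hcos]; push_cast; rfl
    rw [this]
    apply hM
    nlinarith [Real.cos_le_one (-(L * s.im))]
  · intro s hs
    simp only [Set.mem_preimage, Set.mem_singleton_iff] at hs
    exact hbound s (by simp [hs]) (by simp [hs])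

/-- An entire function of exponential type that is positive and decreasing on the positive
half-line decays at most exponentially there. -/
theorem exists_exp_le_of_exponential_type {g : ℂ → ℂ} (hg : Differentiable ℂ g) {γ : ℝ → ℝ}
    (hγ : ∀ r : ℝ, 0 ≤ r → g r = γ r) (hanti : AntitoneOn γ (Set.Ici 0))
    (hpos : ∀ r, 0 ≤ r → 0 < γ r) {C : ℝ} (hC : 0 < C)
    (hgrowth : ∀ z, ‖g z‖ ≤ C * Real.exp (C * ‖z‖)) :
    ∃ D : ℝ, 0 < D ∧ ∀ r, 1 ≤ r → Real.exp (-(D * r)) ≤ γ r := by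
  -- With `a = r` the point `r + a - a cos w` is the origin, so the three lines theorem compares `γ
  -- 0` with `γ r` and the growth bound.
  obtain ⟨w, hw⟩ := Complex.cos_surjective 2
  have hcosh : (2:ℝ) ≤ Real.cosh w.im := by
    have := norm_cos_le_cosh_im w; rw [hw] at this; simpa using this
  wlog hwi : 0 ≤ w.im generalizing w
  · exact this (-w) (by simp [hw]) (by simpa using hcosh) (by simp; linarith)
  set y := w.im with hy
  have hy0 : 0 < y := by
    rcases hwi.lt_or_eq with h | h
    · exact h
    · rw [← h] at hcosh; norm_num at hcosh
  -- This makes the interpolation exponent `y / L` equal to `1/2`, independently of `r`.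
  set L := 2 * y with hLdef
  have hL : 0 < L := by positivity
  set H := 2 + Real.cosh L with hH
  have hHpos : 0 < H := by have := Real.cosh_pos L; positivity
  -- γ 0 ≤ √(γ r) √(C e^{CHr})
  have main : ∀ r, 1 ≤ r → γ 0 ^ 2 ≤ γ r * (C * Real.exp (C * (H * r))) := by
    intro r hr
    have hr0 : 0 ≤ r := by linarith
    have := norm_le_rpow_mul_rpow_of_segment hg (r := r) (a := r) (L := L) (M := γ r)
      (B := C * Real.exp (C * (H * r))) hr0 hr0 hL (w := w) ?_ ?_ hwi (by linarith)
    · have e1 : y / L = 1 / 2 := by rw [hLdef]; field_simp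
      have e0 : (r + r - r * Complex.cos w : ℂ) = ((0:ℝ) : ℂ) := by rw [hw]; push_cast; ring
      rw [e0, hγ 0 le_rfl, ← hy, e1, Complex.norm_real, Real.norm_of_nonneg (hpos 0 le_rfl).le] at this
      norm_num at this
      rw [← Real.sqrt_eq_rpow, ← Real.sqrt_eq_rpow] at this
      calc γ 0 ^ 2 ≤ (√(γ r) * √(C * Real.exp (C * (H * r)))) ^ 2 := by
            gcongr
            exact (hpos 0 le_rfl).le
        _ = _ := by
            rw [mul_pow, Real.sq_sqrt (hpos r hr0).le, Real.sq_sqrt (by positivity)]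
    · intro x hx
      rw [hγ x (by linarith), Complex.norm_real, Real.norm_of_nonneg (hpos x (by linarith)).le]
      exact hanti hr0 (by simp; linarith) hx
    · intro z hz
      refine (hgrowth z).trans ?_
      gcongr
      rw [hH]; linarith
  set q := γ 0 ^ 2 / C with hq
  have hqpos : 0 < q := by have := hpos 0 le_rfl; positivity
  -- The prefactor `q` is absorbed into the exponential because `r ≥ 1`.
  refine ⟨C * H + |Real.log q|, by positivity, fun r hr => ?_⟩
  have h1 := main r hr
  have h2 : q * Real.exp (-(C * H * r)) ≤ γ r := by
    rw [hq, Real.exp_neg, ← div_eq_mul_inv, div_div, div_le_iff₀ (by positivity)]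
    rw [mul_assoc C H r]; exact h1
  refine le_trans ?_ h2
  have h3 : Real.exp (-(|Real.log q| * r)) ≤ q := by
    calc Real.exp (-(|Real.log q| * r)) ≤ Real.exp (Real.log q) := by
          apply Real.exp_le_exp.2
          have := neg_abs_le (Real.log q)
          nlinarith [abs_nonneg (Real.log q)]
      _ = q := Real.exp_log hqpos
  calc Real.exp (-((C * H + |Real.log q|) * r))
      = Real.exp (-(|Real.log q| * r)) * Real.exp (-(C * H * r)) := by
        rw [← Real.exp_add]; congr 1; ring
    _ ≤ _ := by gcongr

/-- Close to the positive half-line an entire function of exponential type that is positive and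
decreasing there is comparable to its values on the half-line. -/
theorem exists_norm_le_mul_of_exponential_type {g : ℂ → ℂ} (hg : Differentiable ℂ g) {γ : ℝ → ℝ}
    (hγ : ∀ r : ℝ, 0 ≤ r → g r = γ r) (hanti : AntitoneOn γ (Set.Ici 0))
    (hpos : ∀ r, 0 ≤ r → 0 < γ r) {C : ℝ} (hC : 0 < C)
    (hgrowth : ∀ z, ‖g z‖ ≤ C * Real.exp (C * ‖z‖)) :
    ∃ A : ℝ, 1 ≤ A ∧ ∀ r : ℝ, 1 ≤ r → ∀ z : ℂ, ‖z - r‖ ≤ 1 / (2 * r ^ 2) → ‖g z‖ ≤ A * γ r := by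
  obtain ⟨D, hD, hlow⟩ := exists_exp_le_of_exponential_type hg hγ hanti hpos hC hgrowth
  set H := 2 + Real.cosh 1 with hH
  have hHpos : 0 < H := by have := Real.cosh_pos 1; positivity
  set E := |Real.log C| + C * H + D with hE
  refine ⟨Real.exp E, Real.one_le_exp (by positivity), fun r hr z hz => ?_⟩
  have hr0 : 0 < r := by linarith
  obtain ⟨w, hw⟩ := Complex.cos_surjective (1 - (z - r))
  wlog hwi : 0 ≤ w.im generalizing w
  · exact this (-w) (by simp [hw]) (by simp; linarith)
  -- Here `|1 - cos w| = |z - r| ≤ 1/(2r²)`. The radius is chosen of order `r⁻²` precisely to get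
  -- height at most `1/r`.
  have hwim : w.im ≤ 1 / r := by
    have h1 := sq_im_div_two_le_norm_one_sub_cos w
    rw [hw, sub_sub_cancel] at h1
    have h2 : w.im ^ 2 ≤ (1 / r) ^ 2 := by
      have : w.im ^ 2 / 2 ≤ 1 / (2 * r ^ 2) := h1.trans hz
      rw [div_pow, one_pow]
      have e : 1 / (2 * r ^ 2) = (1 / r ^ 2) / 2 := by field_simp
      rw [e] at this; linarith
    exact (sq_le_sq₀ hwi (by positivity)).1 h2
  have hw1 : w.im ≤ 1 := hwim.trans (by rw [div_le_one hr0]; exact hr)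
  have key := norm_le_rpow_mul_rpow_of_segment hg (r := r) (a := 1) (L := 1) (M := γ r)
      (B := C * Real.exp (C * (H * r))) hr0.le zero_le_one one_pos (w := w) ?_ ?_ hwi hw1
  · have hz' : (r + (1:ℝ) - (1:ℝ) * Complex.cos w : ℂ) = z := by rw [hw]; push_cast; ring
    rw [hz', div_one] at key
    refine key.trans ?_
    have hγr := hpos r hr0.le
    rw [Real.rpow_sub hγr, Real.rpow_one, div_mul_eq_mul_div, mul_div_assoc, ← Real.div_rpow
      (by positivity) hγr.le, mul_comm]
    gcongr
    -- The interpolated bound is `γ r (B / γ r)^{Im w}`. The quotient `B / γ r` is at most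
    -- exponential in `r` by the lower bound on `γ`, and the exponent `Im w ≤ 1/r` reduces it to the
    -- constant `e^E`.
    have hB : C * Real.exp (C * (H * r)) / γ r ≤ Real.exp (E * r) := by
      rw [div_le_iff₀ hγr]
      have hlr := hlow r hr
      calc C * Real.exp (C * (H * r))
          ≤ Real.exp (|Real.log C| * r) * Real.exp (C * (H * r)) := by
            gcongr
            calc C = Real.exp (Real.log C) := (Real.exp_log hC).symm
              _ ≤ _ := by
                apply Real.exp_le_exp.2
                have := le_abs_self (Real.log C)
                nlinarith [abs_nonneg (Real.log C)]
        _ = Real.exp (E * r) * Real.exp (-(D * r)) := by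
            rw [← Real.exp_add, ← Real.exp_add]; congr 1; rw [hE]; ring
        _ ≤ _ := by gcongr
    calc (C * Real.exp (C * (H * r)) / γ r) ^ w.im ≤ (Real.exp (E * r)) ^ w.im := by
          gcongr
      _ = Real.exp (E * r * w.im) := by rw [← Real.exp_mul]
      _ ≤ Real.exp E := by
          apply Real.exp_le_exp.2
          have h3 : r * w.im ≤ 1 := by
            calc r * w.im ≤ r * (1 / r) := by gcongr
              _ = 1 := by field_simp
          have : 0 ≤ E := by positivity
          nlinarith
  · intro x hx
    rw [hγ x (by linarith), Complex.norm_real, Real.norm_of_nonneg (hpos x (by linarith)).le]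
    exact hanti hr0.le (by simp; linarith) hx
  · intro z hz
    refine (hgrowth z).trans ?_
    gcongr
    refine hz.trans ?_
    rw [hH]; nlinarith [Real.cosh_pos 1]

/-- The Schwarz lemma: on the disc of radius `1/(2r²)` about `r` the function `g - γ r` is `O(γ r)`,
so it is at most `γ r / 2` on a fixed fraction of that disc. This keeps `g / γ r` away from the
branch cut of the square root. -/
theorem exists_norm_sub_le_half_of_exponential_type {g : ℂ → ℂ} (hg : Differentiable ℂ g)
    {γ : ℝ → ℝ}
    (hγ : ∀ r : ℝ, 0 ≤ r → g r = γ r) (hanti : AntitoneOn γ (Set.Ici 0))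
    (hpos : ∀ r, 0 ≤ r → 0 < γ r) {C : ℝ} (hC : 0 < C)
    (hgrowth : ∀ z, ‖g z‖ ≤ C * Real.exp (C * ‖z‖)) :
    ∃ c : ℝ, 0 < c ∧ ∀ r : ℝ, 1 ≤ r → ∀ z : ℂ, ‖z - r‖ ≤ c / r ^ 2 → ‖g z - γ r‖ ≤ γ r / 2 := by
  obtain ⟨A, hA, hbd⟩ := exists_norm_le_mul_of_exponential_type hg hγ hanti hpos hC hgrowth
  -- The Schwarz lemma is used with image radius `2(A+1) γ r`, so `|z - r|` must be at most `R /
  -- (4(A+1))` with `R = 1/(2r²)`.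
  refine ⟨1 / (8 * (A + 1)), by positivity, fun r hr z hz => ?_⟩
  have hr0 : 0 < r := by linarith
  have hγr := hpos r hr0.le
  set R := 1 / (2 * r ^ 2) with hR
  have hRpos : 0 < R := by positivity
  have hzR : ‖z - r‖ ≤ R / (4 * (A + 1)) := by
    refine hz.trans (le_of_eq ?_); rw [hR]; field_simp; ring
  have hzlt : dist z r < R := by
    rw [dist_eq_norm]; refine hzR.trans_lt ?_
    rw [div_lt_iff₀ (by positivity)]; nlinarith
  have key := Complex.dist_le_div_mul_dist_of_mapsTo_ball (f := g) (c := r) (R₁ := R)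
    (R₂ := 2 * (A + 1) * γ r) (z := z) hg.differentiableOn ?_ (Metric.mem_ball.2 hzlt)
  · rw [dist_eq_norm, dist_eq_norm, hγ r hr0.le] at key
    refine key.trans ?_
    calc 2 * (A + 1) * γ r / R * ‖z - r‖ ≤ 2 * (A + 1) * γ r / R * (R / (4 * (A + 1))) := by gcongr
      _ = γ r / 2 := by field_simp; norm_num
  · intro x hx
    rw [Metric.mem_closedBall, dist_eq_norm]
    rw [Metric.mem_ball, dist_eq_norm] at hx
    calc ‖g x - g r‖ ≤ ‖g x‖ + ‖g r‖ := norm_sub_le _ _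
      _ ≤ A * γ r + γ r := by
          gcongr
          · exact hbd r hr x hx.le
          · rw [hγ r hr0.le, Complex.norm_real, Real.norm_of_nonneg hγr.le]
      _ ≤ _ := by nlinarith

/-! ### The square root of an entire profile as a Schwartz function -/

/-- `γ` is a positive decreasing profile on the half-line with rapid decay, and the restriction of
the entire function `g` of exponential type. -/
structure IsEntireProfile (g : ℂ → ℂ) (γ : ℝ → ℝ) : Prop where
  differentiable : Differentiable ℂ g
  eq_ofReal : ∀ r : ℝ, 0 ≤ r → g r = γ r
  antitone : AntitoneOn γ (Set.Ici 0)
  pos : ∀ r, 0 ≤ r → 0 < γ r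
  growth : ∃ C : ℝ, 0 < C ∧ ∀ z, ‖g z‖ ≤ C * Real.exp (C * ‖z‖)
  decay : ∀ N : ℕ, ∃ C : ℝ, ∀ r, 0 ≤ r → r ^ N * γ r ≤ C

/-- Differentiating a holomorphic function along the real axis commutes with taking real parts.
Cauchy's estimates for the extension thereby bound the real derivatives. -/
theorem iteratedDeriv_eq_re_iteratedDeriv {h : ℂ → ℂ} {S : ℝ → ℝ} {U : Set ℂ} (hU : IsOpen U)
    (hd : DifferentiableOn ℂ h U) (hS : ∀ x : ℝ, (x : ℂ) ∈ U → S x = (h x).re) (n : ℕ) :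
    ∀ x : ℝ, (x : ℂ) ∈ U → iteratedDeriv n S x = (iteratedDeriv n h x).re := by
  have hdn : ∀ n, DifferentiableOn ℂ (iteratedDeriv n h) U := by
    intro n
    induction n with
    | zero => simpa using hd
    | succ n ih => rw [iteratedDeriv_succ]; exact ih.deriv hU
  induction n with
  | zero => simpa using hS
  | succ n ih =>
    intro x hx
    rw [iteratedDeriv_succ, iteratedDeriv_succ]
    have hUx : ∀ᶠ y : ℝ in 𝓝 x, (y : ℂ) ∈ U :=
      Complex.continuous_ofReal.continuousAt.eventually (hU.mem_nhds hx)
    have h1 : iteratedDeriv n S =ᶠ[𝓝 x] fun y : ℝ => (iteratedDeriv n h y).re := by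
      filter_upwards [hUx] with y hy using ih y hy
    rw [h1.deriv_eq]
    exact (((hdn n).differentiableAt (hU.mem_nhds hx)).hasDerivAt.real_of_complex).deriv

theorem norm_complex_sqrt (z : ℂ) : ‖Complex.sqrt z‖ = √‖z‖ := by
  rw [Complex.sqrt, Real.sqrt_eq_rpow]
  have := Complex.norm_cpow_real z 2⁻¹
  push_cast at this
  rw [this]; norm_num

theorem complex_sqrt_mul_self (z : ℂ) : Complex.sqrt z * Complex.sqrt z = z := by
  rw [Complex.sqrt, ← sq]; exact_mod_cast Complex.cpow_nat_inv_pow z two_ne_zero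

theorem complex_sqrt_ofReal {x : ℝ} (hx : 0 ≤ x) : Complex.sqrt (x : ℂ) = (√x : ℝ) := by
  rw [Complex.sqrt_of_nonneg (by exact_mod_cast hx)]; simp

/-- Factor `z - ρ = (√z - √ρ)(√z + √ρ)`; the second factor has real part at least `1`, since the
principal root has nonnegative real part. -/
theorem norm_complex_sqrt_sub_le {ρ : ℝ} (hρ : 1 ≤ ρ) (z : ℂ) :
    ‖Complex.sqrt z - (√ρ : ℝ)‖ ≤ ‖z - ρ‖ := by
  have h1 : (z - ρ : ℂ) = (Complex.sqrt z - (√ρ : ℝ)) * (Complex.sqrt z + (√ρ : ℝ)) := by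
    have e : (((√ρ : ℝ) : ℂ)) * ((√ρ : ℝ) : ℂ) = ρ := by
      rw [← Complex.ofReal_mul, Real.mul_self_sqrt (by linarith)]
    linear_combination -(complex_sqrt_mul_self z) + e
  have h2 : 1 ≤ ‖Complex.sqrt z + (√ρ : ℝ)‖ := by
    refine le_trans ?_ (Complex.re_le_norm _)
    have : 0 ≤ (Complex.sqrt z).re := by
      rw [Complex.sqrt, Complex.cpow_inv_two_re]; positivity
    have h3 : 1 ≤ √ρ := Real.one_le_sqrt.2 hρ
    simp; linarith
  rw [h1, norm_mul]
  exact le_mul_of_one_le_right (norm_nonneg _) h2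

namespace IsEntireProfile

variable {g : ℂ → ℂ} {γ : ℝ → ℝ}

/-- The derivatives of `ρ ↦ √γ(√ρ)` are bounded by polynomials times `√γ(√ρ)`. -/
theorem exists_abs_iteratedDeriv_le (h : IsEntireProfile g γ) (n : ℕ) :
    ∃ C : ℝ, 0 ≤ C ∧ ∀ ρ : ℝ, 1 ≤ ρ →
      |iteratedDeriv n (fun x => √(γ (√x))) ρ| ≤ C * ρ ^ n * √(γ (√ρ)) := by
  obtain ⟨C, hC, hgrowth⟩ := h.growth
  obtain ⟨c₀, hc₀, hhalf₀⟩ := exists_norm_sub_le_half_of_exponential_type h.differentiable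
    h.eq_ofReal h.antitone h.pos hC hgrowth
  -- The cap `1/2` keeps the disc of radius `c/ρ` about `ρ ≥ 1` in the right half-plane, where the
  -- principal root is holomorphic.
  set c := min c₀ (1 / 2) with hcdef
  have hc : 0 < c := by positivity
  refine ⟨n.factorial * 2 / c ^ n, by positivity, fun ρ hρ => ?_⟩
  have hρ0 : 0 < ρ := by linarith
  set r := √ρ with hr
  have hr1 : 1 ≤ r := Real.one_le_sqrt.2 hρ
  have hr0 : 0 ≤ r := by linarith
  have hrsq : r ^ 2 = ρ := Real.sq_sqrt hρ0.le
  have hγr := h.pos r hr0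
  set η := c / ρ with hη
  have hηpos : 0 < η := by positivity
  have hη2 : η ≤ 1 / 2 := by
    rw [hη, div_le_iff₀ hρ0]
    have : c ≤ 1 / 2 := min_le_right _ _
    nlinarith
  -- Dividing by `γ r` before taking the root leaves an argument within `1/2` of `1`. Cauchy's
  -- estimate on the disc of radius `c/ρ`, with `|f| ≤ 2√(γ r)`, then gives the constant `2 n!/c^n`
  -- and the factor `ρ^n`.
  set f : ℂ → ℂ := fun z => (√(γ r) : ℝ) * Complex.sqrt (g (Complex.sqrt z) / γ r) with hf
  have hq : ∀ z ∈ Metric.closedBall (ρ : ℂ) η, ‖g (Complex.sqrt z) / γ r - 1‖ ≤ 1 / 2 := by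
    intro z hz
    rw [Metric.mem_closedBall, dist_eq_norm] at hz
    have h1 : ‖Complex.sqrt z - r‖ ≤ c₀ / r ^ 2 := by
      refine (norm_complex_sqrt_sub_le hρ z).trans (hz.trans ?_)
      rw [hη, hrsq]; gcongr; exact min_le_left _ _
    have h2 := hhalf₀ r hr1 _ h1
    have hne : (γ r : ℂ) ≠ 0 := by exact_mod_cast hγr.ne'
    rw [div_sub_one hne, norm_div, Complex.norm_real, Real.norm_of_nonneg hγr.le,
      div_le_iff₀ hγr]
    linarith
  have hzre : ∀ z ∈ Metric.closedBall (ρ : ℂ) η, 0 < z.re := by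
    intro z hz
    rw [Metric.mem_closedBall, dist_eq_norm] at hz
    have := (Complex.abs_re_le_norm (z - ρ)).trans hz
    rw [abs_le] at this
    simp at this
    linarith [this.1]
  have hqre : ∀ z ∈ Metric.closedBall (ρ : ℂ) η, 0 < (g (Complex.sqrt z) / γ r).re := by
    intro z hz
    have := (Complex.abs_re_le_norm _).trans (hq z hz)
    rw [abs_le, Complex.sub_re, Complex.one_re] at this
    linarith [this.1]
  have hfd : DifferentiableOn ℂ f (Metric.closedBall (ρ : ℂ) η) := by
    intro z hz
    apply DifferentiableAt.differentiableWithinAt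
    have h1 : DifferentiableAt ℂ Complex.sqrt z :=
      Complex.differentiableAt_sqrt (Or.inl (hzre z hz))
    have h2 : DifferentiableAt ℂ (fun z => g (Complex.sqrt z) / γ r) z :=
      ((h.differentiable _).comp z h1).div_const _
    exact ((Complex.differentiableAt_sqrt (Or.inl (hqre z hz))).comp z h2).const_mul _
  have hfS : ∀ x : ℝ, (x : ℂ) ∈ Metric.ball (ρ : ℂ) η → √(γ (√x)) = (f x).re := by
    intro x hx
    have hx0 : 0 < x := by
      simpa using hzre _ (Metric.ball_subset_closedBall hx)
    have hγx := h.pos (√x) (Real.sqrt_nonneg _)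
    simp only [hf]
    rw [complex_sqrt_ofReal hx0.le, h.eq_ofReal _ (Real.sqrt_nonneg _), ← Complex.ofReal_div,
      complex_sqrt_ofReal (by positivity), ← Complex.ofReal_mul, Complex.ofReal_re,
      ← Real.sqrt_mul hγr.le]
    congr 1; field_simp
  rw [iteratedDeriv_eq_re_iteratedDeriv Metric.isOpen_ball
    (hfd.mono Metric.ball_subset_closedBall) hfS n ρ (Metric.mem_ball_self hηpos)]
  refine (Complex.abs_re_le_norm _).trans ?_
  have key := Complex.norm_iteratedDeriv_le_of_forall_mem_sphere_norm_le (c := (ρ : ℂ)) (R := η)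
    (C := 2 * √(γ r)) (f := f) n hηpos (hfd.diffContOnCl_ball subset_rfl) ?_
  · refine key.trans (le_of_eq ?_)
    rw [hη, div_pow]; field_simp
  · intro z hz
    simp only [hf]
    rw [norm_mul, Complex.norm_real, Real.norm_of_nonneg (Real.sqrt_nonneg _), norm_complex_sqrt,
      mul_comm]
    gcongr
    have h1 := hq z (Metric.sphere_subset_closedBall hz)
    have h2 : ‖g (Complex.sqrt z) / γ r‖ ≤ 4 := by
      calc ‖g (Complex.sqrt z) / γ r‖ = ‖(g (Complex.sqrt z) / γ r - 1) + 1‖ := by ring_nf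
        _ ≤ 1 / 2 + 1 := (norm_add_le _ _).trans (by gcongr; simp)
        _ ≤ 4 := by norm_num
    rw [Real.sqrt_le_left (by norm_num)]; linarith

theorem contDiffAt_sqrt_sqrt (h : IsEntireProfile g γ) {ρ : ℝ} (hρ : 0 < ρ) :
    ContDiffAt ℝ (⊤ : ℕ∞) (fun x => √(γ (√x))) ρ := by
  have hs : ContDiffAt ℝ (⊤ : ℕ∞) Real.sqrt ρ := Real.contDiffAt_sqrt hρ.ne'
  have hr : 0 < √ρ := Real.sqrt_pos.2 hρ
  have hγ : ContDiffAt ℝ (⊤ : ℕ∞) γ (√ρ) := by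
    have h1 : ContDiff ℝ (⊤ : ℕ∞) fun x : ℝ => (g x).re :=
      (h.differentiable.contDiff (n := ((⊤ : ℕ∞) : WithTop ℕ∞))).real_of_complex
    refine h1.contDiffAt.congr_of_eventuallyEq ?_
    filter_upwards [lt_mem_nhds hr] with x hx
    rw [h.eq_ofReal x hx.le]; simp
  exact (Real.contDiffAt_sqrt (h.pos _ hr.le).ne').comp ρ (hγ.comp ρ hs)

/-- Away from the origin `ρ ↦ √γ(√ρ)` is a Schwartz function. -/
theorem exists_schwartzMap (h : IsEntireProfile g γ) {δ : ℝ} (hδ : 0 < δ) :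
    ∃ F : 𝓢(ℝ, ℝ), ∀ ρ, δ ≤ ρ → F ρ = √(γ (√ρ)) := by
  set S : ℝ → ℝ := fun x => √(γ (√x)) with hS
  set F : ℝ → ℝ := fun x => Real.smoothTransition (2 * x / δ - 1) * S x with hF
  have hF1 : ∀ ρ, δ ≤ ρ → F ρ = S ρ := by
    intro ρ hρ
    simp only [hF]
    rw [Real.smoothTransition.one_of_one_le, one_mul]
    rw [le_sub_iff_add_le, le_div_iff₀ hδ]; linarith
  have hF0 : ∀ ρ, ρ ≤ δ / 2 → F ρ = 0 := by
    intro ρ hρ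
    simp only [hF]
    rw [Real.smoothTransition.zero_of_nonpos, zero_mul]
    rw [sub_nonpos, div_le_iff₀ hδ]; linarith
  have hsm : ContDiff ℝ (⊤ : ℕ∞) F := by
    rw [contDiff_iff_contDiffAt]
    intro ρ
    rcases lt_or_ge ρ (δ / 2) with h1 | h1
    · refine (contDiffAt_const (c := (0:ℝ))).congr_of_eventuallyEq ?_
      filter_upwards [gt_mem_nhds h1] with x hx using hF0 x hx.le
    · have : ContDiff ℝ (⊤ : ℕ∞) fun x => Real.smoothTransition (2 * x / δ - 1) :=
        Real.smoothTransition.contDiff.comp (by fun_prop)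
      exact this.contDiffAt.mul (h.contDiffAt_sqrt_sqrt (by linarith))
  refine ⟨⟨F, hsm, fun k n => ?_⟩, hF1⟩
  obtain ⟨C, hC, hCb⟩ := h.exists_abs_iteratedDeriv_le n
  -- The square of `x^(k+n) √γ(√x)` is `(√x)^(4(k+n)) γ(√x)`.
  obtain ⟨D, hD⟩ := h.decay (4 * (k + n))
  set R := max 1 δ with hR
  have hR1 : 1 ≤ R := le_max_left _ _
  have hcont : Continuous fun x : ℝ => ‖x‖ ^ k * ‖iteratedFDeriv ℝ n F x‖ :=
    Continuous.mul (by fun_prop)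
      ((hsm.of_le (mod_cast le_top)).continuous_iteratedFDeriv'.norm)
  obtain ⟨B, hB⟩ := (isCompact_Icc (a := -R) (b := R)).bddAbove_image hcont.continuousOn
  refine ⟨max B (C * √D), fun x => ?_⟩
  rcases le_or_gt x R with hx | hx
  · rcases le_or_gt (-R) x with hx' | hx'
    · exact le_max_of_le_left (hB ⟨x, ⟨hx', hx⟩, rfl⟩)
    · have : iteratedDeriv n F x = 0 := by
        have h1 : F =ᶠ[𝓝 x] fun _ => 0 := by
          filter_upwards [gt_mem_nhds (show x < δ / 2 by linarith)] with y hy using hF0 y hy.le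
        rw [h1.iteratedDeriv_eq, iteratedDeriv_const]; simp
      rw [norm_iteratedFDeriv_eq_norm_iteratedDeriv, this]
      simp only [norm_zero, mul_zero]
      exact le_max_of_le_right (by positivity)
  · have hx1 : 1 ≤ x := by linarith
    have hxδ : δ < x := lt_of_le_of_lt (le_max_right _ _) hx
    have h1 : F =ᶠ[𝓝 x] S := by
      filter_upwards [lt_mem_nhds hxδ] with y hy using hF1 y hy.le
    rw [norm_iteratedFDeriv_eq_norm_iteratedDeriv, h1.iteratedDeriv_eq, Real.norm_eq_abs,
      Real.norm_eq_abs, abs_of_pos (by linarith : 0 < x)]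
    refine le_max_of_le_right ?_
    have h2 : x ^ (k + n) * √(γ (√x)) ≤ √D := by
      apply Real.le_sqrt_of_sq_le
      rw [mul_pow, Real.sq_sqrt (h.pos _ (Real.sqrt_nonneg _)).le]
      refine le_trans (le_of_eq ?_) (hD (√x) (Real.sqrt_nonneg _))
      congr 1
      rw [← pow_mul]
      conv_lhs => rw [← Real.sq_sqrt (by linarith : 0 ≤ x)]
      rw [← pow_mul]; congr 1; ring
    calc x ^ k * |iteratedDeriv n S x| ≤ x ^ k * (C * x ^ n * √(γ (√x))) := by
          gcongr
          exact hCb x hx1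
      _ = C * (x ^ (k + n) * √(γ (√x))) := by ring
      _ ≤ C * √D := by gcongr

/-- Regularizing at the origin, `x ↦ √γ(√(|x|² + δ))` is a Schwartz function. -/
theorem exists_schwartzMap_comp (h : IsEntireProfile g γ) {E : Type*} [NormedAddCommGroup E]
    [InnerProductSpace ℝ E] {δ : ℝ} (hδ : 0 < δ) :
    ∃ F : 𝓢(E, ℝ), ∀ x, F x = √(γ (√(‖x‖ ^ 2 + δ))) := by
  obtain ⟨F, hF⟩ := h.exists_schwartzMap hδ
  have hg : (fun x : E => ‖x‖ ^ 2 + δ).HasTemperateGrowth :=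
    (Function.hasTemperateGrowth_norm_sq E).add (Function.HasTemperateGrowth.const δ)
  refine ⟨SchwartzMap.compCLM ℝ hg ⟨1, 1, fun x => ?_⟩ F, fun x => ?_⟩
  · rw [Real.norm_of_nonneg (by positivity)]
    nlinarith [sq_nonneg (‖x‖ - 1)]
  · rw [SchwartzMap.compCLM_apply]
    exact hF _ (by simp)

/-- Outside a ball around the origin, `x ↦ √γ(|x|)` agrees with a Schwartz function. -/
theorem exists_schwartzMap_of_norm_ge (h : IsEntireProfile g γ) {E : Type*} [NormedAddCommGroup E]
    [InnerProductSpace ℝ E] {δ : ℝ} (hδ : 0 < δ) :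
    ∃ F : 𝓢(E, ℝ), ∀ x, δ ≤ ‖x‖ → F x = √(γ ‖x‖) := by
  obtain ⟨F, hF⟩ := h.exists_schwartzMap (show 0 < δ ^ 2 by positivity)
  refine ⟨SchwartzMap.compCLM ℝ (Function.hasTemperateGrowth_norm_sq E) ⟨1, 1, fun x => ?_⟩ F,
    fun x hx => ?_⟩
  · rw [Real.norm_of_nonneg (by positivity)]
    nlinarith [sq_nonneg (‖x‖ - 1)]
  · rw [SchwartzMap.compCLM_apply]
    simp only [Function.comp_apply]
    rw [hF _ (by gcongr), Real.sqrt_sq (norm_nonneg x)]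

end IsEntireProfile

/-! ### Polar coordinates and the radial profile of the symbol -/

/-- The surface area `2 π^{d/2} / Γ(d/2)` of the unit sphere of `ℝ^d`. -/
noncomputable def sphereArea (d : ℕ) : ℝ :=
  2 * Real.pi ^ ((d : ℝ) / 2) / Real.Gamma ((d : ℝ) / 2)

/-- The square of the kernel symbol as a function of the radius. -/
noncomputable def symbolProfile {d : ℕ} [NeZero d] (k : Rd d → ℝ) (r : ℝ) : ℝ :=
  sphereArea d * ∫ t in Set.Ioi r, t ^ (d - 1) * ‖fourierProfile k t‖ ^ 2

theorem kernelSymbol_eq {d : ℕ} [NeZero d] (k : Rd d → ℝ) (ζ : Rd d) :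
    kernelSymbol k ζ = √(symbolProfile k ‖ζ‖) := rfl

theorem sphereArea_pos (d : ℕ) [NeZero d] : 0 < sphereArea d := by
  have : (0:ℝ) < d := by exact_mod_cast NeZero.pos d
  have := Real.Gamma_pos_of_pos (show 0 < (d : ℝ) / 2 by positivity)
  unfold sphereArea; positivity

theorem sphereArea_eq (d : ℕ) [NeZero d] :
    sphereArea d = d * volume.real (Metric.ball (0 : Rd d) 1) := by
  have hd : (0:ℝ) < d := by exact_mod_cast NeZero.pos d
  have hG := Real.Gamma_pos_of_pos (show 0 < (d : ℝ) / 2 by positivity)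
  have : Nonempty (Fin d) := ⟨0⟩
  rw [Measure.real, EuclideanSpace.volume_ball, Real.Gamma_add_one (by positivity)]
  simp only [Fintype.card_fin, ENNReal.ofReal_one, one_pow, one_mul]
  rw [ENNReal.toReal_ofReal (by positivity), sphereArea, Real.sqrt_eq_rpow, ← Real.rpow_natCast,
    ← Real.rpow_mul Real.pi_pos.le]
  rw [show (1 / 2 * (d : ℝ)) = d / 2 by ring]
  field_simp

/-- Integration of radial functions in polar coordinates. -/
theorem integral_radial {d : ℕ} [NeZero d] (f : ℝ → ℝ) :
    ∫ x : Rd d, f ‖x‖ = sphereArea d * ∫ t in Set.Ioi (0:ℝ), t ^ (d - 1) * f t := by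
  have : Nontrivial (Rd d) := by
    have : Nonempty (Fin d) := ⟨0⟩
    infer_instance
  rw [integral_fun_norm_addHaar, sphereArea_eq, finrank_euclideanSpace_fin]
  simp [mul_assoc]

theorem exists_isometry_of_norm_eq {d : ℕ} {x y : Rd d} (h : ‖x‖ = ‖y‖) :
    ∃ A : Rd d ≃ₗᵢ[ℝ] Rd d, A x = y :=
  ⟨(ℝ ∙ (x - y))ᗮ.reflection, Submodule.reflection_sub h⟩

theorem IsRadial.comp_isometry {d : ℕ} {f : Rd d → ℝ} (hf : IsRadial f)
    (A : Rd d ≃ₗᵢ[ℝ] Rd d) : f ∘ A = f := by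
  ext x; exact hf _ _ (A.norm_map x)

theorem IsRadial.fourierReal_eq {d : ℕ} {f : Rd d → ℝ} (hf : IsRadial f) {x y : Rd d}
    (h : ‖x‖ = ‖y‖) : fourierReal f x = fourierReal f y := by
  obtain ⟨A, rfl⟩ := exists_isometry_of_norm_eq h
  have h1 := Real.fourier_comp_linearIsometry A (fun x => (f x : ℂ)) x
  have h2 : (fun x => (f x : ℂ)) ∘ A = fun x => (f x : ℂ) := by
    funext z
    simp only [Function.comp_apply]
    rw [← congrFun (hf.comp_isometry A) z, Function.comp_apply]
  rw [h2] at h1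
  exact h1

theorem IsRadial.fourierReal_eq_profile {d : ℕ} [NeZero d] {f : Rd d → ℝ} (hf : IsRadial f)
    (x : Rd d) : fourierReal f x = fourierProfile f ‖x‖ := by
  apply hf.fourierReal_eq
  simp [norm_smul]

namespace IsAdmissibleKernel

variable {d : ℕ} {k : Rd d → ℝ}

theorem hasCompactSupport_ofReal (hk : IsAdmissibleKernel k) :
    HasCompactSupport fun x => (k x : ℂ) :=
  hk.compact_support.comp_left (g := Complex.ofReal) Complex.ofReal_zero

theorem contDiff_ofReal (hk : IsAdmissibleKernel k) :
    ContDiff ℝ (⊤ : ℕ∞) fun x => (k x : ℂ) :=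
  Complex.ofRealCLM.contDiff.comp hk.smooth

/-- The kernel as a complex-valued Schwartz function. -/
noncomputable def schwartz (hk : IsAdmissibleKernel k) : 𝓢(Rd d, ℂ) :=
  hk.hasCompactSupport_ofReal.toSchwartzMap hk.contDiff_ofReal

theorem schwartz_apply (hk : IsAdmissibleKernel k) (x : Rd d) : hk.schwartz x = k x := rfl

theorem fourier_schwartz_apply (hk : IsAdmissibleKernel k) (ξ : Rd d) :
    𝓕 hk.schwartz ξ = fourierReal k ξ := rfl

theorem integrable (hk : IsAdmissibleKernel k) : Integrable k :=
  hk.smooth.continuous.integrable_of_hasCompactSupport hk.compact_support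

theorem integral_norm_sq_fourier (hk : IsAdmissibleKernel k) :
    ∫ ξ, ‖fourierReal k ξ‖ ^ 2 = 1 := by
  have := SchwartzMap.integral_norm_sq_fourier hk.schwartz
  simp only [fourier_schwartz_apply, schwartz_apply] at this
  rw [this, ← hk.integral_sq]
  simp

variable [NeZero d]

/-- The radial profile of the Fourier transform of the kernel is a Schwartz function. -/
noncomputable def profileSchwartz (hk : IsAdmissibleKernel k) : 𝓢(ℝ, ℂ) :=
  SchwartzMap.compCLMOfAntilipschitz ℝ
    (g := fun t : ℝ => t • EuclideanSpace.single (0 : Fin d) (1 : ℝ)) (K := 1)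
    ((ContinuousLinearMap.id ℝ ℝ).smulRight
      (EuclideanSpace.single (0 : Fin d) (1 : ℝ))).hasTemperateGrowth
    (AntilipschitzWith.of_le_mul_dist fun x y => by
      rw [dist_eq_norm, dist_eq_norm, ← sub_smul, norm_smul]; simp) (𝓕 hk.schwartz)

theorem profileSchwartz_apply (hk : IsAdmissibleKernel k) (t : ℝ) :
    hk.profileSchwartz t = fourierProfile k t := rfl

theorem continuous_fourierProfile (hk : IsAdmissibleKernel k) : Continuous (fourierProfile k) :=
  hk.profileSchwartz.continuous

theorem integrable_pow_mul_sq (hk : IsAdmissibleKernel k) (N : ℕ) :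
    Integrable fun t : ℝ => |t| ^ N * ‖fourierProfile k t‖ ^ 2 := by
  have h1 := hk.profileSchwartz.integrable_pow_mul volume N
  obtain ⟨C, hC⟩ := hk.profileSchwartz.decay 0 0
  have h2 : ∀ t, ‖fourierProfile k t‖ ≤ C := by
    intro t; simpa [profileSchwartz_apply] using hC.2 t
  refine (h1.mul_const C).mono' ?_ ?_
  · exact (Continuous.mul (by fun_prop) (hk.continuous_fourierProfile.norm.pow 2)).aestronglyMeasurable
  · filter_upwards with t
    rw [Real.norm_of_nonneg (by positivity), sq, ← mul_assoc]
    exact mul_le_mul_of_nonneg_left (h2 t) (by positivity)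

theorem integrableOn_Ioi (hk : IsAdmissibleKernel k) (N : ℕ) {r : ℝ} (hr : 0 ≤ r) :
    IntegrableOn (fun t : ℝ => t ^ N * ‖fourierProfile k t‖ ^ 2) (Set.Ioi r) := by
  refine (hk.integrable_pow_mul_sq N).integrableOn.congr_fun ?_ measurableSet_Ioi
  intro t ht
  simp only
  rw [abs_of_pos (lt_of_le_of_lt hr ht)]

/-- Plancherel in polar coordinates together with `∫ 𝔎² = 1`. This normalization is what gives the
convolution kernel total mass one. -/
theorem symbolProfile_zero (hk : IsAdmissibleKernel k) : symbolProfile k 0 = 1 := by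
  rw [symbolProfile, ← integral_radial (fun t => ‖fourierProfile k t‖ ^ 2),
    ← hk.integral_norm_sq_fourier]
  simp only [hk.radial.fourierReal_eq_profile]

theorem symbolProfile_nonneg (k : Rd d → ℝ) {r : ℝ} (hr : 0 ≤ r) : 0 ≤ symbolProfile k r := by
  refine mul_nonneg (sphereArea_pos d).le (setIntegral_nonneg measurableSet_Ioi fun t ht => ?_)
  have : 0 < t := lt_of_le_of_lt hr ht
  positivity

theorem symbolProfile_antitoneOn (hk : IsAdmissibleKernel k) :
    AntitoneOn (symbolProfile k) (Set.Ici 0) := by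
  intro r hr s hs hrs
  refine mul_le_mul_of_nonneg_left ?_ (sphereArea_pos d).le
  refine setIntegral_mono_set (hk.integrableOn_Ioi _ hr) ?_ (Set.Ioi_subset_Ioi hrs).eventuallyLE
  filter_upwards [ae_restrict_mem measurableSet_Ioi] with t ht
  have : 0 < t := lt_of_le_of_lt hr ht
  simp only [Pi.zero_apply]
  positivity

theorem symbolProfile_decay (hk : IsAdmissibleKernel k) (N : ℕ) :
    ∃ C : ℝ, ∀ r, 0 ≤ r → r ^ N * symbolProfile k r ≤ C := by
  refine ⟨sphereArea d * ∫ t in Set.Ioi (0:ℝ), t ^ (N + (d - 1)) * ‖fourierProfile k t‖ ^ 2,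
    fun r hr => ?_⟩
  rw [symbolProfile, mul_left_comm]
  refine mul_le_mul_of_nonneg_left ?_ (sphereArea_pos d).le
  rw [← integral_const_mul]
  calc ∫ t in Set.Ioi r, r ^ N * (t ^ (d - 1) * ‖fourierProfile k t‖ ^ 2)
      ≤ ∫ t in Set.Ioi r, t ^ (N + (d - 1)) * ‖fourierProfile k t‖ ^ 2 := by
        refine setIntegral_mono_on ((hk.integrableOn_Ioi _ hr).const_mul _)
          (hk.integrableOn_Ioi _ hr) measurableSet_Ioi fun t ht => ?_
        have : r < t := ht
        have h0 : 0 ≤ t := by linarith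
        rw [← mul_assoc, pow_add]
        gcongr
    _ ≤ _ := by
        refine setIntegral_mono_set (hk.integrableOn_Ioi _ le_rfl) ?_
          (Set.Ioi_subset_Ioi hr).eventuallyLE
        filter_upwards [ae_restrict_mem measurableSet_Ioi] with t ht
        have : 0 < t := ht
        simp only [Pi.zero_apply]
        positivity

/-- Replaces the tail integral by an integral starting at `0`, which has an evident holomorphic
extension and an evident expansion at the origin. -/
theorem symbolProfile_eq_one_sub (hk : IsAdmissibleKernel k) {r : ℝ} (hr : 0 ≤ r) :
    symbolProfile k r =
      1 - sphereArea d * ∫ t in (0:ℝ)..r, t ^ (d - 1) * ‖fourierProfile k t‖ ^ 2 := by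
  have h := intervalIntegral.integral_Ioi_sub_Ioi (hk.integrableOn_Ioi (d - 1) le_rfl) hr
  rw [← h, mul_sub, ← symbolProfile, ← symbolProfile, hk.symbolProfile_zero]
  ring

end IsAdmissibleKernel

/-! ### The Fourier transform along a line as an entire function -/

/-- The Fourier-Laplace transform of `k` along the first coordinate axis. -/
noncomputable def fourierLaplace {d : ℕ} [NeZero d] (k : Rd d → ℝ) (z : ℂ) : ℂ :=
  ∫ x : Rd d, (k x : ℂ) * Complex.exp (-2 * Real.pi * Complex.I * (x 0 : ℝ) * z)

theorem fourierProfile_eq_fourierLaplace {d : ℕ} [NeZero d] (k : Rd d → ℝ) (t : ℝ) :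
    fourierProfile k t = fourierLaplace k t := by
  rw [fourierProfile, fourierReal, Real.fourier_eq', fourierLaplace]
  congr 1
  ext x
  rw [smul_eq_mul, mul_comm]
  congr 2
  rw [inner_smul_right, EuclideanSpace.inner_single_right]
  push_cast
  simp
  ring

theorem conj_fourierLaplace_ofReal {d : ℕ} [NeZero d] (k : Rd d → ℝ) (t : ℝ) :
    (starRingEnd ℂ) (fourierLaplace k t) = fourierLaplace k (-t) := by
  rw [fourierLaplace, fourierLaplace, ← integral_conj]
  congr 1
  ext x
  rw [map_mul, Complex.conj_ofReal, ← Complex.exp_conj]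
  congr 2
  simp [Complex.conj_ofNat]

/-- Since the kernel is real, conjugation on the real axis is `t ↦ -t`. The right-hand side, unlike
the left, makes sense holomorphically for complex `t`. -/
theorem norm_sq_fourierProfile {d : ℕ} [NeZero d] (k : Rd d → ℝ) (t : ℝ) :
    ((‖fourierProfile k t‖ ^ 2 : ℝ) : ℂ) = fourierLaplace k t * fourierLaplace k (-t) := by
  rw [fourierProfile_eq_fourierLaplace, ← conj_fourierLaplace_ofReal, Complex.mul_conj,
    Complex.normSq_eq_norm_sq]

namespace IsAdmissibleKernel

variable {d : ℕ} [NeZero d] {k : Rd d → ℝ}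

theorem exists_radius (hk : IsAdmissibleKernel k) :
    ∃ R : ℝ, 0 < R ∧ ∀ x, k x ≠ 0 → |x 0| ≤ R := by
  obtain ⟨R, hR⟩ := hk.compact_support.isCompact.isBounded.subset_closedBall 0
  refine ⟨max R 1, by positivity, fun x hx => ?_⟩
  have : ‖x‖ ≤ R := by simpa using hR (subset_tsupport _ hx)
  exact ((EuclideanSpace.norm_eq x ▸ PiLp.norm_apply_le x 0 : ‖x 0‖ ≤ ‖x‖).trans this).trans
    (le_max_left _ _)

theorem norm_integrand_le {R : ℝ} (_ : 0 ≤ R) (hkR : ∀ x, k x ≠ 0 → |x 0| ≤ R) (x : Rd d) (z : ℂ) :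
    ‖(k x : ℂ) * Complex.exp (-2 * Real.pi * Complex.I * (x 0 : ℝ) * z)‖ ≤
      |k x| * Real.exp (2 * Real.pi * R * ‖z‖) := by
  rcases eq_or_ne (k x) 0 with h0 | h0
  · simp [h0]
  · rw [norm_mul, Complex.norm_real, Complex.norm_exp, Real.norm_eq_abs]
    gcongr
    calc (-2 * Real.pi * Complex.I * (x 0 : ℝ) * z : ℂ).re
        ≤ ‖(-2 * Real.pi * Complex.I * (x 0 : ℝ) * z : ℂ)‖ := Complex.re_le_norm _
      _ = 2 * Real.pi * |x 0| * ‖z‖ := by simp [abs_of_pos Real.pi_pos]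
      _ ≤ _ := by gcongr; exact hkR x h0

theorem differentiable_fourierLaplace (hk : IsAdmissibleKernel k) :
    Differentiable ℂ (fourierLaplace k) := by
  obtain ⟨R, hR, hkR⟩ := hk.exists_radius
  intro z
  have hint := hk.integrable
  refine (hasDerivAt_integral_of_dominated_loc_of_deriv_le
    (F := fun z (x : Rd d) => (k x : ℂ) * Complex.exp (-2 * Real.pi * Complex.I * (x 0 : ℝ) * z))
    (F' := fun z (x : Rd d) => (-2 * Real.pi * Complex.I * (x 0 : ℝ)) *
      ((k x : ℂ) * Complex.exp (-2 * Real.pi * Complex.I * (x 0 : ℝ) * z)))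
    (s := Metric.ball z 1)
    (bound := fun x => (2 * Real.pi * R) * (|k x| * Real.exp (2 * Real.pi * R * (‖z‖ + 1))))
    (Metric.ball_mem_nhds z one_pos) ?_ ?_ ?_ ?_ ?_ ?_).2.differentiableAt
  · refine Eventually.of_forall fun w => Continuous.aestronglyMeasurable ?_
    have := hk.smooth.continuous
    fun_prop
  · refine (hint.abs.mul_const (Real.exp (2 * Real.pi * R * ‖z‖))).mono' ?_
      (ae_of_all _ fun x => norm_integrand_le hR.le hkR x z)
    refine Continuous.aestronglyMeasurable ?_
    have := hk.smooth.continuous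
    fun_prop
  · refine Continuous.aestronglyMeasurable ?_
    have := hk.smooth.continuous
    fun_prop
  · refine ae_of_all _ fun x w hw => ?_
    have hwz : ‖w‖ ≤ ‖z‖ + 1 := by
      rw [Metric.mem_ball, dist_eq_norm] at hw
      calc ‖w‖ = ‖z + (w - z)‖ := by ring_nf
        _ ≤ ‖z‖ + 1 := (norm_add_le _ _).trans (by gcongr)
    rcases eq_or_ne (k x) 0 with h0 | h0
    · simp [h0]
    rw [norm_mul]
    gcongr
    · simp [abs_of_pos Real.pi_pos]
      gcongr
      exact hkR x h0
    · refine (norm_integrand_le hR.le hkR x w).trans ?_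
      gcongr
  · exact (hint.abs.mul_const _).const_mul _
  · refine ae_of_all _ fun x w _ => ?_
    have h1 : HasDerivAt (fun w : ℂ => -2 * Real.pi * Complex.I * (x 0 : ℝ) * w)
        (-2 * Real.pi * Complex.I * (x 0 : ℝ)) w := by
      simpa using (hasDerivAt_id w).const_mul (-2 * Real.pi * Complex.I * (x 0 : ℝ) : ℂ)
    have h2 := (h1.cexp).const_mul (k x : ℂ)
    rwa [mul_left_comm, mul_comm (-2 * Real.pi * Complex.I * (x 0 : ℝ) : ℂ)]

/-- The easy half of Paley–Wiener: the exponential in the integrand is at most `e^{2πR|z|}` on the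
support of the kernel. -/
theorem fourierLaplace_growth (hk : IsAdmissibleKernel k) :
    ∃ C : ℝ, 0 < C ∧ ∀ z, ‖fourierLaplace k z‖ ≤ C * Real.exp (C * ‖z‖) := by
  obtain ⟨R, hR, hkR⟩ := hk.exists_radius
  set I := ∫ x, |k x|
  have hI : 0 ≤ I := integral_nonneg fun x => abs_nonneg _
  refine ⟨I + 2 * Real.pi * R, by positivity, fun z => ?_⟩
  calc ‖fourierLaplace k z‖ ≤ ∫ x, |k x| * Real.exp (2 * Real.pi * R * ‖z‖) :=
        norm_integral_le_of_norm_le (hk.integrable.abs.mul_const _)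
          (ae_of_all _ fun x => norm_integrand_le hR.le hkR x z)
    _ = I * Real.exp (2 * Real.pi * R * ‖z‖) := integral_mul_const _ _
    _ ≤ _ := by
        gcongr
        · have : 0 < Real.pi := Real.pi_pos
          nlinarith [mul_pos Real.pi_pos hR]
        · linarith

/-- The square of the symbol is the restriction of an entire function of exponential type. -/
theorem exists_entire (hk : IsAdmissibleKernel k) :
    ∃ g : ℂ → ℂ, Differentiable ℂ g ∧ (∀ r : ℝ, 0 ≤ r → g r = symbolProfile k r) ∧
      ∃ C : ℝ, 0 < C ∧ ∀ z, ‖g z‖ ≤ C * Real.exp (C * ‖z‖) := by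
  set f : ℂ → ℂ := fun z => z ^ (d - 1) * (fourierLaplace k z * fourierLaplace k (-z)) with hf
  have hP := hk.differentiable_fourierLaplace
  have hfd : Differentiable ℂ f :=
    (differentiable_id.pow _).mul (hP.mul (hP.comp differentiable_neg))
  obtain ⟨G, hG⟩ := hfd.isExactOn_univ
  simp only [Set.mem_univ, true_imp_iff] at hG
  obtain ⟨C, hC, hCP⟩ := hk.fourierLaplace_growth
  have hc := sphereArea_pos d
  set c := sphereArea d with hcdef
  -- `G` is an entire primitive of `z^(d-1) k̂(z) k̂(-z)`, so on the half-line this is `1` minus the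
  -- integral from `0` to `r`.
  refine ⟨fun z => 1 - c * (G z - G 0), ?_, ?_, ?_⟩
  · have : Differentiable ℂ G := fun z => (hG z).differentiableAt
    fun_prop
  · intro r hr
    rw [hk.symbolProfile_eq_one_sub hr]
    push_cast
    congr 2
    have h1 : ∫ t in (0:ℝ)..r, f t = G r - G 0 := by
      have := intervalIntegral.integral_eq_sub_of_hasDerivAt (f := fun t : ℝ => G t)
        (f' := fun t : ℝ => f t) (a := 0) (b := r) (fun t _ => (hG t).comp_ofReal)
        ((hfd.continuous.comp Complex.continuous_ofReal).intervalIntegrable _ _)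
      simpa using this
    rw [← h1, ← intervalIntegral.integral_ofReal]
    congr 1
    ext t
    rw [hf]
    simp only
    rw [← norm_sq_fourierProfile]
    push_cast
    ring
  · have hGb : ∀ z, ‖G z - G 0‖ ≤ (‖z‖ ^ (d - 1) * (C * Real.exp (C * ‖z‖)) ^ 2) * ‖z‖ := by
      intro z
      have := (convex_closedBall (0:ℂ) ‖z‖).norm_image_sub_le_of_norm_hasDerivWithin_le
        (f := G) (f' := f) (C := ‖z‖ ^ (d - 1) * (C * Real.exp (C * ‖z‖)) ^ 2) (x := 0) (y := z)
        (fun w _ => (hG w).hasDerivWithinAt) ?_ (by simp) (by simp)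
      · simpa using this
      · intro w hw
        have hw' : ‖w‖ ≤ ‖z‖ := by simpa using hw
        simp only [hf]
        rw [norm_mul, norm_mul, norm_pow, sq]
        have e1 : C * Real.exp (C * ‖w‖) ≤ C * Real.exp (C * ‖z‖) := by gcongr
        have h1 := (hCP w).trans e1
        have h2 := hCP (-w)
        rw [norm_neg] at h2
        have h2 := h2.trans e1
        gcongr
    refine ⟨1 + c * (d.factorial * C ^ 2) + (1 + 2 * C), by positivity, fun z => ?_⟩
    have hfac : ‖z‖ ^ d ≤ d.factorial * Real.exp ‖z‖ := by
      have := Real.pow_div_factorial_le_exp ‖z‖ (norm_nonneg _) d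
      rwa [div_le_iff₀ (by positivity), mul_comm] at this
    calc ‖1 - (c:ℂ) * (G z - G 0)‖ ≤ 1 + c * ‖G z - G 0‖ := by
          refine (norm_sub_le _ _).trans ?_
          rw [norm_mul, Complex.norm_real, Real.norm_of_nonneg hc.le]; simp
      _ ≤ 1 + c * ((‖z‖ ^ (d - 1) * (C * Real.exp (C * ‖z‖)) ^ 2) * ‖z‖) := by
          gcongr; exact hGb z
      _ = 1 + c * (‖z‖ ^ d * C ^ 2 * Real.exp (2 * C * ‖z‖)) := by
          have : ‖z‖ ^ d = ‖z‖ ^ (d - 1) * ‖z‖ := by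
            rw [← pow_succ, Nat.sub_add_cancel (NeZero.pos d)]
          rw [this, mul_pow, ← Real.exp_nat_mul]; push_cast; ring_nf
      _ ≤ 1 * Real.exp ((1 + 2 * C) * ‖z‖) + c * (d.factorial * Real.exp ‖z‖ * C ^ 2 * Real.exp (2 * C * ‖z‖)) := by
          gcongr
          rw [one_mul]; exact Real.one_le_exp (by positivity)
      _ = (1 + c * (d.factorial * C ^ 2)) * Real.exp ((1 + 2 * C) * ‖z‖) := by
          rw [show (1 + 2 * C) * ‖z‖ = ‖z‖ + 2 * C * ‖z‖ by ring, Real.exp_add]; ring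
      _ ≤ _ := by
          have h1 : 0 ≤ c * (d.factorial * C ^ 2) := by positivity
          exact mul_le_mul (by linarith) (Real.exp_le_exp.2 (mul_le_mul_of_nonneg_right
            (by linarith) (norm_nonneg z))) (Real.exp_pos _).le (by positivity)

/-- A zero at `r` would, by monotonicity and nonnegativity, persist on all of `[r, ∞)`. The identity
theorem would then kill the entire extension, contradicting the value `1` at the origin. -/
theorem symbolProfile_pos (hk : IsAdmissibleKernel k) {r : ℝ} (hr : 0 ≤ r) :
    0 < symbolProfile k r := by
  refine lt_of_le_of_ne (symbolProfile_nonneg k hr) fun h0 => ?_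
  obtain ⟨g, hg, hgr, -⟩ := hk.exists_entire
  have hzero : ∀ s : ℝ, r ≤ s → g s = 0 := by
    intro s hs
    have hs0 := hr.trans hs
    rw [hgr s hs0]
    have h1 := hk.symbolProfile_antitoneOn hr hs0 hs
    rw [← h0] at h1
    rw [le_antisymm h1 (symbolProfile_nonneg k hs0)]; simp
  have hall : g = 0 := by
    refine (hg.differentiableOn.analyticOnNhd isOpen_univ).eq_of_frequently_eq
      (z₀ := ((r : ℝ) : ℂ)) analyticOnNhd_const ?_
    have h2 : ∃ᶠ s : ℝ in 𝓝[≠] r, r < s :=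
      (eventually_nhdsWithin_of_forall (s := Set.Ioi r) (a := r) fun x hx => hx).frequently.filter_mono
        (nhdsWithin_mono r fun x hx => ne_of_gt hx)
    have h3 : Tendsto (fun s : ℝ => (s : ℂ)) (𝓝[≠] r) (𝓝[≠] (r : ℂ)) :=
      Complex.continuous_ofReal.continuousAt.continuousWithinAt.tendsto_nhdsWithin
        fun x hx => by simpa using hx
    exact h3.frequently (h2.mono fun s hs => hzero s hs.le)
  have := hgr 0 le_rfl
  rw [hk.symbolProfile_zero, hall] at this
  simp at this

theorem exists_isEntireProfile (hk : IsAdmissibleKernel k) :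
    ∃ g : ℂ → ℂ, IsEntireProfile g (symbolProfile k) := by
  obtain ⟨g, hg, hgr, hgrowth⟩ := hk.exists_entire
  exact ⟨g, hg, hgr, hk.symbolProfile_antitoneOn, fun r hr => hk.symbolProfile_pos hr, hgrowth,
    hk.symbolProfile_decay⟩

end IsAdmissibleKernel

/-! ### Smooth families: integrals with parameters and uniform Fourier decay -/

/-- Smoothness of an integral over the unit interval depending on a parameter. -/
theorem contDiff_intervalIntegral_param {E : Type*} [NormedAddCommGroup E] [NormedSpace ℝ E]
    {F : E × ℝ → ℝ} (hF : ContDiff ℝ (⊤ : ℕ∞) F) {w : ℝ → ℝ} (hw : Continuous w) :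
    ContDiff ℝ (⊤ : ℕ∞) fun x => ∫ s in (0:ℝ)..1, w s * F (x, s) := by
  -- The integral is the value at `0` of a convolution in `s`. The bump supplies the compact support
  -- required for smoothness in the parameter, and equals `1` for the relevant arguments `-s`, `0 <
  -- s ≤ 1`.
  let b : ContDiffBump (0:ℝ) := ⟨2, 3, by norm_num, by norm_num⟩
  have key := contDiffOn_convolution_right_with_param_comp (n := ⊤) (μ := (volume : Measure ℝ))
    (ContinuousLinearMap.mul ℝ ℝ) (s := (Set.univ : Set E)) (v := fun _ => (0:ℝ))
    (f := Set.indicator (Set.Ioc 0 1) w) (g := fun x u => b u * F (x, -u))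
    (k := Metric.closedBall 0 3) contDiffOn_const isOpen_univ (isCompact_closedBall _ _) ?_ ?_ ?_
  · rw [contDiffOn_univ] at key
    convert key using 2 with x
    rw [convolution_def, intervalIntegral.integral_of_le zero_le_one,
      ← integral_indicator measurableSet_Ioc]
    congr 1
    ext s
    by_cases hs : s ∈ Set.Ioc (0:ℝ) 1
    · have : b (0 - s) = 1 := by
        apply b.one_of_mem_closedBall
        simp only [Metric.mem_closedBall, zero_sub, dist_zero_right, norm_neg, Real.norm_eq_abs]
        rw [abs_of_pos hs.1]
        exact hs.2.trans (by norm_num [b])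
      rw [zero_sub] at this
      simp [hs, this]
    · simp [hs]
  · intro x u _ hu
    have : b u = 0 := b.zero_of_le_dist (by
      simp only [Metric.mem_closedBall, not_le] at hu; exact hu.le)
    simp [this]
  · refine (IntegrableOn.integrable_indicator ?_ measurableSet_Ioc).locallyIntegrable
    exact (hw.integrableOn_Icc).mono_set Set.Ioc_subset_Icc_self
  · have h1 : ContDiff ℝ (⊤ : ℕ∞) fun p : E × ℝ => b p.2 * F (p.1, -p.2) :=
      (b.contDiff.comp contDiff_snd).mul (hF.comp (contDiff_fst.prodMk contDiff_snd.neg))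
    exact h1.contDiffOn

theorem norm_iteratedFDeriv_slice_le {E F G : Type*} [NormedAddCommGroup E] [NormedSpace ℝ E]
    [NormedAddCommGroup F] [NormedSpace ℝ F] [NormedAddCommGroup G] [NormedSpace ℝ G]
    {Φ : E × F → G} (hΦ : ContDiff ℝ (⊤ : ℕ∞) Φ) (n : ℕ) (a : E) (x : F) :
    ‖iteratedFDeriv ℝ n (fun y => Φ (a, y)) x‖ ≤ ‖iteratedFDeriv ℝ n Φ (a, x)‖ := by
  have h1 : (fun y => Φ (a, y)) =
      (fun p => Φ ((a, 0) + p)) ∘ (ContinuousLinearMap.inr ℝ E F) := by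
    ext y; simp
  have h2 : ContDiff ℝ (⊤ : ℕ∞) (fun p => Φ ((a, 0) + p)) :=
    hΦ.comp (contDiff_const.add contDiff_id)
  rw [h1, ContinuousLinearMap.iteratedFDeriv_comp_right _ h2 _ (mod_cast le_top),
    iteratedFDeriv_comp_add_left]
  refine (ContinuousMultilinearMap.norm_compContinuousLinearMap_le _ _).trans ?_
  simp only [ContinuousLinearMap.inr_apply, Prod.mk_add_mk, add_zero, zero_add]
  refine mul_le_of_le_one_right (norm_nonneg _) (Finset.prod_le_one (fun _ _ => norm_nonneg _)
    fun _ _ => ContinuousLinearMap.norm_inr_le_one ℝ E F)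

/-- Fourier transforms of a smooth family of functions with common compact support decay
rapidly, uniformly for parameters in a compact set. -/
theorem exists_forall_norm_pow_mul_fourier_le {d : ℕ} {Φ : ℝ × Rd d → ℂ}
    (hΦ : ContDiff ℝ (⊤ : ℕ∞) Φ) {R : ℝ} (hR : ∀ a x, R < ‖x‖ → Φ (a, x) = 0) (N : ℕ) :
    ∃ C : ℝ, 0 ≤ C ∧ ∀ a ∈ Set.Icc (0:ℝ) 1, ∀ ξ,
      ‖ξ‖ ^ N * ‖𝓕 (fun x => Φ (a, x)) ξ‖ ≤ C := by
  have hM : ∀ n : ℕ, ∃ M : ℝ, ∀ a ∈ Set.Icc (0:ℝ) 1, ∀ x ∈ Metric.closedBall (0 : Rd d) R,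
      ‖iteratedFDeriv ℝ n Φ (a, x)‖ ≤ M := by
    intro n
    have hc : Continuous fun p => ‖iteratedFDeriv ℝ n Φ p‖ :=
      (hΦ.of_le (mod_cast le_top)).continuous_iteratedFDeriv'.norm
    obtain ⟨M, hM⟩ := ((isCompact_Icc (a := (0:ℝ)) (b := 1)).prod
      (isCompact_closedBall (0 : Rd d) R)).bddAbove_image hc.continuousOn
    exact ⟨M, fun a ha x hx => hM ⟨(a, x), ⟨ha, hx⟩, rfl⟩⟩
  choose M hM using hM
  set V := volume.real (Metric.closedBall (0 : Rd d) R)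
  have hslice : ∀ a, ContDiff ℝ (⊤ : ℕ∞) fun x => Φ (a, x) := fun a =>
    hΦ.comp (contDiff_const.prodMk contDiff_id)
  have hsupp : ∀ a, tsupport (fun x => Φ (a, x)) ⊆ Metric.closedBall 0 R := by
    intro a
    refine closure_minimal (fun x hx => ?_) Metric.isClosed_closedBall
    by_contra h
    simp only [Metric.mem_closedBall, dist_zero_right, not_le] at h
    exact hx (hR a x h)
  have hcs : ∀ a, HasCompactSupport fun x => Φ (a, x) := fun a =>
    (isCompact_closedBall (0 : Rd d) R).of_isClosed_subset (isClosed_tsupport _) (hsupp a)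
  have hzero : ∀ a n x, x ∉ Metric.closedBall (0 : Rd d) R →
      iteratedFDeriv ℝ n (fun x => Φ (a, x)) x = 0 := by
    intro a n x hx
    by_contra h
    exact hx (hsupp a (support_iteratedFDeriv_subset n h))
  have hcont : ∀ a (n : ℕ), Continuous fun x => ‖iteratedFDeriv ℝ n (fun x => Φ (a, x)) x‖ :=
    fun a n => ((hslice a).of_le (mod_cast le_top)).continuous_iteratedFDeriv'.norm
  refine ⟨(2 * Real.pi) ^ 0 * (2 * (0:ℕ) + 2) ^ N *
    ∑ p ∈ Finset.range (0 + 1) ×ˢ Finset.range (N + 1), |M p.2| * V, by positivity,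
    fun a ha ξ => ?_⟩
  have key := Real.pow_mul_norm_iteratedFDeriv_fourier_le (K := 0) (N := N)
    (f := fun x => Φ (a, x)) ((hslice a).of_le (mod_cast le_top)) (fun k n hk hn => ?_)
    (k := 0) (n := N) le_rfl le_rfl ξ
  · rw [norm_iteratedFDeriv_zero] at key
    refine key.trans ?_
    gcongr with p hp
    have hp1 : p.1 = 0 := by simpa using (Finset.mem_product.1 hp).1
    simp only [hp1, pow_zero, one_mul]
    calc ∫ v, ‖iteratedFDeriv ℝ p.2 (fun x => Φ (a, x)) v‖
        = ∫ v in Metric.closedBall (0 : Rd d) R, ‖iteratedFDeriv ℝ p.2 (fun x => Φ (a, x)) v‖ := by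
          rw [setIntegral_eq_integral_of_forall_compl_eq_zero]
          intro x hx; rw [hzero a _ x hx, norm_zero]
      _ ≤ ∫ v in Metric.closedBall (0 : Rd d) R, |M p.2| := by
          refine setIntegral_mono_on ((hcont a _).continuousOn.integrableOn_compact
            (isCompact_closedBall _ _)) (continuous_const.continuousOn.integrableOn_compact
              (isCompact_closedBall _ _)) measurableSet_closedBall fun x hx => ?_
          exact (norm_iteratedFDeriv_slice_le hΦ _ a x).trans ((hM _ a ha x hx).trans (le_abs_self _))
      _ = |M p.2| * V := by rw [setIntegral_const, smul_eq_mul, mul_comm]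
  · refine Continuous.integrable_of_hasCompactSupport (Continuous.mul (by fun_prop) (hcont a n)) ?_
    exact ((hcs a).iteratedFDeriv n).norm.mul_left

/-! ### The symbol near the origin and its dyadic pieces -/

/-- The smooth function `m` with `σ(ζ)² = 1 - ‖ζ‖^d m(ζ)`. -/
noncomputable def symbolDefect {d : ℕ} [NeZero d] (k : Rd d → ℝ) (ζ : Rd d) : ℝ :=
  sphereArea d * ∫ s in (0:ℝ)..1, s ^ (d - 1) * ‖fourierReal k (s • ζ)‖ ^ 2

theorem contDiff_norm_pow_of_even {E : Type*} [NormedAddCommGroup E] [InnerProductSpace ℝ E]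
    {n : ℕ} (hn : Even n) : ContDiff ℝ (⊤ : ℕ∞) fun x : E => ‖x‖ ^ n := by
  obtain ⟨m, rfl⟩ := hn
  have : (fun x : E => ‖x‖ ^ (m + m)) = fun x => (‖x‖ ^ 2) ^ m := by
    ext x; rw [← pow_mul, two_mul]
  rw [this]
  exact (contDiff_norm_sq ℝ).pow m

/-- A smooth cutoff function, equal to one on the unit ball. -/
noncomputable def cutoff (d : ℕ) : ContDiffBump (0 : Rd d) := ⟨1, 2, one_pos, one_lt_two⟩

theorem cutoff_eq_one {d : ℕ} {x : Rd d} (h : ‖x‖ ≤ 1) : cutoff d x = 1 :=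
  (cutoff d).one_of_mem_closedBall (mem_closedBall_zero_iff.2 h)

theorem cutoff_eq_zero {d : ℕ} {x : Rd d} (h : 2 ≤ ‖x‖) : cutoff d x = 0 :=
  (cutoff d).zero_of_le_dist ((dist_zero_right x).symm ▸ h)

namespace IsAdmissibleKernel

variable {d : ℕ} [NeZero d] {k : Rd d → ℝ}

theorem contDiff_symbolDefect (hk : IsAdmissibleKernel k) :
    ContDiff ℝ (⊤ : ℕ∞) (symbolDefect k) := by
  have h1 : ContDiff ℝ (⊤ : ℕ∞) fun p : Rd d × ℝ => ‖𝓕 hk.schwartz (p.2 • p.1)‖ ^ 2 :=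
    (((𝓕 hk.schwartz).smooth ⊤).comp (contDiff_snd.smul contDiff_fst)).norm_sq ℝ
  exact contDiff_const.mul
    (contDiff_intervalIntegral_param h1 (w := fun s => s ^ (d - 1)) (by fun_prop))

/-- Substitute `t = ‖ζ‖ s` in the integral from `0` to `‖ζ‖`: all non-smoothness at the origin is
carried by the explicit factor `‖ζ‖ ^ d`. -/
theorem symbolProfile_norm (hk : IsAdmissibleKernel k) (ζ : Rd d) :
    symbolProfile k ‖ζ‖ = 1 - ‖ζ‖ ^ d * symbolDefect k ζ := by
  rw [hk.symbolProfile_eq_one_sub (norm_nonneg _), symbolDefect]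
  have h1 := intervalIntegral.smul_integral_comp_mul_left (a := 0) (b := 1)
    (fun t => t ^ (d - 1) * ‖fourierProfile k t‖ ^ 2) ‖ζ‖
  rw [mul_zero, mul_one] at h1
  rw [← h1, smul_eq_mul]
  have h2 : ∫ s in (0:ℝ)..1, (‖ζ‖ * s) ^ (d - 1) * ‖fourierProfile k (‖ζ‖ * s)‖ ^ 2 =
      ‖ζ‖ ^ (d - 1) * ∫ s in (0:ℝ)..1, s ^ (d - 1) * ‖fourierReal k (s • ζ)‖ ^ 2 := by
    rw [← intervalIntegral.integral_const_mul]
    refine intervalIntegral.integral_congr fun s hs => ?_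
    rw [Set.uIcc_of_le zero_le_one] at hs
    rw [hk.radial.fourierReal_eq_profile, norm_smul, Real.norm_of_nonneg hs.1, mul_pow,
      mul_comm s, mul_assoc]
  rw [h2]
  have h3 : ‖ζ‖ ^ d = ‖ζ‖ * ‖ζ‖ ^ (d - 1) := by
    rw [← pow_succ', Nat.sub_add_cancel (NeZero.pos d)]
  rw [h3]; ring

theorem kernelSymbol_sq (hk : IsAdmissibleKernel k) (ζ : Rd d) :
    kernelSymbol k ζ ^ 2 = 1 - ‖ζ‖ ^ d * symbolDefect k ζ := by
  rw [kernelSymbol_eq, Real.sq_sqrt (symbolProfile_nonneg k (norm_nonneg _)),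
    hk.symbolProfile_norm]

theorem kernelSymbol_eq_sqrt (hk : IsAdmissibleKernel k) :
    kernelSymbol k = fun ζ => √(1 - ‖ζ‖ ^ d * symbolDefect k ζ) := by
  ext ζ; rw [kernelSymbol_eq, hk.symbolProfile_norm]

theorem one_sub_pos (hk : IsAdmissibleKernel k) (ζ : Rd d) :
    0 < 1 - ‖ζ‖ ^ d * symbolDefect k ζ := by
  rw [← hk.symbolProfile_norm]; exact hk.symbolProfile_pos (norm_nonneg _)

theorem kernelSymbol_pos (hk : IsAdmissibleKernel k) (ζ : Rd d) : 0 < kernelSymbol k ζ :=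
  Real.sqrt_pos.2 (hk.symbolProfile_pos (norm_nonneg _))

theorem kernelSymbol_zero (hk : IsAdmissibleKernel k) : kernelSymbol k 0 = 1 := by
  rw [kernelSymbol_eq, norm_zero, hk.symbolProfile_zero, Real.sqrt_one]

theorem kernelSymbol_anti (hk : IsAdmissibleKernel k) {ζ η : Rd d} (h : ‖ζ‖ ≤ ‖η‖) :
    kernelSymbol k η ≤ kernelSymbol k ζ :=
  Real.sqrt_le_sqrt (hk.symbolProfile_antitoneOn (norm_nonneg _) (norm_nonneg _) h)

theorem kernelSymbol_le_one (hk : IsAdmissibleKernel k) (ζ : Rd d) : kernelSymbol k ζ ≤ 1 := by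
  rw [← hk.kernelSymbol_zero]; exact hk.kernelSymbol_anti (by simp)

theorem continuous_kernelSymbol (hk : IsAdmissibleKernel k) : Continuous (kernelSymbol k) := by
  rw [hk.kernelSymbol_eq_sqrt]
  have := hk.contDiff_symbolDefect.continuous
  fun_prop

/-- The symbol is a Schwartz function up to its localization at the origin. -/
theorem exists_schwartzMap_add_cutoff (hk : IsAdmissibleKernel k) :
    ∃ G : 𝓢(Rd d, ℝ), ∀ ζ, kernelSymbol k ζ = G ζ + cutoff d ζ * kernelSymbol k ζ := by
  obtain ⟨g, hg⟩ := hk.exists_isEntireProfile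
  obtain ⟨F, hF⟩ := hg.exists_schwartzMap_of_norm_ge (E := Rd d) one_pos
  have h1 : ContDiff ℝ (⊤ : ℕ∞) fun x => cutoff d x * F x :=
    (cutoff d).contDiff.mul (F.smooth ⊤)
  have h2 : HasCompactSupport fun x => cutoff d x * F x :=
    (cutoff d).hasCompactSupport.mul_right
  refine ⟨F - h2.toSchwartzMap h1, fun ζ => ?_⟩
  rw [sub_apply]
  change _ = F ζ - cutoff d ζ * F ζ + _
  rcases le_or_gt 1 ‖ζ‖ with h | h
  · rw [hF ζ h, ← kernelSymbol_eq]; ring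
  · rw [cutoff_eq_one h.le]; ring

theorem integrable_kernelSymbol (hk : IsAdmissibleKernel k) : Integrable (kernelSymbol k) := by
  obtain ⟨G, hG⟩ := hk.exists_schwartzMap_add_cutoff
  have h1 : Integrable fun ζ => cutoff d ζ * kernelSymbol k ζ :=
    ((cutoff d).continuous.mul hk.continuous_kernelSymbol).integrable_of_hasCompactSupport
      (cutoff d).hasCompactSupport.mul_right
  refine (G.integrable.add h1).congr (ae_of_all _ fun ζ => ?_)
  exact (hG ζ).symm

/-- In even dimensions the symbol is a Schwartz function. -/
theorem exists_schwartzMap_of_even (hk : IsAdmissibleKernel k) (hd : Even d) :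
    ∃ G : 𝓢(Rd d, ℝ), ∀ ζ, G ζ = kernelSymbol k ζ := by
  obtain ⟨G, hG⟩ := hk.exists_schwartzMap_add_cutoff
  have h0 : ContDiff ℝ (⊤ : ℕ∞) (kernelSymbol k) := by
    rw [hk.kernelSymbol_eq_sqrt]
    exact (contDiff_const.sub ((contDiff_norm_pow_of_even hd).mul
      hk.contDiff_symbolDefect)).sqrt fun ζ => (hk.one_sub_pos ζ).ne'
  have h1 : ContDiff ℝ (⊤ : ℕ∞) fun x => cutoff d x * kernelSymbol k x :=
    (cutoff d).contDiff.mul h0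
  have h2 : HasCompactSupport fun x => cutoff d x * kernelSymbol k x :=
    (cutoff d).hasCompactSupport.mul_right
  exact ⟨G + h2.toSchwartzMap h1, fun ζ => (hG ζ).symm⟩

/-- A dyadic piece of the low frequency part of the symbol, rescaled to unit frequency; the scale
is `μ²`. -/
noncomputable def dyadicPiece (k : Rd d → ℝ) (p : ℝ × Rd d) : ℝ :=
  (cutoff d p.2 - cutoff d ((4:ℝ) • p.2)) *
    (-(‖p.2‖ ^ d * symbolDefect k (p.1 ^ 2 • p.2)) /
      (√(1 - p.1 ^ (2 * d) * ‖p.2‖ ^ d * symbolDefect k (p.1 ^ 2 • p.2)) + 1))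

/-- The cutoff difference vanishes for `‖ζ‖ < 1/4`, which removes the singularity of `‖ζ‖ ^ d`.
Writing the scale as `μ²` keeps the argument of the root equal to `σ(μ²ζ)² > 0` for every real `μ`,
so the family is smooth across `μ = 0` as well. -/
theorem contDiff_dyadicPiece (hk : IsAdmissibleKernel k) :
    ContDiff ℝ (⊤ : ℕ∞) (dyadicPiece k) := by
  rw [contDiff_iff_contDiffAt]
  rintro ⟨μ, ζ⟩
  have hc : ContDiff ℝ (⊤ : ℕ∞) fun p : ℝ × Rd d => cutoff d p.2 - cutoff d ((4:ℝ) • p.2) :=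
    ((cutoff d).contDiff.comp contDiff_snd).sub
      ((cutoff d).contDiff.comp (contDiff_snd.const_smul (4:ℝ)))
  rcases lt_or_ge ‖ζ‖ (1 / 4) with h | h
  · refine (contDiffAt_const (c := (0:ℝ))).congr_of_eventuallyEq ?_
    have : ∀ᶠ p : ℝ × Rd d in 𝓝 (μ, ζ), ‖p.2‖ < 1 / 4 :=
      (continuous_snd.norm.continuousAt (x := (μ, ζ))).eventually_lt_const h
    filter_upwards [this] with p hp
    rw [dyadicPiece, cutoff_eq_one (by linarith), cutoff_eq_one, sub_self, zero_mul]
    rw [norm_smul]; norm_num; linarith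
  · have hζ : ζ ≠ 0 := by rintro rfl; norm_num at h
    have hm : ContDiffAt ℝ (⊤ : ℕ∞) (fun p : ℝ × Rd d => symbolDefect k (p.1 ^ 2 • p.2)) (μ, ζ) :=
      (hk.contDiff_symbolDefect.comp ((contDiff_fst.pow 2).smul contDiff_snd)).contDiffAt
    have hn : ContDiffAt ℝ (⊤ : ℕ∞) (fun p : ℝ × Rd d => ‖p.2‖ ^ d) (μ, ζ) :=
      (contDiffAt_snd.norm ℝ hζ).pow d
    have hpos : 0 < 1 - μ ^ (2 * d) * ‖ζ‖ ^ d * symbolDefect k (μ ^ 2 • ζ) := by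
      have := hk.one_sub_pos (μ ^ 2 • ζ)
      rwa [norm_smul, Real.norm_of_nonneg (sq_nonneg μ), mul_pow, ← pow_mul] at this
    refine hc.contDiffAt.mul (((hn.mul hm).neg).div (ContDiffAt.add (ContDiffAt.sqrt
      (contDiffAt_const.sub (((contDiffAt_fst.pow _).mul hn).mul hm)) hpos.ne') contDiffAt_const) ?_)
    positivity

theorem dyadicPiece_eq_zero {μ : ℝ} {ζ : Rd d} (h : 2 < ‖ζ‖) : dyadicPiece k (μ, ζ) = 0 := by
  rw [dyadicPiece, cutoff_eq_zero h.le, cutoff_eq_zero, sub_self, zero_mul]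
  rw [norm_smul]; norm_num; linarith

/-- Rationalize `σ - 1 = (σ² - 1)/(σ + 1) = -‖ζ‖^d m/(σ + 1)`. Rescaling by `μ²` then extracts the
factor `(μ²)^d` by homogeneity. -/
theorem dyadicPiece_scale (hk : IsAdmissibleKernel k) {μ : ℝ} (hμ : 0 < μ) (ζ : Rd d) :
    (cutoff d ((μ ^ 2)⁻¹ • ζ) - cutoff d ((4:ℝ) • (μ ^ 2)⁻¹ • ζ)) * (kernelSymbol k ζ - 1) =
      (μ ^ 2) ^ d * dyadicPiece k (μ, (μ ^ 2)⁻¹ • ζ) := by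
  have hμ2 : 0 < μ ^ 2 := by positivity
  have e1 : μ ^ 2 • (μ ^ 2)⁻¹ • ζ = ζ := by rw [smul_smul, mul_inv_cancel₀ hμ2.ne', one_smul]
  have e2 : ‖(μ ^ 2)⁻¹ • ζ‖ ^ d = ((μ ^ 2) ^ d)⁻¹ * ‖ζ‖ ^ d := by
    rw [norm_smul, Real.norm_of_nonneg (by positivity), mul_pow, inv_pow]
  have e3 : kernelSymbol k ζ - 1 = -(‖ζ‖ ^ d * symbolDefect k ζ) / (kernelSymbol k ζ + 1) := by
    have := hk.kernelSymbol_pos ζ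
    rw [eq_div_iff (by positivity)]
    linear_combination hk.kernelSymbol_sq ζ
  simp only [dyadicPiece]
  rw [e1, e2, e3, hk.kernelSymbol_eq_sqrt, pow_mul]
  have e4 : (μ ^ 2) ^ d * (((μ ^ 2) ^ d)⁻¹ * ‖ζ‖ ^ d) = ‖ζ‖ ^ d := by
    rw [← mul_assoc, mul_inv_cancel₀ (by positivity), one_mul]
  rw [e4]
  have : (μ ^ 2) ^ d ≠ 0 := by positivity
  field_simp

end IsAdmissibleKernel

/-! ### Rules for Fourier transforms of real functions -/

section FourierReal

variable {d : ℕ}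

theorem fourierReal_eq (f : Rd d → ℝ) (ξ : Rd d) :
    fourierReal f ξ = ∫ x, (𝐞 (-inner ℝ x ξ) : Circle) • (f x : ℂ) := rfl

theorem integrable_fourierChar_smul {f : Rd d → ℝ} (hf : Integrable f) (ξ : Rd d) :
    Integrable fun x => (𝐞 (-inner ℝ x ξ) : Circle) • (f x : ℂ) :=
  (Real.fourierIntegral_convergent_iff ξ).2 hf.ofReal

theorem fourierReal_add {f g : Rd d → ℝ} (hf : Integrable f) (hg : Integrable g) (ξ : Rd d) :
    fourierReal (fun x => f x + g x) ξ = fourierReal f ξ + fourierReal g ξ := by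
  simp only [fourierReal_eq]
  rw [← integral_add (integrable_fourierChar_smul hf ξ) (integrable_fourierChar_smul hg ξ)]
  simp only [Complex.ofReal_add, smul_add]

theorem fourierReal_const_mul (c : ℝ) (f : Rd d → ℝ) (ξ : Rd d) :
    fourierReal (fun x => c * f x) ξ = c * fourierReal f ξ := by
  simp only [fourierReal_eq]
  rw [← integral_const_mul]
  congr 1; ext x
  push_cast
  rw [mul_smul_comm]

theorem fourierReal_neg_fun (f : Rd d → ℝ) (ξ : Rd d) :
    fourierReal (fun x => -f x) ξ = -fourierReal f ξ := by
  have := fourierReal_const_mul (-1) f ξ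
  simpa using this

theorem fourierReal_sub {f g : Rd d → ℝ} (hf : Integrable f) (hg : Integrable g) (ξ : Rd d) :
    fourierReal (fun x => f x - g x) ξ = fourierReal f ξ - fourierReal g ξ := by
  have hg' : Integrable fun x => -g x := hg.neg
  have h := fourierReal_add hf hg' ξ
  simp only [sub_eq_add_neg]
  rw [h, fourierReal_neg_fun]

theorem fourierReal_finset_sum {ι : Type*} (s : Finset ι) {f : ι → Rd d → ℝ}
    (hf : ∀ i ∈ s, Integrable (f i)) (ξ : Rd d) :
    fourierReal (fun x => ∑ i ∈ s, f i x) ξ = ∑ i ∈ s, fourierReal (f i) ξ := by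
  simp only [fourierReal_eq]
  rw [← integral_finsetSum _ fun i hi => integrable_fourierChar_smul (hf i hi) ξ]
  simp only [Complex.ofReal_sum, Finset.smul_sum]

theorem norm_fourierReal_le (f : Rd d → ℝ) (ξ : Rd d) : ‖fourierReal f ξ‖ ≤ ∫ x, |f x| := by
  rw [fourierReal_eq]
  refine (norm_integral_le_integral_norm _).trans (le_of_eq ?_)
  simp [Circle.norm_smul]

theorem continuous_fourierReal {f : Rd d → ℝ} (hf : Integrable f) : Continuous (fourierReal f) :=
  VectorFourier.fourierIntegral_continuous Real.continuous_fourierChar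
    (continuous_inner (𝕜 := ℝ)) hf.ofReal

theorem fourierReal_comp_inv_smul (f : Rd d → ℝ) {c : ℝ} (hc : 0 < c) (ξ : Rd d) :
    fourierReal (fun x => f (c⁻¹ • x)) ξ = (c : ℂ) ^ d * fourierReal f (c • ξ) := by
  have h := Measure.integral_comp_inv_smul_of_nonneg (volume : Measure (Rd d))
    (fun x : Rd d => (𝐞 (-inner ℝ x (c • ξ)) : Circle) • (f x : ℂ)) hc.le
  rw [fourierReal_eq, fourierReal_eq]
  rw [finrank_euclideanSpace_fin] at h
  have e : (c : ℂ) ^ d * ∫ x : Rd d, (𝐞 (-inner ℝ x (c • ξ)) : Circle) • (f x : ℂ) =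
      c ^ d • ∫ x : Rd d, (𝐞 (-inner ℝ x (c • ξ)) : Circle) • (f x : ℂ) := by
    rw [Complex.real_smul]; push_cast; rfl
  rw [e, ← h]
  congr 1; ext x
  rw [inner_smul_left, inner_smul_right]
  simp only [conj_trivial]
  rw [← mul_assoc, inv_mul_cancel₀ hc.ne', one_mul]

/-- The character `ξ ↦ e^{-2πi x·ξ}`. -/
noncomputable def waveChar (x ξ : Rd d) : ℂ := ((𝐞 (-inner ℝ x ξ) : Circle) : ℂ)

theorem norm_waveChar (x ξ : Rd d) : ‖waveChar x ξ‖ = 1 := Circle.norm_coe _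

theorem continuous_waveChar (x : Rd d) : Continuous (waveChar x) := by
  unfold waveChar
  exact continuous_subtype_val.comp (Real.continuous_fourierChar.comp (by fun_prop))

theorem fourierReal_comp_sub (f : Rd d → ℝ) (x ξ : Rd d) :
    fourierReal (fun w => f (x - w)) ξ = waveChar x ξ * fourierReal f (-ξ) := by
  rw [fourierReal_eq, fourierReal_eq,
    ← integral_sub_left_eq_self (fun w => (𝐞 (-inner ℝ w ξ) : Circle) • ((f (x - w) : ℝ) : ℂ))
      volume x, ← integral_const_mul]
  congr 1; ext w
  simp only [sub_sub_cancel, waveChar]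
  rw [inner_sub_left, inner_neg_right, Circle.smul_def, Circle.smul_def, smul_eq_mul, smul_eq_mul,
    ← mul_assoc, ← Circle.coe_mul, ← AddChar.map_add_eq_mul]
  congr 3; ring_nf

theorem conj_fourierReal (f : Rd d → ℝ) (ξ : Rd d) :
    (starRingEnd ℂ) (fourierReal f ξ) = fourierReal f (-ξ) := by
  rw [fourierReal_eq, fourierReal_eq, ← integral_conj]
  congr 1; ext x
  rw [inner_neg_right, Circle.smul_def, Circle.smul_def, smul_eq_mul, smul_eq_mul, map_mul,
    Complex.conj_ofReal, ← Circle.coe_inv_eq_conj, ← AddChar.map_neg_eq_inv]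

theorem IsRadial.fourierReal_neg {f : Rd d → ℝ} (hf : IsRadial f) (ξ : Rd d) :
    fourierReal f (-ξ) = fourierReal f ξ := hf.fourierReal_eq (norm_neg ξ)

theorem IsRadial.ofReal_re_fourierReal {f : Rd d → ℝ} (hf : IsRadial f) (ξ : Rd d) :
    ((fourierReal f ξ).re : ℂ) = fourierReal f ξ := by
  rw [← Complex.conj_eq_iff_re, conj_fourierReal, hf.fourierReal_neg]

theorem exists_forall_norm_pow_mul_schwartz_fourier_le (G : 𝓢(Rd d, ℝ)) (N : ℕ) :
    ∃ C : ℝ, ∀ ξ, ‖ξ‖ ^ N * ‖fourierReal G ξ‖ ≤ C := by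
  let Gc : 𝓢(Rd d, ℂ) := SchwartzMap.postcompCLM Complex.ofRealCLM G
  obtain ⟨C, hC⟩ := (𝓕 Gc).decay N 0
  refine ⟨C, fun ξ => ?_⟩
  have := hC.2 ξ
  rwa [norm_iteratedFDeriv_zero] at this

end FourierReal

/-! ### Decay of the Fourier transform of the symbol -/

namespace IsAdmissibleKernel

variable {d : ℕ} [NeZero d] {k : Rd d → ℝ}

theorem exists_dyadicPiece_fourier_le (hk : IsAdmissibleKernel k) (N : ℕ) :
    ∃ C : ℝ, 0 ≤ C ∧ ∀ a ∈ Set.Icc (0:ℝ) 1, ∀ ξ,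
      ‖ξ‖ ^ N * ‖fourierReal (fun ζ => dyadicPiece k (a, ζ)) ξ‖ ≤ C :=
  exists_forall_norm_pow_mul_fourier_le (Φ := fun p => ((dyadicPiece k p : ℝ) : ℂ))
    (Complex.ofRealCLM.contDiff.comp hk.contDiff_dyadicPiece)
    (fun a x hx => by rw [dyadicPiece_eq_zero hx]; simp) N

theorem integrable_dyadic (hk : IsAdmissibleKernel k) (c : ℝ) (hc : 1 ≤ c) :
    Integrable fun ζ => (cutoff d ζ - cutoff d (c • ζ)) * (kernelSymbol k ζ - 1) := by
  refine Continuous.integrable_of_hasCompactSupport ?_ ?_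
  · exact ((cutoff d).continuous.sub ((cutoff d).continuous.comp (continuous_const_smul c))).mul
      (hk.continuous_kernelSymbol.sub continuous_const)
  · refine HasCompactSupport.intro (isCompact_closedBall (0 : Rd d) 2) fun x hx => ?_
    simp only [Metric.mem_closedBall, dist_zero_right, not_le] at hx
    rw [cutoff_eq_zero hx.le, cutoff_eq_zero, sub_self, zero_mul]
    rw [norm_smul, Real.norm_of_nonneg (by linarith)]
    nlinarith [norm_nonneg x]

theorem integrable_dyadic' (hk : IsAdmissibleKernel k) (c : ℝ) (hc : 1 ≤ c) :
    Integrable fun ζ => (cutoff d (c • ζ) - cutoff d ((4:ℝ) • c • ζ)) * (kernelSymbol k ζ - 1) := by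
  have h := (hk.integrable_dyadic (4 * c) (by linarith)).sub (hk.integrable_dyadic c hc)
  refine h.congr (ae_of_all _ fun ζ => ?_)
  simp only [Pi.sub_apply, smul_smul]
  ring

/-- The low frequency singularity of the symbol contributes `O(|ξ|^{-(2 d - 1)})` to its
Fourier transform. -/
theorem exists_fourier_low_le (hk : IsAdmissibleKernel k) :
    ∃ C : ℝ, ∀ ξ : Rd d, ‖ξ‖ ^ (2 * d - 1) *
      ‖fourierReal (fun ζ => cutoff d ζ * (kernelSymbol k ζ - 1)) ξ‖ ≤ C := by
  obtain ⟨C, hC, hbd⟩ := hk.exists_dyadicPiece_fourier_le (2 * d - 1)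
  have hd := NeZero.pos d
  have piece : ∀ (j : ℕ) (ξ : Rd d), ‖ξ‖ ^ (2 * d - 1) * ‖fourierReal (fun ζ =>
      (cutoff d ((4:ℝ) ^ j • ζ) - cutoff d ((4:ℝ) • (4:ℝ) ^ j • ζ)) * (kernelSymbol k ζ - 1)) ξ‖ ≤
        C * (1 / 4) ^ j := by
    intro j ξ
    set μ : ℝ := (1 / 2) ^ j with hμ
    have hμ0 : 0 < μ := by positivity
    have hμ1 : μ ≤ 1 := pow_le_one₀ (by norm_num) (by norm_num)
    have hμ2 : μ ^ 2 = (1 / 4) ^ j := by rw [hμ, ← pow_mul, mul_comm, pow_mul]; norm_num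
    have hinv : (μ ^ 2)⁻¹ = (4:ℝ) ^ j := by rw [hμ2, ← inv_pow]; norm_num
    have e1 : (fun ζ : Rd d => (cutoff d ((4:ℝ) ^ j • ζ) - cutoff d ((4:ℝ) • (4:ℝ) ^ j • ζ)) *
        (kernelSymbol k ζ - 1)) =
        fun ζ => (μ ^ 2) ^ d * dyadicPiece k (μ, (μ ^ 2)⁻¹ • ζ) := by
      ext ζ
      rw [← hk.dyadicPiece_scale hμ0, hinv]
    have hl : 0 < μ ^ 2 := by positivity
    rw [e1, fourierReal_const_mul, fourierReal_comp_inv_smul (fun ζ => dyadicPiece k (μ, ζ)) hl,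
      norm_mul, norm_mul, ← hμ2]
    have h1 := hbd μ ⟨hμ0.le, hμ1⟩ (μ ^ 2 • ξ)
    set X := ‖fourierReal (fun ζ => dyadicPiece k (μ, ζ)) (μ ^ 2 • ξ)‖
    rw [norm_smul, Real.norm_of_nonneg hl.le, mul_pow] at h1
    have e2 : ‖(((μ ^ 2) ^ d : ℝ) : ℂ)‖ = (μ ^ 2) ^ d := by
      rw [Complex.norm_real, Real.norm_of_nonneg (by positivity)]
    have e3 : ‖((μ ^ 2 : ℝ) : ℂ) ^ d‖ = (μ ^ 2) ^ d := by
      rw [norm_pow, Complex.norm_real, Real.norm_of_nonneg hl.le]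
    rw [e2, e3]
    -- The amplitude and the Jacobian each contribute `(μ²)^d`, while the weight `‖ξ‖^(2d-1)` uses
    -- up only `2d - 1` powers. The spare factor `μ² = 4⁻ʲ` makes the sum over scales converge.
    have e4 : (μ ^ 2) ^ d * (μ ^ 2) ^ d = (μ ^ 2) ^ (2 * d - 1) * μ ^ 2 := by
      rw [← pow_add, ← pow_succ]; congr 1; omega
    calc ‖ξ‖ ^ (2 * d - 1) * ((μ ^ 2) ^ d * ((μ ^ 2) ^ d * X))
        = ‖ξ‖ ^ (2 * d - 1) * (((μ ^ 2) ^ d * (μ ^ 2) ^ d) * X) := by ring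
      _ = ((μ ^ 2) ^ (2 * d - 1) * ‖ξ‖ ^ (2 * d - 1) * X) * μ ^ 2 := by rw [e4]; ring
      _ ≤ C * μ ^ 2 := by gcongr
  have partial_sum : ∀ (J : ℕ) (ξ : Rd d), ‖ξ‖ ^ (2 * d - 1) * ‖fourierReal (fun ζ =>
      (cutoff d ζ - cutoff d ((4:ℝ) ^ J • ζ)) * (kernelSymbol k ζ - 1)) ξ‖ ≤ 2 * C := by
    intro J ξ
    -- The difference of cutoffs at scales `1` and `4^J` telescopes into dyadic annuli.
    have e : (fun ζ : Rd d => (cutoff d ζ - cutoff d ((4:ℝ) ^ J • ζ)) * (kernelSymbol k ζ - 1)) =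
        fun ζ => ∑ j ∈ Finset.range J,
          (cutoff d ((4:ℝ) ^ j • ζ) - cutoff d ((4:ℝ) • (4:ℝ) ^ j • ζ)) *
            (kernelSymbol k ζ - 1) := by
      ext ζ
      rw [← Finset.sum_mul]
      congr 1
      have := Finset.sum_range_sub' (fun j : ℕ => cutoff d ((4:ℝ) ^ j • ζ)) J
      simp only [pow_zero, one_smul] at this
      rw [← this]
      refine Finset.sum_congr rfl fun j _ => ?_
      rw [smul_smul, pow_succ']
    rw [e, fourierReal_finset_sum _ fun j _ =>
      hk.integrable_dyadic' ((4:ℝ) ^ j) (one_le_pow₀ (by norm_num))]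
    calc _ ≤ ‖ξ‖ ^ (2 * d - 1) * ∑ j ∈ Finset.range J, ‖fourierReal (fun ζ =>
          (cutoff d ((4:ℝ) ^ j • ζ) - cutoff d ((4:ℝ) • (4:ℝ) ^ j • ζ)) *
            (kernelSymbol k ζ - 1)) ξ‖ := by gcongr; exact norm_sum_le _ _
      _ ≤ ∑ j ∈ Finset.range J, C * (1 / 4) ^ j := by
          rw [Finset.mul_sum]; exact Finset.sum_le_sum fun j _ => piece j ξ
      _ ≤ C * 2 := by
          rw [← Finset.mul_sum]
          gcongr
          have := Summable.sum_le_tsum (f := fun j : ℕ => ((1:ℝ) / 4) ^ j) (Finset.range J)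
            (fun _ _ => by positivity) (summable_geometric_of_lt_one (by norm_num) (by norm_num))
          rw [tsum_geometric_of_lt_one (by norm_num) (by norm_num)] at this
          exact this.trans (by norm_num)
      _ = 2 * C := by ring
  refine ⟨2 * C, fun ξ => ?_⟩
  -- For `ζ ≠ 0` the inner cutoff at `4^J ζ` is eventually zero; the integrands are bounded by the
  -- indicator of the ball of radius `2`.
  have hlim : Tendsto (fun J : ℕ => fourierReal (fun ζ =>
      (cutoff d ζ - cutoff d ((4:ℝ) ^ J • ζ)) * (kernelSymbol k ζ - 1)) ξ) atTop
      (𝓝 (fourierReal (fun ζ => cutoff d ζ * (kernelSymbol k ζ - 1)) ξ)) := by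
    simp only [fourierReal_eq]
    refine tendsto_integral_of_dominated_convergence
      (Set.indicator (Metric.closedBall 0 2) fun _ => 1) ?_ ?_ ?_ ?_
    · intro J
      exact (integrable_fourierChar_smul (hk.integrable_dyadic _ (one_le_pow₀ (by norm_num)))
        ξ).aestronglyMeasurable
    · rw [integrable_indicator_iff measurableSet_closedBall]
      exact continuous_const.continuousOn.integrableOn_compact (isCompact_closedBall _ _)
    · intro J
      refine ae_of_all _ fun ζ => ?_
      rw [Circle.norm_smul, Complex.norm_real, Real.norm_eq_abs, abs_mul]
      by_cases h : ζ ∈ Metric.closedBall (0 : Rd d) 2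
      · rw [Set.indicator_of_mem h]
        refine mul_le_one₀ ?_ (abs_nonneg _) ?_
        · rw [abs_le]
          have h1 := (cutoff d).nonneg' ζ
          have h2 := (cutoff d).le_one (x := ζ)
          have h3 := (cutoff d).nonneg' ((4:ℝ) ^ J • ζ)
          have h4 := (cutoff d).le_one (x := (4:ℝ) ^ J • ζ)
          constructor <;> linarith
        · have h1 := hk.kernelSymbol_pos ζ
          have h2 := hk.kernelSymbol_le_one ζ
          rw [abs_le]; constructor <;> linarith
      · rw [Set.indicator_of_notMem h]
        simp only [Metric.mem_closedBall, dist_zero_right, not_le] at h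
        rw [cutoff_eq_zero h.le, cutoff_eq_zero, sub_self, abs_zero, zero_mul]
        rw [norm_smul, norm_pow]
        have : (1:ℝ) ≤ ‖(4:ℝ)‖ ^ J := one_le_pow₀ (by norm_num)
        nlinarith [norm_nonneg ζ]
    · have hne : ∀ᵐ ζ : Rd d, ζ ≠ 0 := by
        have : Nontrivial (Rd d) := by
          have : Nonempty (Fin d) := ⟨0⟩
          infer_instance
        exact Measure.ae_ne volume 0
      filter_upwards [hne] with ζ hζ
      refine tendsto_const_nhds.congr' ?_
      have hp : 0 < ‖ζ‖ := norm_pos_iff.2 hζ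
      have := (tendsto_pow_atTop_atTop_of_one_lt (r := (4:ℝ)) (by norm_num)).eventually_ge_atTop
        (2 / ‖ζ‖)
      filter_upwards [this] with J hJ
      have : cutoff d ((4:ℝ) ^ J • ζ) = 0 := by
        apply cutoff_eq_zero
        rw [norm_smul, Real.norm_of_nonneg (by positivity)]
        rwa [div_le_iff₀ hp] at hJ
      rw [this, sub_zero]
  exact le_of_tendsto (tendsto_const_nhds.mul hlim.norm) (Eventually.of_forall fun J =>
    partial_sum J ξ)

/-- With `χ` the cutoff, `σ = G + χ + χ(σ - 1)`. The first two terms are Schwartz, so the rate comes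
from the last one alone. -/
theorem exists_fourier_kernelSymbol_le (hk : IsAdmissibleKernel k) :
    ∃ C : ℝ, ∀ ξ : Rd d, ‖ξ‖ ^ (2 * d - 1) * ‖fourierReal (kernelSymbol k) ξ‖ ≤ C := by
  obtain ⟨G, hG⟩ := hk.exists_schwartzMap_add_cutoff
  obtain ⟨C₁, h₁⟩ := exists_forall_norm_pow_mul_schwartz_fourier_le G (2 * d - 1)
  obtain ⟨C₂, h₂⟩ := exists_forall_norm_pow_mul_schwartz_fourier_le
    ((cutoff d).hasCompactSupport.toSchwartzMap (cutoff d).contDiff) (2 * d - 1)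
  obtain ⟨C₃, h₃⟩ := hk.exists_fourier_low_le
  refine ⟨C₁ + C₂ + C₃, fun ξ => ?_⟩
  have i2 : Integrable fun ζ => cutoff d ζ :=
    (cutoff d).continuous.integrable_of_hasCompactSupport (cutoff d).hasCompactSupport
  have i3 : Integrable fun ζ => cutoff d ζ * (kernelSymbol k ζ - 1) :=
    ((cutoff d).continuous.mul (hk.continuous_kernelSymbol.sub
      continuous_const)).integrable_of_hasCompactSupport (cutoff d).hasCompactSupport.mul_right
  have i1 : Integrable fun ζ => G ζ + cutoff d ζ := G.integrable.add i2
  have e : fourierReal (kernelSymbol k) ξ = fourierReal G ξ + fourierReal (cutoff d) ξ +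
      fourierReal (fun ζ => cutoff d ζ * (kernelSymbol k ζ - 1)) ξ := by
    rw [← fourierReal_add G.integrable i2, ← fourierReal_add i1 i3]
    congr 1; ext ζ
    linear_combination hG ζ
  rw [e]
  calc _ ≤ ‖ξ‖ ^ (2 * d - 1) * (‖fourierReal G ξ‖ + ‖fourierReal (cutoff d) ξ‖ +
        ‖fourierReal (fun ζ => cutoff d ζ * (kernelSymbol k ζ - 1)) ξ‖) := by
        gcongr; exact norm_add₃_le
    _ ≤ _ := by
        rw [mul_add, mul_add]
        exact add_le_add (add_le_add (h₁ ξ) (h₂ ξ)) (h₃ ξ)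

theorem isRadial_kernelSymbol (k : Rd d → ℝ) : IsRadial (kernelSymbol k) := by
  intro x y h
  rw [kernelSymbol_eq, kernelSymbol_eq, h]

end IsAdmissibleKernel

/-! ### The kernel `K = 𝓕⁻¹ σ` -/

/-- The convolution kernel, the inverse Fourier transform of the symbol. -/
noncomputable def convKernel {d : ℕ} [NeZero d] (k : Rd d → ℝ) (x : Rd d) : ℝ :=
  (fourierReal (kernelSymbol k) x).re

namespace IsAdmissibleKernel

variable {d : ℕ} [NeZero d] {k : Rd d → ℝ}

theorem ofReal_convKernel (k : Rd d → ℝ) (x : Rd d) :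
    (convKernel k x : ℂ) = fourierReal (kernelSymbol k) x :=
  (isRadial_kernelSymbol k).ofReal_re_fourierReal x

theorem convKernel_eq_fourierInv (k : Rd d → ℝ) (x : Rd d) :
    (convKernel k x : ℂ) = 𝓕⁻ (fun ζ => (kernelSymbol k ζ : ℂ)) x := by
  rw [ofReal_convKernel, Real.fourierInv_eq_fourier_neg]
  exact ((isRadial_kernelSymbol k).fourierReal_neg x).symm

theorem isRadial_convKernel (k : Rd d → ℝ) : IsRadial (convKernel k) := by
  intro x y h
  rw [convKernel, (isRadial_kernelSymbol k).fourierReal_eq h, convKernel]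

theorem abs_convKernel (k : Rd d → ℝ) (x : Rd d) :
    |convKernel k x| = ‖fourierReal (kernelSymbol k) x‖ := by
  rw [← ofReal_convKernel, Complex.norm_real, Real.norm_eq_abs]

theorem exists_convKernel_le (hk : IsAdmissibleKernel k) :
    ∃ C : ℝ, ∀ x : Rd d, |convKernel k x| ≤ C ∧ ‖x‖ ^ (2 * d - 1) * |convKernel k x| ≤ C := by
  obtain ⟨C, hC⟩ := hk.exists_fourier_kernelSymbol_le
  refine ⟨max (∫ ζ, |kernelSymbol k ζ|) C, fun x => ?_⟩
  rw [abs_convKernel]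
  exact ⟨(norm_fourierReal_le _ x).trans (le_max_left _ _), (hC x).trans (le_max_right _ _)⟩

theorem continuous_convKernel (hk : IsAdmissibleKernel k) : Continuous (convKernel k) :=
  Complex.continuous_re.comp (continuous_fourierReal hk.integrable_kernelSymbol)

/-- The decay exponent `2d - 1` exceeds the dimension exactly because `d ≥ 2`; continuity takes care
of bounded `x`. -/
theorem integrable_convKernel (hk : IsAdmissibleKernel k) (hd : 2 ≤ d) :
    Integrable (convKernel k) := by
  obtain ⟨C, hC⟩ := hk.exists_convKernel_le
  have hC0 : 0 ≤ C := (abs_nonneg _).trans (hC 0).1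
  have hint : Integrable fun x : Rd d => (1 + ‖x‖) ^ (-((2 * d - 1 : ℕ) : ℝ)) := by
    apply integrable_one_add_norm
    rw [finrank_euclideanSpace_fin]
    exact_mod_cast (by omega : d < 2 * d - 1)
  refine (hint.const_mul (2 ^ (2 * d - 1) * C)).mono'
    hk.continuous_convKernel.aestronglyMeasurable (ae_of_all _ fun x => ?_)
  rw [Real.norm_eq_abs, Real.rpow_neg (by positivity), Real.rpow_natCast, ← div_eq_mul_inv,
    le_div_iff₀ (by positivity)]
  rcases le_total ‖x‖ 1 with h | h
  · calc |convKernel k x| * (1 + ‖x‖) ^ (2 * d - 1) ≤ C * 2 ^ (2 * d - 1) := by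
          gcongr
          · exact (hC x).1
          · linarith
      _ = _ := by ring
  · calc |convKernel k x| * (1 + ‖x‖) ^ (2 * d - 1)
        ≤ |convKernel k x| * (2 * ‖x‖) ^ (2 * d - 1) := by gcongr; linarith
      _ = 2 ^ (2 * d - 1) * (‖x‖ ^ (2 * d - 1) * |convKernel k x|) := by rw [mul_pow]; ring
      _ ≤ _ := by gcongr; exact (hC x).2

/-- Fourier inversion, available because both the continuous symbol and its transform are
integrable. Radial symmetry makes the forward and inverse transforms agree. -/
theorem fourierReal_convKernel (hk : IsAdmissibleKernel k) (hd : 2 ≤ d) (ξ : Rd d) :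
    fourierReal (convKernel k) ξ = kernelSymbol k ξ := by
  have h1 : (fun x => (convKernel k x : ℂ)) = 𝓕 (fun ζ => (kernelSymbol k ζ : ℂ)) := by
    ext x; exact ofReal_convKernel k x
  have hc : Continuous fun ζ => (kernelSymbol k ζ : ℂ) :=
    Complex.continuous_ofReal.comp hk.continuous_kernelSymbol
  have hF : Integrable (𝓕 fun ζ => (kernelSymbol k ζ : ℂ)) := by
    rw [← h1]; exact (hk.integrable_convKernel hd).ofReal
  have h2 := congrFun (hc.fourierInv_fourier_eq hk.integrable_kernelSymbol.ofReal hF) (-ξ)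
  rw [← h1, Real.fourierInv_eq_fourier_neg, neg_neg] at h2
  rw [fourierReal, h2, isRadial_kernelSymbol k (-ξ) ξ (norm_neg ξ)]

theorem integral_convKernel (hk : IsAdmissibleKernel k) (hd : 2 ≤ d) :
    ∫ x, convKernel k x = 1 := by
  have h := hk.fourierReal_convKernel hd 0
  rw [hk.kernelSymbol_zero, fourierReal_eq] at h
  simp only [inner_zero_right, neg_zero, AddChar.map_zero_eq_one, one_smul] at h
  rw [integral_complex_ofReal] at h
  exact_mod_cast h

theorem exists_schwartzMap_convKernel (hk : IsAdmissibleKernel k) (hd : Even d) :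
    ∃ κ : 𝓢(Rd d, ℝ), ∀ x, κ x = convKernel k x := by
  obtain ⟨G, hG⟩ := hk.exists_schwartzMap_of_even hd
  refine ⟨SchwartzMap.postcompCLM Complex.reCLM
    (𝓕 (SchwartzMap.postcompCLM Complex.ofRealCLM G)), fun x => ?_⟩
  have : (G : Rd d → ℝ) = kernelSymbol k := funext hG
  rw [convKernel, ← this]
  rfl

end IsAdmissibleKernel

/-! ### Gaussian kernels and their energies on the Fourier side -/

section LogEnergy

variable {d : ℕ}

theorem continuous_waveChar_uncurry : Continuous fun p : Rd d × Rd d => waveChar p.1 p.2 := by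
  unfold waveChar
  exact continuous_subtype_val.comp (Real.continuous_fourierChar.comp (by fun_prop))

theorem waveChar_sub (x y ξ : Rd d) : waveChar (x - y) ξ = waveChar x ξ * waveChar y (-ξ) := by
  simp only [waveChar]
  rw [inner_sub_left, inner_neg_right, ← Circle.coe_mul, ← AddChar.map_add_eq_mul]
  congr 3; ring

theorem fourierReal_eq_integral_mul (f : Rd d → ℝ) (ξ : Rd d) :
    fourierReal f ξ = ∫ x, waveChar x ξ * (f x : ℂ) := rfl

theorem exp_neg_eq_integral {t : ℝ} (ht : 0 < t) (z : Rd d) :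
    (Real.exp (-Real.pi * ‖z‖ ^ 2 / t) : ℂ) =
      ∫ ξ : Rd d, waveChar z ξ *
        ((t ^ ((d : ℝ) / 2) * Real.exp (-(Real.pi * t) * ‖ξ‖ ^ 2) : ℝ) : ℂ) := by
  have hb : 0 < ((Real.pi * t : ℝ) : ℂ).re := by simp only [Complex.ofReal_re]; positivity
  have h := fourier_gaussian_innerProductSpace hb z
  rw [Real.fourier_eq] at h
  have e : ∀ ξ : Rd d, waveChar z ξ *
      ((t ^ ((d : ℝ) / 2) * Real.exp (-(Real.pi * t) * ‖ξ‖ ^ 2) : ℝ) : ℂ) =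
      ((t ^ ((d : ℝ) / 2) : ℝ) : ℂ) * ((𝐞 (-inner ℝ ξ z) : Circle) •
        Complex.exp (-((Real.pi * t : ℝ) : ℂ) * (‖ξ‖ : ℂ) ^ 2)) := by
    intro ξ
    rw [waveChar, real_inner_comm, Circle.smul_def, smul_eq_mul]
    push_cast
    ring
  simp only [e]
  rw [integral_const_mul, h, finrank_euclideanSpace_fin]
  have e1 : ((Real.pi : ℂ) / ((Real.pi * t : ℝ) : ℂ)) = ((t⁻¹ : ℝ) : ℂ) := by
    push_cast
    have : (Real.pi : ℂ) ≠ 0 := by exact_mod_cast Real.pi_ne_zero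
    field_simp
  have e2 : (d : ℂ) / 2 = (((d : ℝ) / 2 : ℝ) : ℂ) := by push_cast; rfl
  rw [e1, e2, ← Complex.ofReal_cpow (by positivity), ← mul_assoc, ← Complex.ofReal_mul,
    ← Real.mul_rpow ht.le (by positivity), mul_inv_cancel₀ ht.ne', Real.one_rpow,
    Complex.ofReal_one, one_mul, Complex.ofReal_exp]
  congr 1
  push_cast
  have : (Real.pi : ℂ) ≠ 0 := by exact_mod_cast Real.pi_ne_zero
  have : (t : ℂ) ≠ 0 := by exact_mod_cast ht.ne'
  field_simp

theorem integrable_exp_neg_mul_norm_sq {b : ℝ} (hb : 0 < b) :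
    Integrable fun ξ : Rd d => Real.exp (-b * ‖ξ‖ ^ 2) := by
  have h := GaussianFourier.integrable_cexp_neg_mul_sq_norm_add (V := Rd d) (b := (b : ℂ))
    (by simpa using hb) 0 0
  simp only [zero_mul, add_zero] at h
  refine h.re.congr (ae_of_all _ fun ξ => ?_)
  have : Complex.exp (-(b : ℂ) * (‖ξ‖ : ℂ) ^ 2) = (Real.exp (-b * ‖ξ‖ ^ 2) : ℂ) := by push_cast; rfl
  simp only [this]
  exact Complex.ofReal_re _

/-- Inserting the Fourier representation of the Gaussian separates the variables `x` and `y`; after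
Fubini the two factors are `f̂(ξ)` and its conjugate. -/
theorem integral_gaussian_energy {f : Rd d → ℝ} (hf : Integrable f) {t : ℝ} (ht : 0 < t) :
    ∫ p : Rd d × Rd d, f p.1 * f p.2 * Real.exp (-Real.pi * ‖p.1 - p.2‖ ^ 2 / t) =
      ∫ ξ : Rd d, t ^ ((d : ℝ) / 2) * Real.exp (-(Real.pi * t) * ‖ξ‖ ^ 2) *
        ‖fourierReal f ξ‖ ^ 2 := by
  set G : Rd d → ℝ := fun ξ => t ^ ((d : ℝ) / 2) * Real.exp (-(Real.pi * t) * ‖ξ‖ ^ 2) with hG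
  have hGi : Integrable G := (integrable_exp_neg_mul_norm_sq (by positivity)).const_mul _
  have hF : Integrable (fun q : (Rd d × Rd d) × Rd d =>
      waveChar (q.1.1 - q.1.2) q.2 * (((f q.1.1 * f q.1.2) * G q.2 : ℝ) : ℂ))
      (((volume : Measure (Rd d)).prod volume).prod volume) := by
    refine ((hf.mul_prod hf).mul_prod hGi).ofReal.bdd_mul (c := 1) ?_ ?_
    · exact (continuous_waveChar_uncurry.comp (by fun_prop :
        Continuous fun q : (Rd d × Rd d) × Rd d => (q.1.1 - q.1.2, q.2))).aestronglyMeasurable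
    · exact ae_of_all _ fun q => (norm_waveChar _ _).le
  apply Complex.ofReal_injective
  rw [← integral_complex_ofReal, ← integral_complex_ofReal]
  calc ∫ p : Rd d × Rd d, ((f p.1 * f p.2 * Real.exp (-Real.pi * ‖p.1 - p.2‖ ^ 2 / t) : ℝ) : ℂ)
      = ∫ p : Rd d × Rd d, ∫ ξ : Rd d,
          waveChar (p.1 - p.2) ξ * (((f p.1 * f p.2) * G ξ : ℝ) : ℂ) := by
        congr 1; ext p
        rw [Complex.ofReal_mul, exp_neg_eq_integral ht, ← integral_const_mul]
        congr 1; ext ξ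
        simp only [hG]
        push_cast; ring
    _ = ∫ ξ : Rd d, ∫ p : Rd d × Rd d,
          waveChar (p.1 - p.2) ξ * (((f p.1 * f p.2) * G ξ : ℝ) : ℂ) :=
        integral_integral_swap hF
    _ = _ := by
        congr 1; ext ξ
        have e : ∀ p : Rd d × Rd d, waveChar (p.1 - p.2) ξ * (((f p.1 * f p.2) * G ξ : ℝ) : ℂ) =
            (G ξ : ℂ) * ((waveChar p.1 ξ * (f p.1 : ℂ)) * (waveChar p.2 (-ξ) * (f p.2 : ℂ))) := by
          intro p
          rw [waveChar_sub]; push_cast; ring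
        simp only [e]
        rw [integral_const_mul]
        have := integral_prod_mul (μ := (volume : Measure (Rd d))) (ν := (volume : Measure (Rd d)))
          (fun x => waveChar x ξ * (f x : ℂ)) (fun y => waveChar y (-ξ) * (f y : ℂ))
        rw [Measure.volume_eq_prod, this, ← fourierReal_eq_integral_mul,
          ← fourierReal_eq_integral_mul, ← conj_fourierReal, Complex.mul_conj,
          Complex.normSq_eq_norm_sq]
        simp only [hG]
        push_cast; rfl

/-! ### The logarithm as a superposition of Gaussians -/

/-- A truncation of the integral `log (1/r) = ½ ∫₀^∞ (e^{-πr²/t} - e^{-π/t}) dt/t`. -/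
noncomputable def logTrunc (n : ℕ) (r : ℝ) : ℝ :=
  ∫ t in (1 / ((n : ℝ) + 1))..((n : ℝ) + 1),
    t⁻¹ * (Real.exp (-Real.pi * r ^ 2 / t) - Real.exp (-Real.pi / t))

/-- Frullani's integral for `u ↦ e^{-π/u}`, with limits `0` at `0` and `1` at infinity, and
dilations `r⁻²` and `1`. -/
theorem tendsto_logTrunc {r : ℝ} (hr : 0 < r) :
    Tendsto (fun n => logTrunc n r) atTop (𝓝 (2 * Real.log (1 / r))) := by
  have hcont : ContinuousOn (fun u : ℝ => Real.exp (-Real.pi / u)) (Set.Ioi 0) := by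
    apply Real.continuous_exp.comp_continuousOn
    exact continuousOn_const.div continuousOn_id fun x hx => (Set.mem_Ioi.1 hx).ne'
  have hL : Tendsto (fun u : ℝ => Real.exp (-Real.pi / u)) (𝓝[>] 0) (𝓝 0) := by
    have h0 : Tendsto (fun u : ℝ => -Real.pi / u) (𝓝[>] 0) atBot := by
      simp only [div_eq_mul_inv]
      exact tendsto_inv_nhdsGT_zero.const_mul_atTop_of_neg (by linarith [Real.pi_pos])
    exact Real.tendsto_exp_atBot.comp h0
  have hR : Tendsto (fun u : ℝ => Real.exp (-Real.pi / u)) atTop (𝓝 1) := by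
    have : Tendsto (fun u : ℝ => -Real.pi / u) atTop (𝓝 0) := tendsto_const_nhds.div_atTop tendsto_id
    have := (Real.continuous_exp.tendsto 0).comp this
    rwa [Real.exp_zero] at this
  have h := Frullani.tendsto_intervalIntegral
    (hcont.locallyIntegrableOn measurableSet_Ioi (μ := volume)) (a := (r ^ 2)⁻¹) (b := 1)
    (by positivity) one_pos hL hR
  have hn : Tendsto (fun n : ℕ => ((1 / ((n : ℝ) + 1)), ((n : ℝ) + 1))) atTop
      ((𝓝[>] 0) ×ˢ atTop) := by
    refine Tendsto.prodMk ?_ (tendsto_atTop_add_const_right _ _ tendsto_natCast_atTop_atTop)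
    refine tendsto_nhdsWithin_iff.2 ⟨tendsto_one_div_add_atTop_nhds_zero_nat, ?_⟩
    exact Eventually.of_forall fun n => Set.mem_Ioi.2 (by positivity)
  have h2 := h.comp hn
  have e : Real.log (1 / (r ^ 2)⁻¹) • ((0 : ℝ) - 1) = 2 * Real.log (1 / r) := by
    rw [one_div, inv_inv, Real.log_pow, one_div, Real.log_inv]; simp
  rw [e] at h2
  refine h2.congr fun n => ?_
  simp only [Function.comp, logTrunc, smul_eq_mul, one_mul]
  congr 1; ext t
  congr 3
  by_cases ht : t = 0
  · simp [ht]
  · field_simp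

theorem intervalIntegrable_logTrunc (r : ℝ) {a b : ℝ} (ha : 0 < a) (hb : 0 < b) :
    IntervalIntegrable
      (fun t => t⁻¹ * (Real.exp (-Real.pi * r ^ 2 / t) - Real.exp (-Real.pi / t))) volume a b := by
  apply ContinuousOn.intervalIntegrable
  have h0 : ∀ t ∈ Set.uIcc a b, t ≠ 0 := fun t ht => ((lt_min ha hb).trans_le ht.1).ne'
  refine (continuousOn_inv₀.mono h0).mul (ContinuousOn.sub ?_ ?_)
  · exact Real.continuous_exp.comp_continuousOn (continuousOn_const.div continuousOn_id h0)
  · exact Real.continuous_exp.comp_continuousOn (continuousOn_const.div continuousOn_id h0)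

/-- For fixed `r` the integrand has constant sign, depending on whether `r ≤ 1` or `r ≥ 1`. The
truncations therefore increase in absolute value to their limit, which provides the majorant for
dominated convergence. -/
theorem abs_logTrunc_le {r : ℝ} (hr : 0 < r) (n : ℕ) :
    |logTrunc n r| ≤ 2 * |Real.log r| := by
  have hpos : ∀ n : ℕ, 0 < 1 / ((n : ℝ) + 1) := fun n => by positivity
  have hle : ∀ n : ℕ, 1 / ((n : ℝ) + 1) ≤ (n : ℝ) + 1 := fun n => by
    rw [div_le_iff₀ (by positivity)]; nlinarith [Nat.cast_nonneg (α := ℝ) n]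
  have hlim := (tendsto_logTrunc hr).abs
  have e : |2 * Real.log (1 / r)| = 2 * |Real.log r| := by
    rw [one_div, Real.log_inv, abs_mul, abs_neg, abs_two]
  rw [e] at hlim
  refine Monotone.ge_of_tendsto (f := fun n => |logTrunc n r|) (fun m n hmn => ?_) hlim n
  have hmn' : (m : ℝ) ≤ n := by exact_mod_cast hmn
  have h1 : 1 / ((n : ℝ) + 1) ≤ 1 / ((m : ℝ) + 1) := by gcongr
  have h2 : (m : ℝ) + 1 ≤ n + 1 := by linarith
  have key : ∀ g : ℝ → ℝ, (∀ t, 0 < t → 0 ≤ g t) →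
      IntervalIntegrable g volume (1 / ((n : ℝ) + 1)) (n + 1) →
      |∫ t in (1 / ((m : ℝ) + 1))..(m + 1), g t| ≤ |∫ t in (1 / ((n : ℝ) + 1))..(n + 1), g t| := by
    intro g hg hi
    refine intervalIntegral.abs_integral_mono_interval ?_ ?_ hi
    · rw [Set.uIoc_of_le (hle m), Set.uIoc_of_le (hle n)]
      exact Set.Ioc_subset_Ioc h1 h2
    · rw [Set.uIoc_of_le (hle n)]
      filter_upwards [ae_restrict_mem measurableSet_Ioc] with t ht
      exact hg t ((hpos n).trans ht.1)
  have hi := intervalIntegrable_logTrunc r (hpos n) (by positivity : (0:ℝ) < n + 1)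
  have hpi := Real.pi_pos
  simp only [logTrunc]
  rcases le_total r 1 with hr1 | hr1
  · refine key _ (fun t ht => mul_nonneg (by positivity) (sub_nonneg.2 (Real.exp_le_exp.2 ?_))) hi
    gcongr
    nlinarith [mul_le_one₀ hr1 hr.le hr1]
  · have := key _ (fun t ht => ?_) hi.neg
    · simpa only [Pi.neg_apply, intervalIntegral.integral_neg, abs_neg] using this
    · rw [Pi.neg_apply, ← mul_neg, neg_sub]
      refine mul_nonneg (by positivity) (sub_nonneg.2 (Real.exp_le_exp.2 ?_))
      gcongr
      nlinarith [one_le_mul_of_one_le_of_one_le hr1 hr1]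

theorem integrable_indicator_log_norm (d : ℕ) [NeZero d] : Integrable fun x : Rd d =>
    Set.indicator (Set.Iio 1) (fun r : ℝ => Real.log r) ‖x‖ := by
  have : Nonempty (Fin d) := ⟨0⟩
  have : Nontrivial (Rd d) := inferInstance
  rw [integrable_fun_norm_addHaar]
  have h1 : IntegrableOn (fun r : ℝ => Real.log r) (Set.Ioo 0 1) := by
    have h := intervalIntegral.intervalIntegrable_log' (a := 0) (b := 1)
    rw [intervalIntegrable_iff_integrableOn_Ioo_of_le zero_le_one] at h
    exact h
  have h2 : IntegrableOn (fun r : ℝ => r ^ (Module.finrank ℝ (Rd d) - 1) • Real.log r)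
      (Set.Ioo 0 1) := by
    refine Integrable.bdd_mul (c := 1) h1 (by fun_prop) ?_
    filter_upwards [ae_restrict_mem measurableSet_Ioo] with r hr
    rw [norm_pow, Real.norm_of_nonneg hr.1.le]
    exact pow_le_one₀ hr.1.le hr.2.le
  rw [← integrable_indicator_iff measurableSet_Ioo] at h2
  rw [← integrable_indicator_iff measurableSet_Ioi]
  refine h2.congr (ae_of_all _ fun r => ?_)
  simp only [Set.indicator, Set.mem_Ioo, Set.mem_Ioi, Set.mem_Iio]
  split_ifs <;> simp_all

/-- For `|x - y| < 1`, bound one factor by its supremum and use local integrability of the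
logarithm. For `|x - y| ≥ 1`, use `log |x - y| ≤ |x| + |y|` and the finite first moments. -/
theorem integrable_mul_mul_log [NeZero d] (φ : 𝓢(Rd d, ℝ)) :
    Integrable (fun p : Rd d × Rd d => φ p.1 * φ p.2 * Real.log ‖p.1 - p.2‖)
      ((volume : Measure (Rd d)).prod volume) := by
  obtain ⟨C, hC⟩ := φ.decay 0 0
  have hb : ∀ x, |φ x| ≤ C := fun x => by simpa using hC.2 x
  have h1 := (φ.integrable (μ := volume)).convolution_integrand (ContinuousLinearMap.mul ℝ ℝ)
    (integrable_indicator_log_norm d)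
  have h2 : Integrable fun x : Rd d => ‖x‖ * |φ x| := by
    simpa using φ.integrable_pow_mul volume 1
  have h3 : Integrable (fun p : Rd d × Rd d => (‖p.1‖ * |φ p.1|) * |φ p.2|)
      ((volume : Measure (Rd d)).prod volume) := h2.mul_prod φ.integrable.abs
  have h4 : Integrable (fun p : Rd d × Rd d => |φ p.1| * (‖p.2‖ * |φ p.2|))
      ((volume : Measure (Rd d)).prod volume) := φ.integrable.abs.mul_prod h2
  refine (((h1.abs.const_mul C).add h3).add h4).mono' ?_ (ae_of_all _ fun p => ?_)
  · refine Measurable.aestronglyMeasurable ?_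
    have := φ.continuous.measurable
    fun_prop
  · simp only [Pi.add_apply, ContinuousLinearMap.mul_apply']
    rw [Real.norm_eq_abs, abs_mul, abs_mul, abs_mul]
    have a1 := abs_nonneg (φ p.1)
    have a2 := abs_nonneg (φ p.2)
    have hC0 : 0 ≤ C := a1.trans (hb _)
    by_cases h : ‖p.1 - p.2‖ < 1
    · rw [Set.indicator_of_mem (Set.mem_Iio.2 h)]
      have : |φ p.1| * |φ p.2| * |Real.log ‖p.1 - p.2‖| ≤
          C * (|φ p.2| * |Real.log ‖p.1 - p.2‖|) := by
        rw [mul_assoc]; gcongr; exact hb _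
      have : 0 ≤ ‖p.1‖ * |φ p.1| * |φ p.2| := by positivity
      have : 0 ≤ |φ p.1| * (‖p.2‖ * |φ p.2|) := by positivity
      linarith
    · have h' : 1 ≤ ‖p.1 - p.2‖ := not_lt.1 h
      have l1 : |Real.log ‖p.1 - p.2‖| ≤ ‖p.1‖ + ‖p.2‖ := by
        rw [abs_of_nonneg (Real.log_nonneg h')]
        exact (Real.log_le_self (norm_nonneg _)).trans (norm_sub_le _ _)
      have : |φ p.1| * |φ p.2| * |Real.log ‖p.1 - p.2‖| ≤
          |φ p.1| * |φ p.2| * (‖p.1‖ + ‖p.2‖) := by gcongr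
      have : 0 ≤ C * (|φ p.2| * |Set.indicator (Set.Iio 1) (fun r : ℝ => Real.log r)
        ‖p.1 - p.2‖|) := by positivity
      linarith

theorem ae_fst_ne_snd (d : ℕ) [NeZero d] :
    ∀ᵐ p : Rd d × Rd d ∂(volume : Measure (Rd d)).prod volume, p.1 ≠ p.2 := by
  have : Nonempty (Fin d) := ⟨0⟩
  have : Nontrivial (Rd d) := inferInstance
  have hm : MeasurableSet {p : Rd d × Rd d | p.1 ≠ p.2} :=
    (measurableSet_eq_fun measurable_fst measurable_snd).compl
  rw [Measure.ae_prod_iff_ae_ae hm]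
  refine ae_of_all _ fun x => ?_
  filter_upwards [Measure.ae_ne volume x] with y hy
  exact hy.symm

/-- The function integrated against `dt/t` to give the logarithmic energy. -/
noncomputable def gaussianEnergy (f : Rd d → ℝ) (t : ℝ) : ℝ :=
  ∫ ξ : Rd d, t ^ ((d : ℝ) / 2) * Real.exp (-(Real.pi * t) * ‖ξ‖ ^ 2) * ‖fourierReal f ξ‖ ^ 2

/-- The subtracted constant `e^{-π/t}` contributes nothing because `f` has zero integral, but it is
what makes the integral against `dt/t` converge to a logarithm. -/
theorem gaussianEnergy_eq {f : Rd d → ℝ} (hf : Integrable f) (h0 : ∫ x, f x = 0) {t : ℝ}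
    (ht : 0 < t) :
    gaussianEnergy f t = ∫ p : Rd d × Rd d, f p.1 * f p.2 *
      (Real.exp (-Real.pi * ‖p.1 - p.2‖ ^ 2 / t) - Real.exp (-Real.pi / t)) := by
  have hff : Integrable (fun p : Rd d × Rd d => f p.1 * f p.2) := hf.mul_prod hf
  have hi : Integrable (fun p : Rd d × Rd d => f p.1 * f p.2 *
      Real.exp (-Real.pi * ‖p.1 - p.2‖ ^ 2 / t)) := by
    refine hff.mul_bdd (c := 1) (Continuous.aestronglyMeasurable (by fun_prop)) (ae_of_all _ fun p => ?_)
    rw [Real.norm_of_nonneg (Real.exp_pos _).le, Real.exp_le_one_iff]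
    have := Real.pi_pos
    rw [neg_mul, neg_div]
    exact neg_nonpos.2 (by positivity)
  simp only [mul_sub]
  rw [gaussianEnergy, ← integral_gaussian_energy hf ht, integral_sub hi (hff.mul_const _),
    integral_mul_const, Measure.volume_eq_prod,
    integral_prod_mul (μ := (volume : Measure (Rd d))) (ν := (volume : Measure (Rd d))) f f,
    h0]
  simp

theorem integral_gaussianEnergy {f : Rd d → ℝ} (hf : Integrable f) (h0 : ∫ x, f x = 0) (n : ℕ) :
    IntegrableOn (fun t => t⁻¹ * gaussianEnergy f t) (Set.Ioc (1 / ((n : ℝ) + 1)) (n + 1)) ∧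
    Integrable (fun p : Rd d × Rd d => f p.1 * f p.2 * logTrunc n ‖p.1 - p.2‖) ∧
    ∫ t in Set.Ioc (1 / ((n : ℝ) + 1)) (n + 1), t⁻¹ * gaussianEnergy f t =
      ∫ p : Rd d × Rd d, f p.1 * f p.2 * logTrunc n ‖p.1 - p.2‖ := by
  have hpos : (0:ℝ) < 1 / ((n : ℝ) + 1) := by positivity
  have hle : 1 / ((n : ℝ) + 1) ≤ (n : ℝ) + 1 := by
    rw [div_le_iff₀ (by positivity)]; nlinarith [Nat.cast_nonneg (α := ℝ) n]
  have hpi := Real.pi_pos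
  have hinv : IntegrableOn (fun t : ℝ => t⁻¹) (Set.Ioc (1 / ((n : ℝ) + 1)) (n + 1)) := by
    rw [← intervalIntegrable_iff_integrableOn_Ioc_of_le hle]
    refine ContinuousOn.intervalIntegrable (continuousOn_inv₀.mono fun t ht => ?_)
    rw [Set.uIcc_of_le hle] at ht
    exact (hpos.trans_le ht.1).ne'
  have hff : Integrable (fun p : Rd d × Rd d => f p.1 * f p.2) := hf.mul_prod hf
  have hF : Integrable (fun q : ℝ × (Rd d × Rd d) => (Real.exp (-Real.pi * ‖q.2.1 - q.2.2‖ ^ 2 / q.1)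
      - Real.exp (-Real.pi / q.1)) * (q.1⁻¹ * (f q.2.1 * f q.2.2)))
      ((volume.restrict (Set.Ioc (1 / ((n : ℝ) + 1)) (n + 1))).prod volume) := by
    refine (Integrable.mul_prod hinv hff).bdd_mul (c := 1)
      (Measurable.aestronglyMeasurable (by fun_prop)) ?_
    have hmem : ∀ᵐ q ∂((volume.restrict (Set.Ioc (1 / ((n : ℝ) + 1)) (n + 1))).prod
        (volume : Measure (Rd d × Rd d))), q.1 ∈ Set.Ioc (1 / ((n : ℝ) + 1)) ((n : ℝ) + 1) :=
      Measure.quasiMeasurePreserving_fst.ae (ae_restrict_mem measurableSet_Ioc)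
    filter_upwards [hmem] with q hq
    have hq0 := hpos.trans hq.1
    have h1 : Real.exp (-Real.pi * ‖q.2.1 - q.2.2‖ ^ 2 / q.1) ≤ 1 := by
      rw [Real.exp_le_one_iff, neg_mul, neg_div]; exact neg_nonpos.2 (by positivity)
    have h2 : Real.exp (-Real.pi / q.1) ≤ 1 := by
      rw [Real.exp_le_one_iff, neg_div]; exact neg_nonpos.2 (by positivity)
    have h3 := Real.exp_pos (-Real.pi * ‖q.2.1 - q.2.2‖ ^ 2 / q.1)
    have h4 := Real.exp_pos (-Real.pi / q.1)
    rw [Real.norm_eq_abs, abs_le]; constructor <;> linarith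
  have e1 : ∀ t ∈ Set.Ioc (1 / ((n : ℝ) + 1)) ((n : ℝ) + 1), t⁻¹ * gaussianEnergy f t =
      ∫ p : Rd d × Rd d, (Real.exp (-Real.pi * ‖p.1 - p.2‖ ^ 2 / t)
        - Real.exp (-Real.pi / t)) * (t⁻¹ * (f p.1 * f p.2)) := by
    intro t ht
    rw [gaussianEnergy_eq hf h0 (hpos.trans ht.1), ← integral_const_mul]
    congr 1; ext p; ring
  have e2 : ∀ p : Rd d × Rd d, f p.1 * f p.2 * logTrunc n ‖p.1 - p.2‖ =
      ∫ t in Set.Ioc (1 / ((n : ℝ) + 1)) (n + 1), (Real.exp (-Real.pi * ‖p.1 - p.2‖ ^ 2 / t)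
        - Real.exp (-Real.pi / t)) * (t⁻¹ * (f p.1 * f p.2)) := by
    intro p
    rw [logTrunc, intervalIntegral.integral_of_le hle, ← integral_const_mul]
    congr 1; ext t; ring
  refine ⟨?_, ?_, ?_⟩
  · exact (integrableOn_congr_fun e1 measurableSet_Ioc).2 hF.integral_prod_left
  · simp only [e2]; exact hF.integral_prod_right
  · rw [setIntegral_congr_fun measurableSet_Ioc e1]
    simp only [e2]
    exact integral_integral_swap hF

/-- The physical-space limit of the truncated energies, by dominated convergence. Comparing it with
the Fourier-side limit of the same quantities identifies the logarithmic energy with the weighted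
norm. -/
theorem tendsto_integral_gaussianEnergy [NeZero d] (φ : 𝓢(Rd d, ℝ)) (h0 : ∫ x, φ x = 0) :
    Tendsto (fun n : ℕ => ∫ t in Set.Ioc (1 / ((n : ℝ) + 1)) (n + 1), t⁻¹ * gaussianEnergy φ t)
      atTop (𝓝 (2 * ∫ x : Rd d, ∫ y : Rd d, φ x * φ y * Real.log (1 / ‖x - y‖))) := by
  have hlog : Integrable (fun p : Rd d × Rd d => φ p.1 * φ p.2 * Real.log (1 / ‖p.1 - p.2‖))
      ((volume : Measure (Rd d)).prod volume) := by
    refine (integrable_mul_mul_log φ).neg.congr (ae_of_all _ fun p => ?_)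
    simp only [Pi.neg_apply, one_div, Real.log_inv, mul_neg]
  rw [← integral_prod (fun p : Rd d × Rd d => φ p.1 * φ p.2 * Real.log (1 / ‖p.1 - p.2‖)) hlog,
    ← integral_const_mul]
  have hc := fun n => (integral_gaussianEnergy φ.integrable h0 n)
  simp only [fun n => (hc n).2.2]
  refine tendsto_integral_of_dominated_convergence
    (fun p => 2 * |φ p.1 * φ p.2 * Real.log ‖p.1 - p.2‖|)
    (fun n => (hc n).2.1.aestronglyMeasurable) ((integrable_mul_mul_log φ).abs.const_mul 2) ?_ ?_
  · intro n
    filter_upwards [ae_fst_ne_snd d] with p hp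
    have := abs_logTrunc_le (norm_pos_iff.2 (sub_ne_zero.2 hp)) n
    rw [Real.norm_eq_abs, abs_mul, abs_mul (φ p.1 * φ p.2)]
    calc _ ≤ |φ p.1 * φ p.2| * (2 * |Real.log ‖p.1 - p.2‖|) := by gcongr
      _ = _ := by ring
  · filter_upwards [ae_fst_ne_snd d] with p hp
    have := (tendsto_logTrunc (norm_pos_iff.2 (sub_ne_zero.2 hp))).const_mul (φ p.1 * φ p.2)
    refine this.trans (le_of_eq ?_)
    congr 1; ring

/-! ### The logarithmic energy as a weighted norm on the Fourier side -/

/-- The weight of `ℋ^{-d/2}(ℝ^d)` on the Fourier side. -/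
noncomputable def hnegWeight (d : ℕ) (ξ : Rd d) : ℝ≥0∞ :=
  ENNReal.ofReal ((sphereArea d * ‖ξ‖ ^ d)⁻¹)

theorem measurable_hnegWeight (d : ℕ) : Measurable (hnegWeight d) := by
  unfold hnegWeight; fun_prop

/-- The constants combine: `k_d (2π)^d` is the area of the unit sphere, the same constant that
occurs in the symbol. -/
theorem normSqHNeg_eq_lintegral [NeZero d] (f : Rd d → ℝ) :
    normSqHNeg f = ∫⁻ ξ, ‖fourierReal f ξ‖ₑ ^ 2 * hnegWeight d ξ := by
  rw [normSqHNeg, ← lintegral_const_mul' _ _ ENNReal.ofReal_ne_top]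
  refine lintegral_congr fun ξ => ?_
  have hG : 0 < Real.Gamma ((d : ℝ) / 2) := Real.Gamma_pos_of_pos (by
    have : (0:ℝ) < d := by exact_mod_cast NeZero.pos d
    positivity)
  have hS := sphereArea_pos d
  rw [← ofReal_norm, ← ENNReal.ofReal_pow (norm_nonneg _), hnegWeight,
    ← ENNReal.ofReal_mul (by positivity), ← ENNReal.ofReal_mul (by positivity)]
  congr 1
  have e1 : (2:ℝ) ^ (1 - (d : ℝ)) = 2 / 2 ^ d := by
    rw [Real.rpow_sub two_pos, Real.rpow_one, Real.rpow_natCast]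
  have e2 : Real.pi ^ (-(d : ℝ) / 2) = (Real.pi ^ ((d : ℝ) / 2))⁻¹ := by
    rw [neg_div, Real.rpow_neg Real.pi_pos.le]
  have e3 : Real.pi ^ d = Real.pi ^ ((d : ℝ) / 2) * Real.pi ^ ((d : ℝ) / 2) := by
    rw [← Real.rpow_add Real.pi_pos, add_halves, Real.rpow_natCast]
  have hp : 0 < Real.pi ^ ((d : ℝ) / 2) := Real.rpow_pos_of_pos Real.pi_pos _
  rw [sphereArea, mul_pow, mul_pow, e1, e2, e3]
  rcases eq_or_ne ‖ξ‖ 0 with h | h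
  · simp [h, NeZero.ne d]
  · field_simp

/-- The Gamma integral `∫ t^{d/2-1} e^{-π|ξ|²t} dt = Γ(d/2) π^{-d/2} |ξ|^{-d}`. -/
theorem lintegral_gaussianEnergy_kernel [NeZero d] {ξ : Rd d} (hξ : ξ ≠ 0) :
    ∫⁻ t in Set.Ioi (0:ℝ), ENNReal.ofReal
      (t⁻¹ * (t ^ ((d : ℝ) / 2) * Real.exp (-(Real.pi * t) * ‖ξ‖ ^ 2))) = 2 * hnegWeight d ξ := by
  have hd : (0:ℝ) < d := by exact_mod_cast NeZero.pos d
  have hξ' := norm_pos_iff.2 hξ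
  have hr : 0 < Real.pi * ‖ξ‖ ^ 2 := by positivity
  have hG : 0 < Real.Gamma ((d : ℝ) / 2) := Real.Gamma_pos_of_pos (by positivity)
  have h := Real.integral_rpow_mul_exp_neg_mul_Ioi (a := (d : ℝ) / 2) (by positivity) hr
  have hI : IntegrableOn (fun t : ℝ => t ^ ((d : ℝ) / 2 - 1) *
      Real.exp (-(Real.pi * ‖ξ‖ ^ 2 * t))) (Set.Ioi 0) := by
    refine Integrable.of_integral_ne_zero ?_
    rw [h]
    positivity
  have e : ∀ t ∈ Set.Ioi (0:ℝ), ENNReal.ofReal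
      (t⁻¹ * (t ^ ((d : ℝ) / 2) * Real.exp (-(Real.pi * t) * ‖ξ‖ ^ 2))) =
      ENNReal.ofReal (t ^ ((d : ℝ) / 2 - 1) * Real.exp (-(Real.pi * ‖ξ‖ ^ 2 * t))) := by
    intro t ht
    rw [Real.rpow_sub ht, Real.rpow_one, ← mul_assoc]
    congr 2
    · field_simp
    · congr 1; ring
  rw [setLIntegral_congr_fun measurableSet_Ioi e, ← ofReal_integral_eq_lintegral_ofReal hI ?_, h]
  · have e3 : (1 / (Real.pi * ‖ξ‖ ^ 2)) ^ ((d : ℝ) / 2) =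
        (Real.pi ^ ((d : ℝ) / 2) * ‖ξ‖ ^ d)⁻¹ := by
      rw [one_div, Real.inv_rpow hr.le, Real.mul_rpow Real.pi_pos.le (by positivity),
        ← Real.rpow_natCast, ← Real.rpow_mul hξ'.le, ← Real.rpow_natCast ‖ξ‖ d]
      congr 3; push_cast; ring
    have hp : 0 < Real.pi ^ ((d : ℝ) / 2) := Real.rpow_pos_of_pos Real.pi_pos _
    have e5 : 2 * hnegWeight d ξ = ENNReal.ofReal (2 * (sphereArea d * ‖ξ‖ ^ d)⁻¹) := by
      rw [ENNReal.ofReal_mul zero_le_two, ENNReal.ofReal_ofNat, hnegWeight]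
    rw [e3, e5, sphereArea]
    congr 1
    field_simp
  · filter_upwards [ae_restrict_mem measurableSet_Ioi] with t ht
    have : (0:ℝ) < t := ht
    positivity

/-- On the Fourier side everything is nonnegative, so Tonelli and exhaustion of `(0, ∞)` suffice,
even before the weighted norm is known to be finite. -/
theorem tendsto_ofReal_integral_gaussianEnergy [NeZero d] (φ : 𝓢(Rd d, ℝ))
    (h0 : ∫ x, φ x = 0) :
    Tendsto (fun n : ℕ => ENNReal.ofReal
      (∫ t in Set.Ioc (1 / ((n : ℝ) + 1)) (n + 1), t⁻¹ * gaussianEnergy φ t))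
      atTop (𝓝 (2 * normSqHNeg φ)) := by
  have hφ := continuous_fourierReal (φ.integrable (μ := volume))
  have hpos : ∀ n : ℕ, (0:ℝ) < 1 / ((n : ℝ) + 1) := fun n => by positivity
  set w : ℝ → Rd d → ℝ := fun t ξ => t⁻¹ * (t ^ ((d : ℝ) / 2) *
    Real.exp (-(Real.pi * t) * ‖ξ‖ ^ 2)) with hw
  have hbd : ∀ ξ, ‖fourierReal φ ξ‖ ≤ ∫ x, |φ x| := norm_fourierReal_le φ
  have hm : Measurable fun q : ℝ × Rd d => ENNReal.ofReal (w q.1 q.2) * ‖fourierReal φ q.2‖ₑ ^ 2 := by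
    have := hφ.measurable
    simp only [hw]
    fun_prop
  have e1 : ∀ t : ℝ, 0 < t → ENNReal.ofReal (t⁻¹ * gaussianEnergy φ t) =
      ∫⁻ ξ, ENNReal.ofReal (w t ξ) * ‖fourierReal φ ξ‖ₑ ^ 2 := by
    intro t ht
    have hi : Integrable fun ξ : Rd d => t⁻¹ * (t ^ ((d : ℝ) / 2) *
        Real.exp (-(Real.pi * t) * ‖ξ‖ ^ 2) * ‖fourierReal φ ξ‖ ^ 2) := by
      refine Integrable.const_mul ?_ _
      refine Integrable.mul_bdd (c := (∫ x, |φ x|) ^ 2)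
        ((integrable_exp_neg_mul_norm_sq (by positivity)).const_mul _)
        (Continuous.aestronglyMeasurable (by fun_prop)) (ae_of_all _ fun ξ => ?_)
      rw [norm_pow, norm_norm]
      gcongr
      exact hbd ξ
    rw [gaussianEnergy, ← integral_const_mul, ofReal_integral_eq_lintegral_ofReal hi
      (ae_of_all _ fun ξ => by positivity)]
    refine lintegral_congr fun ξ => ?_
    rw [← ofReal_norm, ← ENNReal.ofReal_pow (norm_nonneg _), ← ENNReal.ofReal_mul (by positivity)]
    congr 1
    simp only [hw]; ring
  have e2 : ∀ n : ℕ, ENNReal.ofReal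
      (∫ t in Set.Ioc (1 / ((n : ℝ) + 1)) (n + 1), t⁻¹ * gaussianEnergy φ t) =
      ∫⁻ t in Set.Ioc (1 / ((n : ℝ) + 1)) (n + 1),
        ∫⁻ ξ, ENNReal.ofReal (w t ξ) * ‖fourierReal φ ξ‖ₑ ^ 2 := by
    intro n
    rw [ofReal_integral_eq_lintegral_ofReal (integral_gaussianEnergy φ.integrable h0 n).1 ?_]
    · exact setLIntegral_congr_fun measurableSet_Ioc fun t ht => e1 t ((hpos n).trans ht.1)
    · filter_upwards [ae_restrict_mem measurableSet_Ioc] with t ht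
      have ht0 := (hpos n).trans ht.1
      exact mul_nonneg (by positivity) (integral_nonneg fun ξ => by positivity)
  have e3 : 2 * normSqHNeg φ = ∫⁻ t in Set.Ioi (0:ℝ),
      ∫⁻ ξ, ENNReal.ofReal (w t ξ) * ‖fourierReal φ ξ‖ₑ ^ 2 := by
    have : Nonempty (Fin d) := ⟨0⟩
    have : Nontrivial (Rd d) := inferInstance
    rw [lintegral_lintegral_swap hm.aemeasurable, normSqHNeg_eq_lintegral,
      ← lintegral_const_mul' _ _ (by norm_num)]
    refine lintegral_congr_ae ?_
    filter_upwards [Measure.ae_ne volume (0 : Rd d)] with ξ hξ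
    rw [lintegral_mul_const' _ _ (by finiteness), lintegral_gaussianEnergy_kernel hξ]
    ring
  simp only [e2, e3]
  have hcov : AECover (volume.restrict (Set.Ioi (0:ℝ))) atTop
      (fun n : ℕ => Set.Ioc (1 / ((n : ℝ) + 1)) ((n : ℝ) + 1)) :=
    (aecover_Ioi_of_Ioi tendsto_one_div_add_atTop_nhds_zero_nat).inter
      (aecover_Iic (tendsto_atTop_add_const_right _ _ tendsto_natCast_atTop_atTop))
  have := hcov.lintegral_tendsto_of_nat (f := fun t =>
    ∫⁻ ξ, ENNReal.ofReal (w t ξ) * ‖fourierReal φ ξ‖ₑ ^ 2) hm.lintegral_prod_right.aemeasurable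
  refine this.congr fun n => ?_
  rw [Measure.restrict_restrict measurableSet_Ioc, Set.inter_eq_left.2]
  exact fun t ht => (hpos n).trans ht.1

/-- The logarithmic energy of a Schwartz function with zero integral is its squared norm in
`ℋ^{-d/2}(ℝ^d)`. -/
theorem ofReal_logEnergy [NeZero d] (φ : schwartzZero d) :
    ENNReal.ofReal (∫ x : Rd d, ∫ y : Rd d,
      (φ : 𝓢(Rd d, ℝ)) x * (φ : 𝓢(Rd d, ℝ)) y * Real.log (1 / ‖x - y‖)) =
      normSqHNeg (φ : 𝓢(Rd d, ℝ)) := by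
  have h1 := tendsto_ofReal_integral_gaussianEnergy (φ : 𝓢(Rd d, ℝ)) φ.2
  have h2 := ENNReal.tendsto_ofReal (tendsto_integral_gaussianEnergy (φ : 𝓢(Rd d, ℝ)) φ.2)
  have h := tendsto_nhds_unique h1 h2
  rw [ENNReal.ofReal_mul zero_le_two, ENNReal.ofReal_ofNat] at h
  exact ((ENNReal.mul_right_inj two_ne_zero (by norm_num)).1 h).symm

end LogEnergy

/-! ### The covariance structure of the two fields -/

section Covariance

variable {d : ℕ} {ι : Type*}

/-- The Fourier multiplier of the linear combination `∑ i ∈ s, a i (f(x i) - f(y i))`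
of increments. -/
noncomputable def waveSum (s : Finset ι) (a : ι → ℝ) (x y : ι → Rd d) (ξ : Rd d) : ℂ :=
  ∑ i ∈ s, (a i : ℂ) * (waveChar (x i) ξ - waveChar (y i) ξ)

theorem continuous_waveSum (s : Finset ι) (a : ι → ℝ) (x y : ι → Rd d) :
    Continuous (waveSum s a x y) :=
  continuous_finsetSum _ fun i _ => continuous_const.mul
    ((continuous_waveChar (x i)).sub (continuous_waveChar (y i)))

theorem norm_waveChar_sub_le (x y ξ : Rd d) :
    ‖waveChar x ξ - waveChar y ξ‖ ≤ 2 * Real.pi * ‖x - y‖ * ‖ξ‖ := by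
  have h1 : waveChar x ξ - waveChar y ξ = waveChar y ξ * (waveChar (x - y) ξ - 1) := by
    have : waveChar x ξ = waveChar y ξ * waveChar (x - y) ξ := by
      simp only [waveChar]
      rw [← Circle.coe_mul, ← AddChar.map_add_eq_mul, inner_sub_left]
      congr 3; ring
    rw [this]; ring
  have h2 : waveChar (x - y) ξ =
      Complex.exp (Complex.I * ((2 * Real.pi * -inner ℝ (x - y) ξ : ℝ) : ℂ)) := by
    rw [waveChar, Real.fourierChar_apply, mul_comm]
  rw [h1, norm_mul, norm_waveChar, one_mul, h2]
  refine Real.norm_exp_I_mul_ofReal_sub_one_le.trans ?_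
  rw [Real.norm_eq_abs, abs_mul, abs_neg, abs_of_pos (by positivity : 0 < 2 * Real.pi),
    mul_assoc (2 * Real.pi)]
  exact mul_le_mul_of_nonneg_left (abs_real_inner_le_norm (x - y) ξ) (by positivity)

theorem norm_waveSum_le (s : Finset ι) (a : ι → ℝ) (x y : ι → Rd d) :
    ∃ C : ℝ, 0 ≤ C ∧ ∀ ξ, ‖waveSum s a x y ξ‖ ≤ C * ‖ξ‖ := by
  refine ⟨∑ i ∈ s, |a i| * (2 * Real.pi * ‖x i - y i‖), by positivity, fun ξ => ?_⟩
  rw [Finset.sum_mul]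
  refine (norm_sum_le _ _).trans (Finset.sum_le_sum fun i _ => ?_)
  rw [norm_mul, Complex.norm_real, Real.norm_eq_abs, mul_assoc]
  gcongr
  exact norm_waveChar_sub_le _ _ _

theorem IsAdmissibleKernel.measurable_whiteNoiseIntegrand {k : Rd d → ℝ}
    (hk : IsAdmissibleKernel k) (ε : ℝ) (x y : Rd d) :
    Measurable (whiteNoiseIntegrand k ε x y) := by
  have := hk.smooth.continuous.measurable
  unfold whiteNoiseIntegrand
  refine Measurable.indicator (by fun_prop) (measurableSet_lt measurable_const measurable_snd)

theorem fourierReal_rescale_sub {K : Rd d → ℝ} (hK : IsRadial K) {ε : ℝ} (hε : 0 < ε)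
    (x ξ : Rd d) :
    fourierReal (fun w => rescale K ε (x - w)) ξ = waveChar x ξ * fourierReal K (ε • ξ) := by
  have h1 : fourierReal (rescale K ε) (-ξ) = fourierReal K (ε • ξ) := by
    unfold rescale
    rw [fourierReal_const_mul, fourierReal_comp_inv_smul K hε, smul_neg, hK.fourierReal_neg]
    have : (ε : ℂ) ^ d ≠ 0 := pow_ne_zero _ (by exact_mod_cast hε.ne')
    push_cast
    rw [← mul_assoc, inv_mul_cancel₀ this, one_mul]
  rw [fourierReal_comp_sub, h1]

theorem integrable_rescale_sub {K : Rd d → ℝ} (hK : Integrable K) {ε : ℝ} (hε : 0 < ε)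
    (x : Rd d) : Integrable fun w => rescale K ε (x - w) := by
  unfold rescale
  exact ((hK.comp_smul (inv_ne_zero hε.ne')).comp_sub_left x).const_mul _

/-- The increment of the convolution kernel. -/
noncomputable def kernelIncr (K : Rd d → ℝ) (ε : ℝ) (x y w : Rd d) : ℝ :=
  rescale K ε (x - w) - rescale K ε (y - w)

theorem integrable_kernelIncr {K : Rd d → ℝ} (hK : Integrable K) {ε : ℝ} (hε : 0 < ε)
    (x y : Rd d) : Integrable (kernelIncr K ε x y) :=
  (integrable_rescale_sub hK hε x).sub (integrable_rescale_sub hK hε y)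

theorem fourierReal_kernelIncr {K : Rd d → ℝ} (hK : Integrable K) (hr : IsRadial K) {ε : ℝ}
    (hε : 0 < ε) (x y ξ : Rd d) :
    fourierReal (kernelIncr K ε x y) ξ =
      (waveChar x ξ - waveChar y ξ) * fourierReal K (ε • ξ) := by
  unfold kernelIncr
  rw [fourierReal_sub (integrable_rescale_sub hK hε x) (integrable_rescale_sub hK hε y),
    fourierReal_rescale_sub hr hε, fourierReal_rescale_sub hr hε, sub_mul]

variable [NeZero d] {k : Rd d → ℝ}

/-- The variance of a linear combination of increments, on the Fourier side. -/
noncomputable def symbolVariance (k : Rd d → ℝ) (ε : ℝ) (T : Rd d → ℂ) : ℝ≥0∞ :=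
  ∫⁻ ξ, ‖T ξ‖ₑ ^ 2 * ENNReal.ofReal (kernelSymbol k (ε • ξ) ^ 2) * hnegWeight d ξ

namespace IsAdmissibleKernel

/-- Substituting `u = t‖ξ‖` turns the integral over scales `t > ε` into the tail beyond `ε‖ξ‖` that
defines `σ(εξ)²`, with the factor `‖ξ‖^{-d}` left over. This identity is the reason for the form of
the symbol. -/
theorem lintegral_fourierProfile (hk : IsAdmissibleKernel k) {ε : ℝ} (hε : 0 < ε) {ξ : Rd d}
    (hξ : ξ ≠ 0) :
    ∫⁻ t in Set.Ioi ε, ENNReal.ofReal (t ^ (d - 1) * ‖fourierProfile k (t * ‖ξ‖)‖ ^ 2) =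
      ENNReal.ofReal (kernelSymbol k (ε • ξ) ^ 2) * hnegWeight d ξ := by
  have hr := norm_pos_iff.2 hξ
  set r := ‖ξ‖ with hrdef
  have hS := sphereArea_pos d
  have hd : d - 1 + 1 = d := Nat.sub_add_cancel (NeZero.pos d)
  have e : ∀ t : ℝ, t ^ (d - 1) * ‖fourierProfile k (t * r)‖ ^ 2 =
      (r ^ (d - 1))⁻¹ * ((r * t) ^ (d - 1) * ‖fourierProfile k (r * t)‖ ^ 2) := by
    intro t
    rw [mul_pow, mul_comm t r]
    field_simp
  have hint : IntegrableOn (fun t : ℝ => (r * t) ^ (d - 1) * ‖fourierProfile k (r * t)‖ ^ 2)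
      (Set.Ioi ε) :=
    (integrableOn_Ioi_comp_mul_left_iff (fun u : ℝ => u ^ (d - 1) * ‖fourierProfile k u‖ ^ 2)
      ε hr).2 (hk.integrableOn_Ioi (d - 1) (by positivity))
  simp only [e]
  rw [← ofReal_integral_eq_lintegral_ofReal (hint.const_mul _) ?_, integral_const_mul,
    integral_comp_mul_left_Ioi (fun u : ℝ => u ^ (d - 1) * ‖fourierProfile k u‖ ^ 2) ε hr,
    kernelSymbol_eq, Real.sq_sqrt (symbolProfile_nonneg k (norm_nonneg _)), symbolProfile,
    norm_smul, Real.norm_of_nonneg hε.le, ← hrdef, mul_comm r ε, hnegWeight,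
    ← ENNReal.ofReal_mul]
  · congr 1
    have : r ^ d = r ^ (d - 1) * r := by rw [← pow_succ, hd]
    rw [← hrdef, this, smul_eq_mul]
    field_simp
  · refine mul_nonneg hS.le (setIntegral_nonneg measurableSet_Ioi fun t ht => ?_)
    have : 0 < t := lt_trans (by positivity) (Set.mem_Ioi.1 ht)
    positivity
  · filter_upwards [ae_restrict_mem measurableSet_Ioi] with t ht
    have : 0 < t := hε.trans ht
    positivity

/-- Plancherel at a fixed scale `t`. Dilation contributes `t^d` to the transform, so the power of
`t` is `t^{-(d+1)} t^{2d} = t^{d-1}`, and translations produce the multiplier `waveSum`. -/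
theorem lintegral_slice (hk : IsAdmissibleKernel k) (s : Finset ι) (a : ι → ℝ)
    (x y : ι → Rd d) {t : ℝ} (ht : 0 < t) :
    ∫⁻ w : Rd d, ‖∑ i ∈ s, a i * ((k (t⁻¹ • (x i - w)) - k (t⁻¹ • (y i - w))) *
      t ^ (-((d : ℝ) + 1) / 2))‖ₑ ^ 2 =
    ∫⁻ ξ : Rd d, ENNReal.ofReal (t ^ (d - 1) * ‖fourierProfile k (t * ‖ξ‖)‖ ^ 2) *
      ‖waveSum s a x y ξ‖ₑ ^ 2 := by
  set u : Rd d → ℝ := fun w => ∑ i ∈ s, a i * ((k (t⁻¹ • (x i - w)) - k (t⁻¹ • (y i - w))) *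
      t ^ (-((d : ℝ) + 1) / 2)) with hu
  have hkt : ∀ z : Rd d, HasCompactSupport fun w : Rd d => k (t⁻¹ • (z - w)) := by
    intro z
    have h1 : HasCompactSupport fun w : Rd d => k (t⁻¹ • w) :=
      hk.compact_support.comp_smul (inv_ne_zero ht.ne')
    exact h1.comp_homeomorph (Homeomorph.subLeft z)
  have hkc : ∀ z : Rd d, ContDiff ℝ (⊤ : ℕ∞) fun w : Rd d => k (t⁻¹ • (z - w)) := fun z =>
    hk.smooth.comp (by fun_prop : ContDiff ℝ (⊤ : ℕ∞) fun w : Rd d => t⁻¹ • (z - w))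
  have hki : ∀ z : Rd d, Integrable fun w : Rd d => k (t⁻¹ • (z - w)) := fun z =>
    (hkc z).continuous.integrable_of_hasCompactSupport (hkt z)
  have hterm : ∀ i, HasCompactSupport fun w : Rd d =>
      a i * ((k (t⁻¹ • (x i - w)) - k (t⁻¹ • (y i - w))) * t ^ (-((d : ℝ) + 1) / 2)) := fun i =>
    (((hkt (x i)).sub (hkt (y i))).mul_right (f' := fun _ => t ^ (-((d : ℝ) + 1) / 2))).mul_left
      (f := fun _ => a i)
  have huc : HasCompactSupport u := by
    rw [hu]
    classical
    induction s using Finset.induction_on with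
    | empty =>
      simp only [Finset.sum_empty]
      exact HasCompactSupport.zero
    | insert i s hi ih =>
      simp only [Finset.sum_insert hi]
      exact (hterm i).add (ih rfl)
  have hud : ContDiff ℝ (⊤ : ℕ∞) u :=
    ContDiff.sum fun i _ => contDiff_const.mul (((hkc (x i)).sub (hkc (y i))).mul contDiff_const)
  have hucc : HasCompactSupport fun w => (u w : ℂ) :=
    huc.comp_left (g := Complex.ofReal) Complex.ofReal_zero
  let U : 𝓢(Rd d, ℂ) := hucc.toSchwartzMap (Complex.ofRealCLM.contDiff.comp hud)
  have hPl := SchwartzMap.integral_norm_sq_fourier U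
  have hU : ∀ ξ, 𝓕 U ξ = fourierReal u ξ := fun ξ => rfl
  have hfour : ∀ ξ, fourierReal u ξ =
      (t ^ (-((d : ℝ) + 1) / 2) : ℝ) * ((t : ℂ) ^ d * fourierReal k (t • ξ)) *
        waveSum s a x y ξ := by
    intro ξ
    have h1 : ∀ z : Rd d, fourierReal (fun w => k (t⁻¹ • (z - w))) ξ =
        waveChar z ξ * ((t : ℂ) ^ d * fourierReal k (t • ξ)) := by
      intro z
      rw [fourierReal_comp_sub (fun w => k (t⁻¹ • w)) z ξ, fourierReal_comp_inv_smul k ht,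
        smul_neg, hk.radial.fourierReal_neg]
    rw [hu, fourierReal_finset_sum s (f := fun i w =>
      a i * ((k (t⁻¹ • (x i - w)) - k (t⁻¹ • (y i - w))) * t ^ (-((d : ℝ) + 1) / 2)))
      (fun i _ => (((hki (x i)).sub (hki (y i))).mul_const _).const_mul _), waveSum,
      Finset.mul_sum]
    refine Finset.sum_congr rfl fun i _ => ?_
    have h2 : (fun w : Rd d =>
        a i * ((k (t⁻¹ • (x i - w)) - k (t⁻¹ • (y i - w))) * t ^ (-((d : ℝ) + 1) / 2))) =
        fun w => (a i * t ^ (-((d : ℝ) + 1) / 2)) *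
          (k (t⁻¹ • (x i - w)) - k (t⁻¹ • (y i - w))) := by ext w; ring
    rw [h2, fourierReal_const_mul, fourierReal_sub (hki _) (hki _), h1, h1]
    push_cast
    ring
  have e1 : ∀ f : 𝓢(Rd d, ℂ), ∫⁻ w, ‖f w‖ₑ ^ 2 = ENNReal.ofReal (∫ w, ‖f w‖ ^ 2) := by
    intro f
    have hi : Integrable fun w => ‖f w‖ ^ 2 := (f.memLp 2).integrable_norm_pow two_ne_zero
    rw [ofReal_integral_eq_lintegral_ofReal hi (ae_of_all _ fun w => by positivity)]
    refine lintegral_congr fun w => ?_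
    rw [← ofReal_norm, ENNReal.ofReal_pow (norm_nonneg _)]
  have e2 := e1 U
  rw [← hPl, ← e1 (𝓕 U)] at e2
  have e3 : ∀ w, ‖U w‖ₑ = ‖u w‖ₑ := fun w => by
    rw [← ofReal_norm, ← ofReal_norm]
    exact congrArg _ (Complex.norm_real (u w))
  simp only [e3] at e2
  rw [e2]
  refine lintegral_congr fun ξ => ?_
  rw [hU, hfour, hk.radial.fourierReal_eq_profile, norm_smul, Real.norm_of_nonneg ht.le,
    ← ofReal_norm, ← ofReal_norm, ← ENNReal.ofReal_pow (norm_nonneg _),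
    ← ENNReal.ofReal_pow (norm_nonneg _), ← ENNReal.ofReal_mul (by positivity)]
  congr 1
  rw [norm_mul, norm_mul, norm_mul, norm_pow, Complex.norm_real, Complex.norm_real,
    Real.norm_of_nonneg ht.le, Real.norm_of_nonneg (by positivity), mul_pow, mul_pow, mul_pow]
  have e4 : (t ^ (-((d : ℝ) + 1) / 2)) ^ 2 * (t ^ d) ^ 2 = t ^ (d - 1) := by
    have hd : 1 ≤ d := NeZero.pos d
    rw [← Real.rpow_natCast (t ^ (-((d : ℝ) + 1) / 2)), ← Real.rpow_mul ht.le,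
      ← Real.rpow_natCast t d, ← Real.rpow_natCast (t ^ (d : ℝ)), ← Real.rpow_mul ht.le,
      ← Real.rpow_add ht, ← Real.rpow_natCast t (d - 1)]
    congr 1
    push_cast [Nat.cast_sub hd]
    ring
  rw [← e4]
  ring

/-- The `L²` norm of a linear combination of white noise integrands. -/
theorem lintegral_sum_whiteNoiseIntegrand (hk : IsAdmissibleKernel k) {ε : ℝ} (hε : 0 < ε)
    (s : Finset ι) (a : ι → ℝ) (x y : ι → Rd d) :
    ∫⁻ p, ‖∑ i ∈ s, a i * whiteNoiseIntegrand k ε (x i) (y i) p‖ₑ ^ 2 ∂(spaceTime d) =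
      symbolVariance k ε (waveSum s a x y) := by
  have hm : Measurable fun p : Rd d × ℝ =>
      ‖∑ i ∈ s, a i * whiteNoiseIntegrand k ε (x i) (y i) p‖ₑ ^ 2 := by
    have := fun i => hk.measurable_whiteNoiseIntegrand ε (x i) (y i)
    fun_prop
  have hp := hk.continuous_fourierProfile.measurable
  have hw := (continuous_waveSum s a x y).measurable
  rw [spaceTime, lintegral_prod_symm _ hm.aemeasurable]
  have h1 : ∀ t ∈ Set.Ioi (0:ℝ),
      ∫⁻ w : Rd d, ‖∑ i ∈ s, a i * whiteNoiseIntegrand k ε (x i) (y i) (w, t)‖ₑ ^ 2 =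
      (Set.Ioi ε).indicator (fun t => ∫⁻ ξ : Rd d,
        ENNReal.ofReal (t ^ (d - 1) * ‖fourierProfile k (t * ‖ξ‖)‖ ^ 2) *
          ‖waveSum s a x y ξ‖ₑ ^ 2) t := by
    intro t ht
    by_cases h : ε < t
    · rw [Set.indicator_of_mem (Set.mem_Ioi.2 h), ← hk.lintegral_slice s a x y ht]
      refine lintegral_congr fun w => ?_
      simp only [whiteNoiseIntegrand]
      simp only [Set.indicator_of_mem (show ((w, t) : Rd d × ℝ) ∈ {p : Rd d × ℝ | ε < p.2} from h)]
    · rw [Set.indicator_of_notMem (by simpa using h)]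
      have h0 : ∀ w i, whiteNoiseIntegrand k ε (x i) (y i) (w, t) = 0 := fun w i =>
        Set.indicator_of_notMem (show ((w, t) : Rd d × ℝ) ∉ {p : Rd d × ℝ | ε < p.2} from h) _
      simp only [h0]
      simp
  rw [setLIntegral_congr_fun measurableSet_Ioi h1, lintegral_indicator measurableSet_Ioi,
    Measure.restrict_restrict measurableSet_Ioi, Set.inter_eq_left.2 (Set.Ioi_subset_Ioi hε.le),
    lintegral_lintegral_swap (Measurable.aemeasurable (by fun_prop)), symbolVariance]
  have : Nonempty (Fin d) := ⟨0⟩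
  have : Nontrivial (Rd d) := inferInstance
  refine lintegral_congr_ae ?_
  filter_upwards [Measure.ae_ne volume (0 : Rd d)] with ξ hξ
  rw [lintegral_mul_const' _ _ (by finiteness), hk.lintegral_fourierProfile hε hξ]
  ring

/-- Linear vanishing of `T` at the origin cancels enough of the singularity `‖ξ‖^{-d}`: in polar
coordinates the radial integrand is a multiple of `r γ(εr)`, which is integrable since `γ` decays
rapidly. -/
theorem exists_symbolVariance_le (hk : IsAdmissibleKernel k) {ε : ℝ} (hε : 0 < ε) :
    ∃ M : ℝ, 0 ≤ M ∧ ∀ (T : Rd d → ℂ) (C : ℝ), 0 ≤ C → (∀ ξ, ‖T ξ‖ ≤ C * ‖ξ‖) →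
      symbolVariance k ε T ≤ ENNReal.ofReal (C ^ 2 * M) := by
  have : Nonempty (Fin d) := ⟨0⟩
  have : Nontrivial (Rd d) := inferInstance
  set g : ℝ → ℝ := fun r => r ^ 2 * symbolProfile k (ε * r) * (sphereArea d * r ^ d)⁻¹ with hg
  have hS := sphereArea_pos d
  have hgk : ∀ ξ : Rd d, g ‖ξ‖ = ‖ξ‖ ^ 2 * kernelSymbol k (ε • ξ) ^ 2 *
      (sphereArea d * ‖ξ‖ ^ d)⁻¹ := by
    intro ξ
    rw [kernelSymbol_eq, Real.sq_sqrt (symbolProfile_nonneg k (norm_nonneg _)), norm_smul,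
      Real.norm_of_nonneg hε.le]
  have hint : Integrable fun ξ : Rd d => g ‖ξ‖ := by
    rw [integrable_fun_norm_addHaar, finrank_euclideanSpace_fin]
    obtain ⟨C₀, hC₀⟩ := hk.symbolProfile_decay 0
    obtain ⟨C₃, hC₃⟩ := hk.symbolProfile_decay 3
    have hcont : ContinuousOn (fun r : ℝ => r * symbolProfile k (ε * r)) (Set.Ioi 0) := by
      have h1 : Continuous fun r : ℝ => kernelSymbol k ((ε * r) • EuclideanSpace.single (0 : Fin d) (1:ℝ)) ^ 2 :=
        (hk.continuous_kernelSymbol.comp (by fun_prop)).pow 2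
      refine (continuous_id.mul h1).continuousOn.congr fun r hr => ?_
      have hr' : (0:ℝ) < r := hr
      rw [Pi.mul_apply, kernelSymbol_eq, Real.sq_sqrt (symbolProfile_nonneg k (norm_nonneg _)), norm_smul,
        Real.norm_of_nonneg (by positivity)]
      simp
    have e : ∀ r ∈ Set.Ioi (0:ℝ), r ^ (d - 1) • g r =
        (sphereArea d)⁻¹ * (r * symbolProfile k (ε * r)) := by
      intro r hr
      have hr' : (0:ℝ) < r := hr
      have : r ^ d = r ^ (d - 1) * r := by rw [← pow_succ, Nat.sub_add_cancel (NeZero.pos d)]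
      rw [hg, smul_eq_mul]
      simp only [this]
      field_simp
    rw [integrableOn_congr_fun e measurableSet_Ioi]
    refine Integrable.const_mul ?_ _
    have hb : IntegrableOn (fun r : ℝ => (C₀ + C₃ / ε ^ 3) * (1 + r ^ 2)⁻¹) (Set.Ioi 0) :=
      (integrable_inv_one_add_sq.const_mul _).integrableOn
    refine Integrable.mono' (hb.const_mul 2) (hcont.aestronglyMeasurable measurableSet_Ioi) ?_
    filter_upwards [ae_restrict_mem measurableSet_Ioi] with r hr
    have hr' : (0:ℝ) < r := hr
    have h0 := symbolProfile_nonneg k (show 0 ≤ ε * r by positivity)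
    have b0 := hC₀ (ε * r) (by positivity)
    have b3 := hC₃ (ε * r) (by positivity)
    rw [pow_zero, one_mul] at b0
    rw [Real.norm_of_nonneg (by positivity)]
    have b3' : r ^ 3 * symbolProfile k (ε * r) ≤ C₃ / ε ^ 3 := by
      rw [le_div_iff₀ (by positivity)]
      calc _ = (ε * r) ^ 3 * symbolProfile k (ε * r) := by ring
        _ ≤ C₃ := b3
    have hmain : r * symbolProfile k (ε * r) * (1 + r ^ 2) ≤ 2 * (C₀ + C₃ / ε ^ 3) := by
      have : r ≤ 1 + r ^ 3 := by
        rcases le_total r 1 with h | h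
        · linarith [pow_pos hr' 3]
        · linarith [le_self_pow₀ h (three_ne_zero)]
      have := mul_le_mul_of_nonneg_right this h0
      have hC3 : 0 ≤ C₃ / ε ^ 3 := le_trans (by positivity) b3'
      have hC0 : 0 ≤ C₀ := h0.trans b0
      nlinarith
    rw [← mul_assoc, ← div_eq_mul_inv, le_div_iff₀ (by positivity)]
    exact hmain
  refine ⟨∫ ξ : Rd d, g ‖ξ‖, integral_nonneg fun ξ => by rw [hgk]; positivity, fun T C hC hT => ?_⟩
  rw [ENNReal.ofReal_mul (by positivity), ofReal_integral_eq_lintegral_ofReal hint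
    (ae_of_all _ fun ξ => by simp only [Pi.zero_apply]; rw [hgk]; positivity), symbolVariance,
    ← lintegral_const_mul' _ _ ENNReal.ofReal_ne_top]
  refine lintegral_mono fun ξ => ?_
  rw [hgk, ← ofReal_norm, ← ENNReal.ofReal_pow (norm_nonneg _), hnegWeight,
    ← ENNReal.ofReal_mul (by positivity), ← ENNReal.ofReal_mul (by positivity),
    ← ENNReal.ofReal_mul (by positivity)]
  refine ENNReal.ofReal_le_ofReal ?_
  have := hT ξ
  calc _ ≤ (C * ‖ξ‖) ^ 2 * kernelSymbol k (ε • ξ) ^ 2 * (sphereArea d * ‖ξ‖ ^ d)⁻¹ := by gcongr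
    _ = _ := by ring

theorem symbolVariance_waveSum_lt_top (hk : IsAdmissibleKernel k) {ε : ℝ} (hε : 0 < ε)
    (s : Finset ι) (a : ι → ℝ) (x y : ι → Rd d) :
    symbolVariance k ε (waveSum s a x y) < ∞ := by
  obtain ⟨M, -, hM⟩ := hk.exists_symbolVariance_le hε
  obtain ⟨C, hC, hT⟩ := norm_waveSum_le s a x y
  exact (hM _ C hC hT).trans_lt ENNReal.ofReal_lt_top

theorem memLp_whiteNoiseIntegrand (hk : IsAdmissibleKernel k) {ε : ℝ} (hε : 0 < ε) (x y : Rd d) :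
    MemLp (whiteNoiseIntegrand k ε x y) 2 (spaceTime d) := by
  refine ⟨(hk.measurable_whiteNoiseIntegrand ε x y).aestronglyMeasurable, ?_⟩
  have h := hk.lintegral_sum_whiteNoiseIntegrand hε (Finset.univ : Finset Unit) (fun _ => 1)
    (fun _ => x) (fun _ => y)
  simp only [Finset.univ_unique, Finset.sum_singleton, one_mul] at h
  rw [eLpNorm_lt_top_iff_lintegral_rpow_enorm_lt_top two_ne_zero (by norm_num)]
  have h2 := hk.symbolVariance_waveSum_lt_top hε (Finset.univ : Finset Unit) (fun _ => 1)
    (fun _ => x) (fun _ => y)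
  simp only [ENNReal.toReal_ofNat, ENNReal.rpow_ofNat]
  simp only [Finset.univ_unique] at h2
  rw [h]
  exact h2

/-! ### The Fourier transforms of the convolution kernels -/

/-- The transform of the rescaled mollifier is `σ(ε·)`, so the weighted norm of the combined kernel
increments is the very integral found for the white noise. This is where the two fields are matched.
-/
theorem normSqHNeg_sum_kernelIncr (hk : IsAdmissibleKernel k) (hd : 2 ≤ d) {ε : ℝ} (hε : 0 < ε)
    (s : Finset ι) (a : ι → ℝ) (x y : ι → Rd d) :
    normSqHNeg (fun w => ∑ i ∈ s, a i * kernelIncr (convKernel k) ε (x i) (y i) w) =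
      symbolVariance k ε (waveSum s a x y) := by
  have hK := hk.integrable_convKernel hd
  rw [normSqHNeg_eq_lintegral, symbolVariance]
  refine lintegral_congr fun ξ => ?_
  congr 1
  rw [fourierReal_finset_sum s fun i _ => (integrable_kernelIncr hK hε (x i) (y i)).const_mul _]
  have : ∀ i ∈ s, fourierReal (fun w => a i * kernelIncr (convKernel k) ε (x i) (y i) w) ξ =
      (a i : ℂ) * (waveChar (x i) ξ - waveChar (y i) ξ) * kernelSymbol k (ε • ξ) := by
    intro i _
    rw [fourierReal_const_mul, fourierReal_kernelIncr hK (isRadial_convKernel k) hε,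
      hk.fourierReal_convKernel hd, mul_assoc]
  rw [Finset.sum_congr rfl this, ← Finset.sum_mul, ← waveSum, enorm_mul, mul_pow]
  congr 1
  rw [← ofReal_norm, Complex.norm_real, ← ENNReal.ofReal_pow (norm_nonneg _), Real.norm_eq_abs,
    sq_abs]

end IsAdmissibleKernel

end Covariance

/-! ### A continuity criterion of Kolmogorov type -/

section Kolmogorov

variable {d : ℕ}

/-- The point of the dyadic grid `2^{-n} ℤ^d` with index `z`. -/
noncomputable def gridPoint (n : ℕ) (z : Fin d → ℤ) : Rd d :=
  WithLp.toLp 2 fun i => (z i : ℝ) / 2 ^ n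

/-- The index of the lower corner of the dyadic cube of side `2^{-n}` that contains `x`. -/
noncomputable def gridFloor (n : ℕ) (x : Rd d) : Fin d → ℤ := fun i => ⌊2 ^ n * x i⌋

theorem gridPoint_apply (n : ℕ) (z : Fin d → ℤ) (i : Fin d) :
    gridPoint n z i = (z i : ℝ) / 2 ^ n := rfl

/-- The indices of grid points in a box of size about `R`. -/
noncomputable def gridBox (d R n : ℕ) : Finset (Fin d → ℤ) :=
  Fintype.piFinset fun _ => Finset.Icc (-((R + 1) * 2 ^ n : ℤ)) ((R + 1) * 2 ^ n)

theorem norm_le_of_forall_abs_le {v : Rd d} {B : ℝ} (hB : 0 ≤ B) (h : ∀ i, |v i| ≤ B) :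
    ‖v‖ ≤ d * B := by
  rw [EuclideanSpace.norm_eq]
  refine (Real.sqrt_le_sqrt (Finset.sum_le_sum (g := fun _ => B ^ 2) fun i _ => ?_)).trans ?_
  · rw [Real.norm_eq_abs]; gcongr; exact h i
  · rw [Finset.sum_const, Finset.card_univ, Fintype.card_fin, nsmul_eq_mul]
    refine Real.sqrt_le_iff.2 ⟨by positivity, ?_⟩
    rw [mul_pow]
    gcongr
    rcases Nat.eq_zero_or_pos d with h0 | h0
    · simp [h0]
    · exact le_self_pow₀ (by exact_mod_cast h0) two_ne_zero

theorem abs_apply_le_norm (v : Rd d) (i : Fin d) : |v i| ≤ ‖v‖ := by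
  rw [← Real.norm_eq_abs]; exact PiLp.norm_apply_le v i

theorem norm_gridPoint_sub_le (n : ℕ) {z w : Fin d → ℤ} (h : ∀ i, |z i - w i| ≤ 2) :
    ‖gridPoint n z - gridPoint n w‖ ≤ 2 * d * (1 / 2) ^ n := by
  have := norm_le_of_forall_abs_le (v := gridPoint n z - gridPoint n w)
    (B := 2 * (1 / 2) ^ n) (by positivity) fun i => by
      rw [PiLp.sub_apply, gridPoint_apply, gridPoint_apply, ← sub_div, abs_div,
        abs_of_pos (by positivity : (0:ℝ) < 2 ^ n), one_div, inv_pow, div_eq_mul_inv]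
      have h' : |(z i : ℝ) - w i| ≤ 2 := by
        rw [← Int.cast_sub, ← Int.cast_abs]; exact_mod_cast h i
      exact mul_le_mul_of_nonneg_right h' (by positivity)
  calc _ ≤ _ := this
    _ = _ := by ring

theorem norm_gridPoint_gridFloor_sub_le (n : ℕ) (x : Rd d) :
    ‖gridPoint n (gridFloor n x) - x‖ ≤ 2 * d * (1 / 2) ^ n := by
  have := norm_le_of_forall_abs_le (v := gridPoint n (gridFloor n x) - x)
    (B := 2 * (1 / 2) ^ n) (by positivity) fun i => by
      have h2 : (0:ℝ) < 2 ^ n := by positivity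
      have h3 : gridPoint n (gridFloor n x) i - x i = (⌊2 ^ n * x i⌋ - 2 ^ n * x i) / 2 ^ n := by
        rw [gridPoint_apply, gridFloor]; field_simp
      rw [PiLp.sub_apply, h3, abs_div, abs_of_pos h2, one_div, inv_pow, div_eq_mul_inv]
      gcongr
      have := Int.floor_le (2 ^ n * x i)
      have := Int.lt_floor_add_one (2 ^ n * x i)
      rw [abs_le]; constructor <;> linarith
  calc _ ≤ _ := this
    _ = _ := by ring

theorem gridFloor_mem_gridBox {R : ℕ} (n : ℕ) {x : Rd d} (hx : ‖x‖ ≤ R) :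
    gridFloor n x ∈ gridBox d R n := by
  rw [gridBox, Fintype.mem_piFinset]
  intro i
  have h1 := abs_le.1 ((abs_apply_le_norm x i).trans hx)
  have h2 : (1:ℝ) ≤ 2 ^ n := one_le_pow₀ one_le_two
  rw [Finset.mem_Icc, gridFloor]
  constructor
  · rw [Int.le_floor]; push_cast; nlinarith
  · rw [← Int.cast_le (R := ℝ)]
    refine (Int.floor_le _).trans ?_
    push_cast; nlinarith

theorem gridPoint_eq_succ (n : ℕ) (z : Fin d → ℤ) :
    gridPoint n z = gridPoint (n + 1) fun i => 2 * z i := by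
  ext i
  rw [gridPoint_apply, gridPoint_apply, pow_succ]; push_cast; field_simp

theorem two_mul_gridFloor_mem_gridBox {R : ℕ} (n : ℕ) {x : Rd d} (hx : ‖x‖ ≤ R) :
    (fun i => 2 * gridFloor n x i) ∈ gridBox d R (n + 1) := by
  have := gridFloor_mem_gridBox n hx
  rw [gridBox, Fintype.mem_piFinset] at this ⊢
  intro i
  have h := Finset.mem_Icc.1 (this i)
  rw [Finset.mem_Icc, pow_succ]
  constructor <;> linarith [h.1, h.2]

theorem abs_two_mul_gridFloor_sub_le (n : ℕ) (x : Rd d) (i : Fin d) :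
    |2 * gridFloor n x i - gridFloor (n + 1) x i| ≤ 2 := by
  simp only [gridFloor]
  have e : (2:ℝ) ^ (n + 1) * x i = 2 * (2 ^ n * x i) := by rw [pow_succ]; ring
  rw [e]
  set u := 2 ^ n * x i
  have h1 := Int.floor_le u
  have h2 := Int.lt_floor_add_one u
  have h3 := Int.floor_le (2 * u)
  have h4 := Int.lt_floor_add_one (2 * u)
  have a1 : (2 * ⌊u⌋ - ⌊2 * u⌋ : ℝ) < 2 := by linarith
  have a2 : (-2 : ℝ) < (2 * ⌊u⌋ - ⌊2 * u⌋ : ℝ) := by linarith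
  rw [abs_le]
  constructor
  · have : (-2 : ℤ) < 2 * ⌊u⌋ - ⌊2 * u⌋ := by exact_mod_cast a2
    exact this.le
  · have : 2 * ⌊u⌋ - ⌊2 * u⌋ < (2 : ℤ) := by exact_mod_cast a1
    exact this.le

theorem abs_gridFloor_sub_gridFloor_le (n : ℕ) {x y : Rd d} (h : ‖x - y‖ ≤ (1 / 2) ^ n)
    (i : Fin d) : |gridFloor n x i - gridFloor n y i| ≤ 2 := by
  simp only [gridFloor]
  have h0 := (abs_apply_le_norm (x - y) i).trans h
  have e : |2 ^ n * x i - 2 ^ n * y i| ≤ 1 := by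
    rw [← mul_sub, abs_mul, abs_of_pos (by positivity : (0:ℝ) < 2 ^ n)]
    rw [PiLp.sub_apply] at h0
    calc (2:ℝ) ^ n * |x i - y i| ≤ 2 ^ n * (1 / 2) ^ n := by gcongr
      _ = 1 := by rw [← mul_pow]; norm_num
  have h5 := abs_le.1 e
  set u := 2 ^ n * x i
  set w := 2 ^ n * y i
  have h1 := Int.floor_le u
  have h2 := Int.lt_floor_add_one u
  have h3 := Int.floor_le w
  have h4 := Int.lt_floor_add_one w
  have a1 : (⌊u⌋ - ⌊w⌋ : ℝ) < 3 := by linarith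
  have a2 : (-3 : ℝ) < (⌊u⌋ - ⌊w⌋ : ℝ) := by linarith
  have b1 : ⌊u⌋ - ⌊w⌋ < (3 : ℤ) := by exact_mod_cast a1
  have b2 : (-3 : ℤ) < ⌊u⌋ - ⌊w⌋ := by exact_mod_cast a2
  rw [abs_le]
  omega

/-- A function whose oscillation on neighbouring points of the grid `2^{-n} ℤ^d` decays
geometrically has a continuous regularization. -/
theorem exists_continuousMap_of_grid {f : Rd d → ℝ}
    (hf : ∀ R : ℕ, ∀ᶠ n in atTop, ∀ z ∈ gridBox d R n, ∀ w ∈ gridBox d R n,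
      (∀ i, |z i - w i| ≤ 2) → |f (gridPoint n z) - f (gridPoint n w)| ≤ (3 / 4) ^ n) :
    ∃ F : C(Rd d, ℝ), ∀ x,
      Tendsto (fun n => f (gridPoint n (gridFloor n x))) atTop (𝓝 (F x)) := by
  set g : ℕ → Rd d → ℝ := fun n x => f (gridPoint n (gridFloor n x)) with hg
  have hstep : ∀ R : ℕ, ∃ N, ∀ n, N ≤ n →
      (∀ x, ‖x‖ ≤ R → dist (g n x) (g (n + 1) x) ≤ (3 / 4) ^ (n + 1)) ∧
      (∀ x y, ‖x‖ ≤ R → ‖y‖ ≤ R → ‖x - y‖ ≤ (1 / 2) ^ n → dist (g n x) (g n y) ≤ (3 / 4) ^ n) := by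
    intro R
    obtain ⟨N, hN⟩ := eventually_atTop.1 (hf R)
    refine ⟨N, fun n hn => ⟨fun x hx => ?_, fun x y hx hy hxy => ?_⟩⟩
    · simp only [hg]
      rw [gridPoint_eq_succ]
      exact hN (n + 1) (by omega) _ (two_mul_gridFloor_mem_gridBox n hx) _
        (gridFloor_mem_gridBox (n + 1) hx) (abs_two_mul_gridFloor_sub_le n x)
    · exact hN n hn _ (gridFloor_mem_gridBox n hx) _ (gridFloor_mem_gridBox n hy)
        (abs_gridFloor_sub_gridFloor_le n hxy)
  choose N hN using hstep
  have hgeo : ∀ (R : ℕ) (x : Rd d), ‖x‖ ≤ R → ∀ n, N R ≤ n → ∀ m,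
      dist (g (n + m) x) (g (n + m + 1) x) ≤ (3 / 4) ^ (n + 1) * (3 / 4) ^ m := by
    intro R x hx n hn m
    refine ((hN R (n + m) (by omega)).1 x hx).trans (le_of_eq ?_)
    rw [← pow_add]; congr 1; omega
  have hlim : ∀ x, ∃ L, Tendsto (fun n => g n x) atTop (𝓝 L) := by
    intro x
    obtain ⟨R, hR⟩ := exists_nat_ge ‖x‖
    have hc := cauchySeq_of_le_geometric (f := fun m => g (N R + m) x) (3 / 4 : ℝ)
      ((3 / 4) ^ (N R + 1)) (by norm_num) fun m => hgeo R x hR (N R) le_rfl m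
    obtain ⟨L, hL⟩ := cauchySeq_tendsto_of_complete hc
    refine ⟨L, (tendsto_add_atTop_iff_nat (N R)).1 ?_⟩
    simpa only [add_comm] using hL
  choose F hF using hlim
  -- The constant is the geometric tail `(3/4)^(n+1) / (1 - 3/4) = 3 (3/4)^n`, which makes the
  -- convergence uniform on balls.
  have hunif : ∀ (R : ℕ) (x : Rd d), ‖x‖ ≤ R → ∀ n, N R ≤ n →
      dist (g n x) (F x) ≤ 3 * (3 / 4) ^ n := by
    intro R x hx n hn
    have hL : Tendsto (fun m => g (n + m) x) atTop (𝓝 (F x)) := by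
      simpa only [add_comm] using (tendsto_add_atTop_iff_nat n).2 (hF x)
    have := dist_le_of_le_geometric_of_tendsto₀ (f := fun m => g (n + m) x) (3 / 4 : ℝ)
      ((3 / 4) ^ (n + 1)) (by norm_num) (fun m => hgeo R x hx n hn m) hL
    refine this.trans (le_of_eq ?_)
    rw [pow_succ]; ring
  refine ⟨⟨F, ?_⟩, hF⟩
  rw [Metric.continuous_iff]
  intro x ε hε
  obtain ⟨R, hR⟩ := exists_nat_ge (‖x‖ + 1)
  have ht : Tendsto (fun n : ℕ => 7 * (3 / 4 : ℝ) ^ n) atTop (𝓝 0) := by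
    simpa using (tendsto_pow_atTop_nhds_zero_of_lt_one (r := (3 / 4 : ℝ)) (by norm_num)
      (by norm_num)).const_mul 7
  obtain ⟨n, hn1, hn2⟩ := ((ht.eventually_lt_const hε).and (eventually_ge_atTop (N R))).exists
  refine ⟨(1 / 2) ^ n, by positivity, fun y hy => ?_⟩
  have hle : ((1:ℝ) / 2) ^ n ≤ 1 := pow_le_one₀ (by norm_num) (by norm_num)
  rw [dist_eq_norm] at hy
  have hxR : ‖x‖ ≤ R := by linarith
  have hyR : ‖y‖ ≤ R := by
    have : ‖y‖ ≤ ‖y - x‖ + ‖x‖ := by simpa using norm_add_le (y - x) x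
    linarith
  have h1 := hunif R x hxR n hn2
  have h2 := hunif R y hyR n hn2
  have h3 := (hN R n hn2).2 y x hyR hxR hy.le
  rw [dist_comm] at h2
  calc dist (F y) (F x) ≤ dist (F y) (g n y) + dist (g n y) (g n x) + dist (g n x) (F x) :=
        dist_triangle4 _ _ _ _
    _ ≤ 3 * (3 / 4) ^ n + (3 / 4) ^ n + 3 * (3 / 4) ^ n := by gcongr
    _ = 7 * (3 / 4) ^ n := by ring
    _ < ε := hn1

variable {Ω : Type*} [MeasurableSpace Ω] {P : Measure Ω} {X : Rd d → Ω → ℝ}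

/-- Markov's inequality for the moment of order `4d`: the ratio of the distance scale `2^{-n}` to
the threshold `(3/4)^n` is `(2/3)^n`, and `(2/3)^{4dn} = (16/81)^{dn}`. -/
theorem measure_increment_ge_le (hmeas : ∀ x, AEMeasurable (X x) P) {C : ℝ} (hC : 0 ≤ C)
    (hX : ∀ x y, ∫⁻ ω, ‖X x ω - X y ω‖ₑ ^ (4 * d) ∂P ≤ ENNReal.ofReal (C * ‖x - y‖ ^ (4 * d)))
    {n : ℕ} {x y : Rd d} (hxy : ‖x - y‖ ≤ 2 * d * (1 / 2) ^ n) :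
    P {ω | (3 / 4) ^ n ≤ |X x ω - X y ω|} ≤
      ENNReal.ofReal (C * (2 * d) ^ (4 * d) * (16 / 81) ^ (d * n)) := by
  set θ : ℝ := ((3 / 4) ^ n) ^ (4 * d) with hθ
  have hθ0 : 0 < θ := by positivity
  have h1 := mul_meas_ge_le_lintegral₀ (μ := P) (f := fun ω => ‖X x ω - X y ω‖ₑ ^ (4 * d))
    (((hmeas x).sub (hmeas y)).enorm.pow_const _) (ENNReal.ofReal θ)
  have hsub : {ω | (3 / 4) ^ n ≤ |X x ω - X y ω|} ⊆
      {ω | ENNReal.ofReal θ ≤ ‖X x ω - X y ω‖ₑ ^ (4 * d)} := by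
    intro ω hω
    have hω' : (3 / 4) ^ n ≤ |X x ω - X y ω| := hω
    rw [Set.mem_ofPred, ← ofReal_norm, ← ENNReal.ofReal_pow (norm_nonneg _), Real.norm_eq_abs]
    exact ENNReal.ofReal_le_ofReal (by rw [hθ]; gcongr)
  have h2 : ENNReal.ofReal θ * P {ω | (3 / 4) ^ n ≤ |X x ω - X y ω|} ≤
      ENNReal.ofReal (C * (2 * d * (1 / 2) ^ n) ^ (4 * d)) :=
    (mul_le_mul_right (measure_mono hsub) _).trans (h1.trans ((hX x y).trans
      (ENNReal.ofReal_le_ofReal (by gcongr))))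
  have h3 : C * (2 * d * (1 / 2) ^ n) ^ (4 * d) =
      θ * (C * (2 * d) ^ (4 * d) * (16 / 81) ^ (d * n)) := by
    have e : ((1 / 2 : ℝ) ^ n) ^ (4 * d) = θ * (16 / 81) ^ (d * n) := by
      rw [hθ, ← pow_mul, ← pow_mul, show n * (4 * d) = 4 * (d * n) by ring,
        pow_mul (1 / 2 : ℝ) 4, pow_mul (3 / 4 : ℝ) 4, ← mul_pow]
      norm_num
    rw [mul_pow, e]; ring
  rw [h3, ENNReal.ofReal_mul hθ0.le] at h2
  exact (ENNReal.mul_le_mul_iff_right (by simpa using hθ0) ENNReal.ofReal_ne_top).1 h2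

theorem card_gridBox_le (d R n : ℕ) : ((gridBox d R n).card : ℝ) ≤ ((2 * R + 3) * 2 ^ n) ^ d := by
  rw [gridBox, Fintype.card_piFinset, Finset.prod_const, Finset.card_univ, Fintype.card_fin,
    Nat.cast_pow, Int.card_Icc]
  gcongr
  have h2 : (1:ℝ) ≤ 2 ^ n := one_le_pow₀ one_le_two
  have : (((((R:ℤ) + 1) * 2 ^ n + 1 - -((R + 1) * 2 ^ n)).toNat : ℕ) : ℝ) =
      (R + 1) * 2 ^ n + 1 + (R + 1) * 2 ^ n := by
    have h0 : (0:ℤ) ≤ (R + 1) * 2 ^ n := by positivity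
    rw [← Int.cast_natCast, Int.toNat_of_nonneg (by linarith)]
    push_cast; ring
  rw [this]
  nlinarith

/-- Union bound and Borel–Cantelli. Even the crude count `O(4^{dn})` of all pairs of grid points is
affordable, because `4 · 16/81 = 64/81 < 1`; the moment order `4d` leaves room for this. -/
theorem ae_eventually_grid_le [NeZero d] (hmeas : ∀ x, AEMeasurable (X x) P) {C : ℝ} (hC : 0 ≤ C)
    (hX : ∀ x y, ∫⁻ ω, ‖X x ω - X y ω‖ₑ ^ (4 * d) ∂P ≤ ENNReal.ofReal (C * ‖x - y‖ ^ (4 * d)))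
    (R : ℕ) :
    ∀ᵐ ω ∂P, ∀ᶠ n in atTop, ∀ z ∈ gridBox d R n, ∀ w ∈ gridBox d R n,
      (∀ i, |z i - w i| ≤ 2) → |X (gridPoint n z) ω - X (gridPoint n w) ω| ≤ (3 / 4) ^ n := by
  classical
  set s : ℕ → Finset ((Fin d → ℤ) × (Fin d → ℤ)) := fun n =>
    (gridBox d R n ×ˢ gridBox d R n).filter fun q => ∀ i, |q.1 i - q.2 i| ≤ 2 with hs
  set E : ℕ → Set Ω := fun n => ⋃ q ∈ s n,
    {ω | (3 / 4) ^ n ≤ |X (gridPoint n q.1) ω - X (gridPoint n q.2) ω|} with hE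
  set K : ℝ := (2 * R + 3) ^ (2 * d) * (C * (2 * d) ^ (4 * d)) with hK
  have hEle : ∀ n, P (E n) ≤ ENNReal.ofReal (K * (64 / 81) ^ n) := by
    intro n
    have hcard : ((s n).card : ℝ) ≤ (2 * R + 3) ^ (2 * d) * 4 ^ (d * n) := by
      have h1 : ((s n).card : ℝ) ≤ (gridBox d R n).card * (gridBox d R n).card := by
        have := Finset.card_filter_le (gridBox d R n ×ˢ gridBox d R n)
          fun q => ∀ i, |q.1 i - q.2 i| ≤ 2
        rw [Finset.card_product] at this
        exact_mod_cast this
      have h2 := card_gridBox_le d R n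
      calc ((s n).card : ℝ) ≤ ((2 * R + 3) * 2 ^ n) ^ d * ((2 * R + 3) * 2 ^ n) ^ d :=
            h1.trans (by gcongr)
        _ = _ := by
            have : (4:ℝ) ^ (d * n) = 2 ^ (n * d) * 2 ^ (n * d) := by
              rw [← mul_pow, mul_comm n d]; norm_num
            rw [mul_pow, ← pow_mul, this]
            ring
    calc P (E n) ≤ ∑ q ∈ s n,
          P {ω | (3 / 4) ^ n ≤ |X (gridPoint n q.1) ω - X (gridPoint n q.2) ω|} :=
          measure_biUnion_finset_le _ _
      _ ≤ ∑ q ∈ s n, ENNReal.ofReal (C * (2 * d) ^ (4 * d) * (16 / 81) ^ (d * n)) :=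
          Finset.sum_le_sum fun q hq => measure_increment_ge_le hmeas hC hX
            (norm_gridPoint_sub_le n (Finset.mem_filter.1 hq).2)
      _ = ENNReal.ofReal ((s n).card * (C * (2 * d) ^ (4 * d) * (16 / 81) ^ (d * n))) := by
          rw [Finset.sum_const, nsmul_eq_mul,
            ENNReal.ofReal_mul (p := ((s n).card : ℝ)) (Nat.cast_nonneg _),
            ENNReal.ofReal_natCast]
      _ ≤ ENNReal.ofReal (K * (64 / 81) ^ n) := by
          refine ENNReal.ofReal_le_ofReal ?_
          calc _ ≤ (2 * R + 3) ^ (2 * d) * 4 ^ (d * n) *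
                (C * (2 * d) ^ (4 * d) * (16 / 81) ^ (d * n)) := by gcongr
            _ = K * (64 / 81) ^ (d * n) := by
                have : (64 / 81 : ℝ) ^ (d * n) = 4 ^ (d * n) * (16 / 81) ^ (d * n) := by
                  rw [← mul_pow]; norm_num
                rw [this]; ring
            _ ≤ K * (64 / 81) ^ n := by
                have hK0 : 0 ≤ K := by positivity
                refine mul_le_mul_of_nonneg_left ?_ hK0
                exact pow_le_pow_of_le_one (by norm_num) (by norm_num)
                  (Nat.le_mul_of_pos_left n (NeZero.pos d))
  have hsum : ∑' n, P (E n) ≠ ∞ := by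
    have hsm : Summable fun n : ℕ => K * (64 / 81 : ℝ) ^ n :=
      (summable_geometric_of_lt_one (by norm_num) (by norm_num)).mul_left K
    refine ne_top_of_le_ne_top ?_ (ENNReal.tsum_le_tsum hEle)
    rw [← ENNReal.ofReal_tsum_of_nonneg (fun n => by positivity) hsm]
    exact ENNReal.ofReal_ne_top
  filter_upwards [ae_eventually_notMem hsum] with ω hω
  filter_upwards [hω] with n hn z hz w hw hzw
  by_contra! h
  refine hn (Set.mem_biUnion (x := (z, w)) ?_ h.le)
  simp only [hs]
  exact Finset.mem_coe.2 (Finset.mem_filter.2 ⟨Finset.mem_product.2 ⟨hz, hw⟩, hzw⟩)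

/-- Borel–Cantelli at a single point: the limit along the grid agrees almost surely with the
original variable, so the regularization is a modification. -/
theorem ae_tendsto_grid [NeZero d] (hmeas : ∀ x, AEMeasurable (X x) P) {C : ℝ} (hC : 0 ≤ C)
    (hX : ∀ x y, ∫⁻ ω, ‖X x ω - X y ω‖ₑ ^ (4 * d) ∂P ≤ ENNReal.ofReal (C * ‖x - y‖ ^ (4 * d)))
    (x : Rd d) :
    ∀ᵐ ω ∂P, Tendsto (fun n => X (gridPoint n (gridFloor n x)) ω) atTop (𝓝 (X x ω)) := by
  set E : ℕ → Set Ω := fun n =>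
    {ω | (3 / 4) ^ n ≤ |X (gridPoint n (gridFloor n x)) ω - X x ω|} with hE
  set K : ℝ := C * (2 * d) ^ (4 * d) with hK
  have hEle : ∀ n, P (E n) ≤ ENNReal.ofReal (K * (16 / 81) ^ n) := fun n =>
    (measure_increment_ge_le hmeas hC hX (norm_gridPoint_gridFloor_sub_le n x)).trans
      (ENNReal.ofReal_le_ofReal (mul_le_mul_of_nonneg_left
        (pow_le_pow_of_le_one (by norm_num) (by norm_num)
          (Nat.le_mul_of_pos_left n (NeZero.pos d))) (by positivity)))
  have hsum : ∑' n, P (E n) ≠ ∞ := by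
    have hsm : Summable fun n : ℕ => K * (16 / 81 : ℝ) ^ n :=
      (summable_geometric_of_lt_one (by norm_num) (by norm_num)).mul_left K
    refine ne_top_of_le_ne_top ?_ (ENNReal.tsum_le_tsum hEle)
    rw [← ENNReal.ofReal_tsum_of_nonneg (fun n => by positivity) hsm]
    exact ENNReal.ofReal_ne_top
  filter_upwards [ae_eventually_notMem hsum] with ω hω
  rw [tendsto_iff_norm_sub_tendsto_zero]
  refine squeeze_zero' (Eventually.of_forall fun n => norm_nonneg _) ?_
    (tendsto_pow_atTop_nhds_zero_of_lt_one (r := (3 / 4 : ℝ)) (by norm_num) (by norm_num))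
  filter_upwards [hω] with n hn
  exact (not_le.1 hn).le

/-- A Kolmogorov continuity theorem for random fields on `ℝ^d`. -/
theorem exists_continuous_modification [NeZero d] (hmeas : ∀ x, AEMeasurable (X x) P) {C : ℝ}
    (hC : 0 ≤ C)
    (hX : ∀ x y, ∫⁻ ω, ‖X x ω - X y ω‖ₑ ^ (4 * d) ∂P ≤
      ENNReal.ofReal (C * ‖x - y‖ ^ (4 * d))) :
    ∃ A : Ω → C(Rd d, ℝ), ∀ x, (fun ω => A ω x) =ᵐ[P] X x := by
  classical
  have h1 : ∀ᵐ ω ∂P, ∃ F : C(Rd d, ℝ), ∀ x,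
      Tendsto (fun n => X (gridPoint n (gridFloor n x)) ω) atTop (𝓝 (F x)) := by
    have := ae_all_iff.2 fun R => ae_eventually_grid_le hmeas hC hX R
    filter_upwards [this] with ω hω
    exact exists_continuousMap_of_grid (f := fun x => X x ω) hω
  -- The zero function is only a default on the null event where the grid limit is not a continuous
  -- function.
  refine ⟨fun ω => if h : ∃ F : C(Rd d, ℝ), ∀ x,
    Tendsto (fun n => X (gridPoint n (gridFloor n x)) ω) atTop (𝓝 (F x)) then h.choose else 0,
    fun x => ?_⟩
  filter_upwards [h1, ae_tendsto_grid hmeas hC hX x] with ω hω hωx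
  rw [dif_pos hω]
  exact tendsto_nhds_unique (hω.choose_spec x) hωx

/-- Moments of a centred Gaussian variable in terms of its variance. -/
theorem exists_gaussian_moment (m : ℕ) : ∃ c : ℝ, 0 ≤ c ∧ ∀ {Ω : Type u} [MeasurableSpace Ω]
    {P : Measure Ω} {Y : Ω → ℝ} {v : NNReal} {b : ℝ}, AEMeasurable Y P →
      P.map Y = gaussianReal 0 v → v ≤ b →
        ∫⁻ ω, ‖Y ω‖ₑ ^ (2 * m) ∂P ≤ ENNReal.ofReal (c * b ^ m) := by
  have hfin : ∫⁻ x, ‖x‖ₑ ^ (2 * m) ∂(gaussianReal 0 1) ≠ ∞ := by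
    have h := memLp_id_gaussianReal (μ := 0) (v := 1) (2 * m : ℕ)
    rcases Nat.eq_zero_or_pos m with h0 | h0
    · simp [h0]
    · have := h.2
      rw [eLpNorm_lt_top_iff_lintegral_rpow_enorm_lt_top (by simpa using by omega)
        ENNReal.coe_ne_top] at this
      have e : (((2 * m : ℕ) : NNReal) : ℝ≥0∞).toReal = ((2 * m : ℕ) : ℝ) := by simp
      simp only [e, ENNReal.rpow_natCast, id] at this
      exact this.ne
  refine ⟨(∫⁻ x, ‖x‖ₑ ^ (2 * m) ∂(gaussianReal 0 1)).toReal, ENNReal.toReal_nonneg, ?_⟩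
  intro Ω _ P Y v b hY hlaw hv
  have e1 : ∫⁻ ω, ‖Y ω‖ₑ ^ (2 * m) ∂P = ∫⁻ x, ‖x‖ₑ ^ (2 * m) ∂(gaussianReal 0 v) := by
    rw [← hlaw, lintegral_map' (by fun_prop) hY]
  have e2 : gaussianReal 0 v = (gaussianReal 0 1).map (√(v : ℝ) * ·) := by
    rw [gaussianReal_map_const_mul]
    congr 1
    · simp
    · ext; simp
  rw [e1, e2, lintegral_map (by fun_prop) (by fun_prop)]
  simp only [enorm_mul, mul_pow]
  rw [lintegral_const_mul' _ _ (by finiteness), ← ofReal_norm,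
    Real.norm_of_nonneg (Real.sqrt_nonneg _), ← ENNReal.ofReal_pow (Real.sqrt_nonneg _),
    pow_mul, Real.sq_sqrt (NNReal.coe_nonneg v), ENNReal.ofReal_mul ENNReal.toReal_nonneg,
    ENNReal.ofReal_toReal hfin, mul_comm]
  gcongr

end Kolmogorov

/-! ### Random continuous functions modulo constants -/

section Laws

variable {d : ℕ}

theorem incr_mk (x y : Rd d) (f : C(Rd d, ℝ)) :
    incr x y ((constFunctions d).mkQ f) = f x - f y := rfl

/-- The representative of a function modulo constants that vanishes at the origin. -/
noncomputable def normalizedRep (a : ContModConst d) : C(Rd d, ℝ) :=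
  a.out - ContinuousMap.const _ (a.out 0)

theorem mk_normalizedRep (a : ContModConst d) : (constFunctions d).mkQ (normalizedRep a) = a := by
  have h : (constFunctions d).mkQ (ContinuousMap.const (Rd d) (a.out 0)) = 0 := by
    rw [Submodule.mkQ_apply, Submodule.Quotient.mk_eq_zero]
    exact ⟨a.out 0, fun _ => rfl⟩
  rw [normalizedRep, map_sub, h, sub_zero]
  exact Quotient.out_eq a

theorem normalizedRep_apply (a : ContModConst d) (x : Rd d) : normalizedRep a x = incr x 0 a := by
  conv_rhs => rw [← mk_normalizedRep a]
  rw [incr_mk]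
  simp [normalizedRep]

/-- The increments of a function along a dense sequence of points. -/
noncomputable def denseIncr (a : ContModConst d) (n : ℕ) : ℝ :=
  incr (TopologicalSpace.denseSeq (Rd d) n) 0 a

/-- For compact `K` and open `U`, the image of `K` lies in `U` iff for some `n` its values on a
countable dense subset of `K` stay at distance at least `1/(n+1)` from the complement. Evaluations
at arbitrary points are limits of evaluations along the dense sequence. -/
theorem borel_continuousMap_le :
    borel C(Rd d, ℝ) ≤ MeasurableSpace.comap
      (fun f n => f (TopologicalSpace.denseSeq (Rd d) n)) (MeasurableSpace.pi (X := fun _ : ℕ => ℝ)) := by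
  set m : MeasurableSpace C(Rd d, ℝ) := MeasurableSpace.comap
    (fun f n => f (TopologicalSpace.denseSeq (Rd d) n)) (MeasurableSpace.pi (X := fun _ : ℕ => ℝ)) with hm
  have hdense : ∀ n, Measurable fun f : C(Rd d, ℝ) => f (TopologicalSpace.denseSeq (Rd d) n) :=
    fun n => measurable_pi_iff.1 (comap_measurable
      fun (f : C(Rd d, ℝ)) (n : ℕ) => f (TopologicalSpace.denseSeq (Rd d) n)) n
  have heval : ∀ x : Rd d, Measurable fun f : C(Rd d, ℝ) => f x := by
    intro x
    obtain ⟨u, hu, hux⟩ := mem_closure_iff_seq_limit.1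
      ((TopologicalSpace.denseRange_denseSeq (Rd d)).closure_eq ▸ Set.mem_univ x)
    choose n hn using hu
    refine measurable_of_tendsto_metrizable (f := fun j f => f (u j)) (fun j => ?_) ?_
    · rw [← hn j]; exact hdense (n j)
    · rw [tendsto_pi_nhds]
      exact fun f => (f.continuous.tendsto x).comp hux
  rw [borel_eq_generateFrom_of_subbasis ContinuousMap.compactOpen_eq]
  refine MeasurableSpace.generateFrom_le ?_
  rintro _ ⟨K, hK, U, hU, rfl⟩
  have hUo : IsOpen U := hU
  obtain ⟨t, htK, htc, htd⟩ : ∃ t ⊆ K, t.Countable ∧ K ⊆ closure t :=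
    TopologicalSpace.IsSeparable.exists_countable_dense_subset
      (TopologicalSpace.IsSeparable.of_separableSpace K)
  have e : {f : C(Rd d, ℝ) | Set.MapsTo f K U} = ⋃ n : ℕ, ⋂ x ∈ t,
      {f : C(Rd d, ℝ) | ENNReal.ofReal (1 / ((n : ℝ) + 1)) ≤ Metric.infEDist (f x) Uᶜ} := by
    ext f
    simp only [Set.mem_ofPred, Set.mem_iUnion, Set.mem_iInter]
    constructor
    · intro h
      have hK' : IsCompact (f '' K) := IsCompact.image hK f.continuous
      obtain ⟨δ, hδ, hδs⟩ := hK'.exists_thickening_subset_open hUo h.image_subset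
      obtain ⟨n, hn⟩ := exists_nat_one_div_lt hδ
      refine ⟨n, fun x hx => ?_⟩
      rw [Metric.le_infEDist]
      intro y hy
      rw [edist_dist]
      refine ENNReal.ofReal_le_ofReal ?_
      by_contra! hlt
      refine hy (hδs (Metric.mem_thickening_iff.2 ⟨f x, Set.mem_image_of_mem f (htK hx), ?_⟩))
      rw [dist_comm]; exact hlt.trans hn
    · rintro ⟨n, hn⟩ x hx
      have hcl : IsClosed {x | ENNReal.ofReal (1 / ((n : ℝ) + 1)) ≤ Metric.infEDist (f x) Uᶜ} :=
        isClosed_le continuous_const (Metric.continuous_infEDist.comp f.continuous)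
      have hx' : ENNReal.ofReal (1 / ((n : ℝ) + 1)) ≤ Metric.infEDist (f x) Uᶜ :=
        hcl.closure_subset_iff.2 (fun y hy => hn y hy) (htd hx)
      by_contra hxU
      rw [Metric.infEDist_zero_of_mem hxU, nonpos_iff_eq_zero, ENNReal.ofReal_eq_zero] at hx'
      have : (0:ℝ) < 1 / ((n : ℝ) + 1) := by positivity
      linarith
  beta_reduce
  rw [e]
  refine MeasurableSet.iUnion fun n => MeasurableSet.biInter htc fun x _ => ?_
  exact measurableSet_le measurable_const (Metric.continuous_infEDist.measurable.comp (heval x))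

/-- A Borel set of the quotient pulls back to a Borel set of continuous functions. Membership can be
tested on the representative vanishing at the origin, whose values are increments. -/
theorem measurableSpace_contModConst_le :
    instMeasurableSpaceContModConst d ≤
      MeasurableSpace.comap denseIncr (MeasurableSpace.pi (X := fun _ : ℕ => ℝ)) := by
  intro U hU
  have hc : Continuous fun f : C(Rd d, ℝ) => (constFunctions d).mkQ f := continuous_quot_mk
  have h1 : MeasurableSet[borel C(Rd d, ℝ)] ((constFunctions d).mkQ ⁻¹' U) :=
    hc.borel_measurable hU
  obtain ⟨V, hV, hVU⟩ := borel_continuousMap_le _ h1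
  refine ⟨V, hV, ?_⟩
  ext a
  have h2 : (fun n => normalizedRep a (TopologicalSpace.denseSeq (Rd d) n)) = denseIncr a := by
    ext n; exact normalizedRep_apply a _
  rw [Set.mem_preimage, ← h2]
  have h3 := Set.ext_iff.1 hVU (normalizedRep a)
  rw [Set.mem_preimage, Set.mem_preimage, mk_normalizedRep] at h3
  exact h3

variable {Ω : Type u} [MeasurableSpace Ω] {P : Measure Ω} {Ω' : Type v} [MeasurableSpace Ω']
  {P' : Measure Ω'}

/-- Only the increments along the dense sequence matter, so countably many exceptional null sets are
discarded. -/
theorem aemeasurable_contModConst {A : Ω → ContModConst d}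
    (hA : ∀ x, AEMeasurable (fun ω => incr x 0 (A ω)) P) : AEMeasurable A P := by
  classical
  have hA' := fun n => hA (TopologicalSpace.denseSeq (Rd d) n)
  have hall : ∀ᵐ ω ∂P, ∀ n, denseIncr (A ω) n = (hA' n).mk _ ω :=
    ae_all_iff.2 fun n => (hA' n).ae_eq_mk
  obtain ⟨N, hN, hNm, hN0⟩ := exists_measurable_superset_of_null (ae_iff.1 hall)
  have hmem : ∀ ω ∉ N, ∀ n, denseIncr (A ω) n = (hA' n).mk _ ω := fun ω hω => by
    by_contra h; exact hω (hN h)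
  refine ⟨fun ω => if ω ∈ N then 0 else A ω, ?_, ?_⟩
  · suffices h : Measurable fun ω => denseIncr (if ω ∈ N then 0 else A ω) by
      exact (measurable_comap_iff.2 h).mono le_rfl measurableSpace_contModConst_le
    refine measurable_pi_iff.2 fun n => ?_
    have e : (fun ω => denseIncr (if ω ∈ N then 0 else A ω) n) =
        fun ω => if ω ∈ N then 0 else (hA' n).mk _ ω := by
      ext ω
      split_ifs with h
      · simp [denseIncr]
      · exact hmem ω h n
    rw [e]
    exact Measurable.ite hNm measurable_const (hA' n).measurable_mk
  · have : ∀ᵐ ω ∂P, ω ∉ N := measure_eq_zero_iff_ae_notMem.1 hN0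
    filter_upwards [this] with ω hω
    rw [if_neg hω]

/-- The law of a random continuous function modulo constants is determined by the
characteristic functions of the linear combinations of its increments. -/
theorem identDistrib_of_charFun_incr [IsProbabilityMeasure P] [IsProbabilityMeasure P']
    {A : Ω' → ContModConst d} {B : Ω → ContModConst d}
    (hA : ∀ x, AEMeasurable (fun ω => incr x 0 (A ω)) P')
    (hB : ∀ x, AEMeasurable (fun ω => incr x 0 (B ω)) P)
    (h : ∀ (s : Finset ℕ) (a : ℕ → ℝ) (x : ℕ → Rd d),
      ∫ ω, Complex.exp (((∑ i ∈ s, a i * incr (x i) 0 (A ω) : ℝ) : ℂ) * Complex.I) ∂P' =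
      ∫ ω, Complex.exp (((∑ i ∈ s, a i * incr (x i) 0 (B ω) : ℝ) : ℂ) * Complex.I) ∂P) :
    IdentDistrib A B P' P := by
  classical
  have hAm := aemeasurable_contModConst hA
  have hBm := aemeasurable_contModConst hB
  have hAs : AEMeasurable (fun ω n => denseIncr (A ω) n) P' :=
    aemeasurable_pi_lambda _ fun n => hA _
  have hBs : AEMeasurable (fun ω n => denseIncr (B ω) n) P :=
    aemeasurable_pi_lambda _ fun n => hB _
  have hseq : P'.map (fun ω n => denseIncr (A ω) n) = P.map (fun ω n => denseIncr (B ω) n) := by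
    have hfin : ∀ I : Finset ℕ, P'.map (fun ω => I.restrict fun n => denseIncr (A ω) n) =
        P.map (fun ω => I.restrict fun n => denseIncr (B ω) n) := by
      intro I
      have hAI : AEMeasurable (fun ω => I.restrict fun n => denseIncr (A ω) n) P' :=
        (Finset.measurable_restrict I).comp_aemeasurable hAs
      have hBI : AEMeasurable (fun ω => I.restrict fun n => denseIncr (B ω) n) P :=
        (Finset.measurable_restrict I).comp_aemeasurable hBs
      have := Measure.isProbabilityMeasure_map hAI
      have := Measure.isProbabilityMeasure_map hBI
      refine Measure.ext_of_charFunDual ?_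
      ext L
      set a : ℕ → ℝ := fun n => if hn : n ∈ I then L (Pi.single ⟨n, hn⟩ 1) else 0 with ha
      have hL : ∀ u : ℕ → ℝ, L (I.restrict u) = ∑ i ∈ I, a i * u i := by
        intro u
        have := (L : (I → ℝ) →ₗ[ℝ] ℝ).pi_apply_eq_sum_univ (I.restrict u)
        rw [← Finset.sum_coe_sort I fun i => a i * u i]
        refine this.trans (Finset.sum_congr rfl fun i _ => ?_)
        rw [ha]
        simp only [Finset.coe_mem, dif_pos, Finset.restrict, smul_eq_mul]
        rw [mul_comm]
        congr 1
        exact congrArg L (by ext j; simp [Pi.single_apply, eq_comm])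
      rw [charFunDual_apply, charFunDual_apply,
        integral_map hAI (Continuous.aestronglyMeasurable (by fun_prop)),
        integral_map hBI (Continuous.aestronglyMeasurable (by fun_prop))]
      simp only [hL]
      exact h I a (TopologicalSpace.denseSeq (Rd d))
    -- The law of a sequence is the unique projective limit of its finite-dimensional marginals.
    have h1 := isProjectiveLimit_map hAs
    simp_rw [hfin] at h1
    have : ∀ I : Finset ℕ, IsFiniteMeasure
        (P.map (fun ω => I.restrict fun n => denseIncr (B ω) n)) := fun I => inferInstance
    exact h1.unique (isProjectiveLimit_map hBs)
  refine ⟨hAm, hBm, ?_⟩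
  ext U hU
  obtain ⟨V, hV, rfl⟩ := measurableSpace_contModConst_le U hU
  rw [Measure.map_apply_of_aemeasurable hAm hU, Measure.map_apply_of_aemeasurable hBm hU]
  have h1 := Measure.map_apply_of_aemeasurable hAs hV
  have h2 := Measure.map_apply_of_aemeasurable hBs hV
  rw [hseq, h2] at h1
  exact h1.symm

end Laws

/-! ### The pairing of the log-correlated field with test functions -/

section HNeg

variable {d : ℕ}

/-- The weighted Lebesgue measure that gives the norm of `ℋ^{-d/2}(ℝ^d)` on the Fourier side. -/
noncomputable def hnegMeasure (d : ℕ) : Measure (Rd d) := volume.withDensity (hnegWeight d)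

/-- The norm of `ℋ^{-d/2}(ℝ^d)`. -/
noncomputable def hnegNorm (f : Rd d → ℝ) : ℝ≥0∞ := eLpNorm (fourierReal f) 2 (hnegMeasure d)

theorem eLpNorm_two_sq {α E : Type*} [MeasurableSpace α] [NormedAddCommGroup E] (μ : Measure α)
    (f : α → E) : eLpNorm f 2 μ ^ 2 = ∫⁻ x, ‖f x‖ₑ ^ 2 ∂μ := by
  have := eLpNorm_nnreal_pow_eq_lintegral (f := f) (μ := μ) (p := 2) two_ne_zero
  simpa using this

theorem hnegNorm_sq [NeZero d] (f : Rd d → ℝ) : normSqHNeg f = hnegNorm f ^ 2 := by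
  rw [normSqHNeg_eq_lintegral, hnegNorm, eLpNorm_two_sq, hnegMeasure]
  by_cases hf : AEMeasurable (fun ξ => ‖fourierReal f ξ‖ₑ ^ 2)
  · rw [lintegral_withDensity_eq_lintegral_mul₀ (measurable_hnegWeight d).aemeasurable hf]
    refine lintegral_congr fun ξ => ?_
    rw [Pi.mul_apply, mul_comm]
  · rw [lintegral_withDensity_eq_lintegral_mul_non_measurable _ (measurable_hnegWeight d)]
    · refine lintegral_congr fun ξ => ?_
      rw [Pi.mul_apply, mul_comm]
    · exact ae_of_all _ fun ξ => ENNReal.ofReal_lt_top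

theorem hnegNorm_sub_le {f g : Rd d → ℝ} (hf : Integrable f) (hg : Integrable g) :
    hnegNorm (fun x => f x - g x) ≤ hnegNorm f + hnegNorm g := by
  have e : fourierReal (fun x => f x - g x) = fourierReal f - fourierReal g := by
    ext ξ; exact fourierReal_sub hf hg ξ
  rw [hnegNorm, e]
  exact eLpNorm_sub_le (continuous_fourierReal hf).aestronglyMeasurable
    (continuous_fourierReal hg).aestronglyMeasurable one_le_two

theorem hnegNorm_add_le {f g : Rd d → ℝ} (hf : Integrable f) (hg : Integrable g) :
    hnegNorm (fun x => f x + g x) ≤ hnegNorm f + hnegNorm g := by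
  have e : fourierReal (fun x => f x + g x) = fourierReal f + fourierReal g := by
    ext ξ; exact fourierReal_add hf hg ξ
  rw [hnegNorm, e]
  exact eLpNorm_add_le (continuous_fourierReal hf).aestronglyMeasurable
    (continuous_fourierReal hg).aestronglyMeasurable one_le_two

theorem hnegNorm_const_mul (c : ℝ) (f : Rd d → ℝ) :
    hnegNorm (fun x => c * f x) = ‖c‖ₑ * hnegNorm f := by
  have e : fourierReal (fun x => c * f x) = (c : ℂ) • fourierReal f := by
    ext ξ; exact fourierReal_const_mul c f ξ
  rw [hnegNorm, e, eLpNorm_const_smul, hnegNorm]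
  congr 1
  rw [← ofReal_norm, Complex.norm_real, ofReal_norm]

theorem hnegNorm_zero : hnegNorm (fun _ : Rd d => (0:ℝ)) = 0 := by
  have := hnegNorm_const_mul 0 (fun _ : Rd d => (0:ℝ))
  simpa using this

theorem hnegNorm_sub_comm (f g : Rd d → ℝ) :
    hnegNorm (fun x => f x - g x) = hnegNorm (fun x => g x - f x) := by
  have := hnegNorm_const_mul (-1) (fun x => g x - f x)
  simpa using this

theorem hnegNorm_le_add {f g : Rd d → ℝ} (hf : Integrable f) (hg : Integrable g) :
    hnegNorm f ≤ hnegNorm g + hnegNorm fun x => f x - g x := by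
  have hs : Integrable fun x => f x - g x := hf.sub hg
  have h := hnegNorm_add_le hg hs
  simpa only [add_sub_cancel] using h

theorem tendsto_normSqHNeg_iff [NeZero d] {α : Type*} {l : Filter α} {f : α → Rd d → ℝ} :
    Tendsto (fun n => normSqHNeg (f n)) l (𝓝 0) ↔ Tendsto (fun n => hnegNorm (f n)) l (𝓝 0) := by
  simp only [hnegNorm_sq]
  constructor
  · intro h
    have := (ENNReal.continuous_rpow_const (y := (1/2 : ℝ))).tendsto 0 |>.comp h
    rw [ENNReal.zero_rpow_of_pos (by norm_num)] at this
    refine this.congr fun n => ?_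
    simp only [Function.comp]
    rw [← ENNReal.rpow_natCast, ← ENNReal.rpow_mul]
    norm_num
  · intro h
    have := ((ENNReal.continuous_pow 2).tendsto 0).comp h
    rwa [zero_pow two_ne_zero] at this

theorem tendsto_hnegNorm {f : Rd d → ℝ} (hf : Integrable f) {φ : ℕ → schwartzZero d}
    (hfin : hnegNorm f ≠ ∞)
    (h1 : Tendsto (fun n => hnegNorm fun x => f x - (φ n : 𝓢(Rd d, ℝ)) x) atTop (𝓝 0)) :
    Tendsto (fun n => hnegNorm (φ n : 𝓢(Rd d, ℝ))) atTop (𝓝 (hnegNorm f)) := by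
  have hu : Tendsto (fun n => hnegNorm f + hnegNorm fun x => f x - (φ n : 𝓢(Rd d, ℝ)) x) atTop
      (𝓝 (hnegNorm f)) := by
    have := (tendsto_const_nhds (x := hnegNorm f)).add h1
    rwa [add_zero] at this
  have hl : Tendsto (fun n => hnegNorm f - hnegNorm fun x => f x - (φ n : 𝓢(Rd d, ℝ)) x) atTop
      (𝓝 (hnegNorm f)) := by
    have := ENNReal.Tendsto.sub (tendsto_const_nhds (x := hnegNorm f)) h1 (Or.inl hfin)
    rwa [tsub_zero] at this
  refine tendsto_of_tendsto_of_tendsto_of_le_of_le hl hu (fun n => ?_) fun n => ?_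
  · exact tsub_le_iff_right.2 (hnegNorm_le_add hf (SchwartzMap.integrable _))
  · have := hnegNorm_le_add (f := (φ n : 𝓢(Rd d, ℝ))) (SchwartzMap.integrable _) hf
    rwa [hnegNorm_sub_comm] at this

end HNeg

theorem IsPairing.congr_ae {d : ℕ} {Ω : Type*} [MeasurableSpace Ω] {P : Measure Ω}
    {h : Ω → GenFunModConst d} {f : Rd d → ℝ} {Y Z : Ω → ℝ} (hf : IsPairing P h f Y)
    (hYZ : Y =ᵐ[P] Z) :
    IsPairing P h f Z := by
  obtain ⟨hfi, hY, φ, h1, h2⟩ := hf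
  refine ⟨hfi, hY.ae_eq hYZ, φ, h1, h2.congr fun n => eLpNorm_congr_ae ?_⟩
  filter_upwards [hYZ] with ω hω
  rw [hω]

section Pairing

variable {d : ℕ} [NeZero d] {Ω : Type u} [MeasurableSpace Ω] {P : Measure Ω}
  {h : Ω → GenFunModConst d}

theorem eLpNorm_two_sq_eq_variance [IsFiniteMeasure P] {Y : Ω → ℝ}
    (hY : MemLp Y 2 P) (h0 : ∫ ω, Y ω ∂P = 0) :
    eLpNorm Y 2 P ^ 2 = ENNReal.ofReal Var[Y; P] := by
  rw [eLpNorm_two_sq, ofReal_variance hY, evariance_eq_lintegral_ofReal, h0]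
  refine lintegral_congr fun ω => ?_
  rw [sub_zero, ← ofReal_norm, ← ENNReal.ofReal_pow (norm_nonneg _), Real.norm_eq_abs, sq_abs]

namespace IsWholeSpaceLGF

/-- The pairing is an isometry on test functions. -/
theorem eLpNorm_apply (hh : IsWholeSpaceLGF P h) (φ : schwartzZero d) :
    eLpNorm (fun ω => h ω φ) 2 P = hnegNorm (φ : 𝓢(Rd d, ℝ)) := by
  have := (hh.gaussian φ).isProbabilityMeasure
  have hm := (hh.gaussian φ).memLp_two
  have h1 := eLpNorm_two_sq_eq_variance hm (hh.mean_zero φ)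
  rw [← covariance_self (hh.gaussian φ).aemeasurable, hh.cov_eq, ofReal_logEnergy, hnegNorm_sq] at h1
  exact (ENNReal.pow_right_strictMono two_ne_zero).injective h1

theorem integral_cexp [IsProbabilityMeasure P] (hh : IsWholeSpaceLGF P h) (φ : schwartzZero d) :
    ∫ ω, Complex.exp (((h ω φ : ℝ) : ℂ) * Complex.I) ∂P =
      Complex.exp (-((hnegNorm (φ : 𝓢(Rd d, ℝ))).toReal ^ 2 : ℝ) / 2) := by
  have hg := hh.gaussian φ
  have hm := hg.memLp_two
  have h1 := eLpNorm_two_sq_eq_variance hm (hh.mean_zero φ)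
  rw [hh.eLpNorm_apply] at h1
  have h2 : Var[fun ω => h ω φ; P] = (hnegNorm (φ : 𝓢(Rd d, ℝ))).toReal ^ 2 := by
    rw [← ENNReal.toReal_pow, h1, ENNReal.toReal_ofReal (variance_nonneg _ _)]
  have h3 := hg.map_eq_gaussianReal
  rw [hh.mean_zero φ, h2] at h3
  have h4 := congrArg (fun μ => charFun μ 1) h3
  rw [charFun_gaussianReal, charFun_apply_real,
    integral_map hg.aemeasurable (Continuous.aestronglyMeasurable (by fun_prop))] at h4
  simp only [Complex.ofReal_one, one_mul] at h4
  rw [h4]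
  congr 1
  rw [Real.coe_toNNReal _ (by positivity)]
  push_cast
  ring

/-- A function approximated by test functions can be paired with the field. -/
theorem exists_isPairing (hh : IsWholeSpaceLGF P h) {f : Rd d → ℝ} (hf : Integrable f)
    {φ : ℕ → schwartzZero d}
    (hφ : Tendsto (fun n => normSqHNeg fun x => f x - (φ n : 𝓢(Rd d, ℝ)) x) atTop (𝓝 0)) :
    ∃ Y, IsPairing P h f Y := by
  have hn := tendsto_normSqHNeg_iff.1 hφ
  set δ : ℕ → ℝ≥0∞ := fun n => hnegNorm fun x => f x - (φ n : 𝓢(Rd d, ℝ)) x with hδ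
  have hm : ∀ n, MemLp (fun ω => h ω (φ n)) 2 P := fun n => (hh.gaussian (φ n)).memLp_two
  -- The isometry on test functions transfers the Cauchy property from the weighted norm to `L²(P)`,
  -- where completeness supplies the pairing.
  have hdist : ∀ n m, edist (hm n).toLp (hm m).toLp ≤ δ n + δ m := by
    intro n m
    rw [Lp.edist_toLp_toLp]
    have e : ((fun ω => h ω (φ n)) - fun ω => h ω (φ m)) = fun ω => h ω (φ n - φ m) := by
      ext ω; exact (map_sub (h ω) _ _).symm
    rw [e, hh.eLpNorm_apply]
    have hi : ∀ n, Integrable fun x => f x - (φ n : 𝓢(Rd d, ℝ)) x := fun n =>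
      hf.sub (SchwartzMap.integrable _)
    have h1 := hnegNorm_sub_le (hi m) (hi n)
    have e2 : (fun x => (f x - (φ m : 𝓢(Rd d, ℝ)) x) - (f x - (φ n : 𝓢(Rd d, ℝ)) x)) =
        ((φ n - φ m : schwartzZero d) : 𝓢(Rd d, ℝ)) := by
      ext x
      simp
    rw [e2, add_comm] at h1
    exact h1
  have hc : CauchySeq fun n => (hm n).toLp := by
    rw [EMetric.cauchySeq_iff]
    intro ε hε
    have h2 : (0 : ℝ≥0∞) < ε / 2 := ENNReal.half_pos hε.ne'
    obtain ⟨N, hN⟩ := eventually_atTop.1 (hn.eventually_lt_const h2)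
    refine ⟨N, fun n hn' m hm' => (hdist n m).trans_lt ?_⟩
    calc δ n + δ m < ε / 2 + ε / 2 := ENNReal.add_lt_add (hN n hn') (hN m hm')
      _ = ε := ENNReal.add_halves ε
  obtain ⟨Y, hY⟩ := cauchySeq_tendsto_of_complete hc
  refine ⟨Y, hf, Lp.memLp Y, φ, hφ, ?_⟩
  rw [tendsto_iff_edist_tendsto_0] at hY
  refine hY.congr fun n => ?_
  rw [Lp.edist_def]
  refine eLpNorm_congr_ae ?_
  filter_upwards [(hm n).coeFn_toLp] with ω hω
  rw [Pi.sub_apply, hω]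

end IsWholeSpaceLGF

namespace IsPairing

theorem zero : IsPairing P h (fun _ => 0) fun _ => 0 := by
  refine ⟨integrable_zero _ _ _, MemLp.zero, fun _ => 0, ?_, ?_⟩
  · rw [tendsto_normSqHNeg_iff]
    simp [hnegNorm_zero]
  · simp

theorem add (hh : IsWholeSpaceLGF P h) {f g : Rd d → ℝ} {Y Z : Ω → ℝ}
    (hf : IsPairing P h f Y) (hg : IsPairing P h g Z) :
    IsPairing P h (fun x => f x + g x) fun ω => Y ω + Z ω := by
  obtain ⟨hfi, hY, φ, h1, h2⟩ := hf
  obtain ⟨hgi, hZ, ψ, h3, h4⟩ := hg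
  rw [tendsto_normSqHNeg_iff] at h1 h3
  refine ⟨hfi.add hgi, hY.add hZ, fun n => φ n + ψ n, ?_, ?_⟩
  · rw [tendsto_normSqHNeg_iff]
    have h13 := h1.add h3
    rw [add_zero] at h13
    refine tendsto_of_tendsto_of_tendsto_of_le_of_le tendsto_const_nhds h13
      (fun _ => zero_le) fun n => ?_
    have hle := hnegNorm_add_le
      (f := fun x => f x - (φ n : 𝓢(Rd d, ℝ)) x) (g := fun x => g x - (ψ n : 𝓢(Rd d, ℝ)) x)
      (hfi.sub (SchwartzMap.integrable _)) (hgi.sub (SchwartzMap.integrable _))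
    refine le_trans (le_of_eq ?_) hle
    congr 1
    ext x
    simp only [Submodule.coe_add, add_apply]
    ring
  · have h24 := h2.add h4
    rw [add_zero] at h24
    refine tendsto_of_tendsto_of_tendsto_of_le_of_le tendsto_const_nhds h24
      (fun _ => zero_le) fun n => ?_
    have m1 : AEStronglyMeasurable (fun ω => h ω (φ n) - Y ω) P :=
      (hh.gaussian (φ n)).memLp_two.1.sub hY.1
    have m2 : AEStronglyMeasurable (fun ω => h ω (ψ n) - Z ω) P :=
      (hh.gaussian (ψ n)).memLp_two.1.sub hZ.1
    refine le_trans (le_of_eq ?_) (eLpNorm_add_le m1 m2 one_le_two)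
    congr 1
    ext ω
    simp only [map_add, Pi.add_apply]
    ring

theorem const_mul {f : Rd d → ℝ} {Y : Ω → ℝ} (hf : IsPairing P h f Y) (c : ℝ) :
    IsPairing P h (fun x => c * f x) fun ω => c * Y ω := by
  obtain ⟨hfi, hY, φ, h1, h2⟩ := hf
  rw [tendsto_normSqHNeg_iff] at h1
  refine ⟨hfi.const_mul c, hY.const_mul c, fun n => c • φ n, ?_, ?_⟩
  · rw [tendsto_normSqHNeg_iff]
    have h3 := ENNReal.Tendsto.const_mul (a := ‖c‖ₑ) h1 (Or.inr enorm_ne_top)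
    rw [mul_zero] at h3
    refine h3.congr fun n => ?_
    rw [← hnegNorm_const_mul]
    congr 1
    ext x
    simp only [Submodule.coe_smul, smul_apply, smul_eq_mul]
    ring
  · have h3 := ENNReal.Tendsto.const_mul (a := ‖c‖ₑ) h2 (Or.inr enorm_ne_top)
    rw [mul_zero] at h3
    refine h3.congr fun n => ?_
    rw [← eLpNorm_const_smul]
    congr 1
    ext ω
    simp only [map_smul, smul_eq_mul, Pi.smul_apply]
    ring

theorem sum (hh : IsWholeSpaceLGF P h) {ι : Type*} (s : Finset ι) (a : ι → ℝ)
    {f : ι → Rd d → ℝ} {Y : ι → Ω → ℝ} (hf : ∀ i, IsPairing P h (f i) (Y i)) :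
    IsPairing P h (fun x => ∑ i ∈ s, a i * f i x) fun ω => ∑ i ∈ s, a i * Y i ω := by
  classical
  induction s using Finset.induction_on with
  | empty =>
    simp only [Finset.sum_empty]
    exact zero
  | insert i s hi ih =>
    simp only [Finset.sum_insert hi]
    exact ((hf i).const_mul (a i)).add hh ih

theorem hnegNorm_ne_top (hh : IsWholeSpaceLGF P h) {f : Rd d → ℝ} {Y : Ω → ℝ}
    (hf : IsPairing P h f Y) : hnegNorm f ≠ ∞ := by
  obtain ⟨hfi, -, φ, h1, -⟩ := hf
  rw [tendsto_normSqHNeg_iff] at h1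
  obtain ⟨n, hn⟩ := (h1.eventually_lt_const (zero_lt_one)).exists
  have h2 := hnegNorm_le_add hfi ((φ n : 𝓢(Rd d, ℝ)).integrable (μ := volume))
  rw [← hh.eLpNorm_apply] at h2
  exact (h2.trans_lt (ENNReal.add_lt_top.2
    ⟨(hh.gaussian (φ n)).memLp_two.2, hn.trans ENNReal.one_lt_top⟩)).ne

theorem enorm_cexp_sub_le (a b : ℝ) :
    ‖Complex.exp ((a : ℂ) * Complex.I) - Complex.exp ((b : ℂ) * Complex.I)‖ₑ ≤ ‖a - b‖ₑ := by
  have e : Complex.exp ((a : ℂ) * Complex.I) - Complex.exp ((b : ℂ) * Complex.I) =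
      Complex.exp ((b : ℂ) * Complex.I) *
        (Complex.exp (Complex.I * ((a - b : ℝ) : ℂ)) - 1) := by
    rw [mul_sub, ← Complex.exp_add, mul_one]
    congr 2
    push_cast; ring
  rw [e, enorm_mul, ← ofReal_norm, Complex.norm_exp_ofReal_mul_I, ENNReal.ofReal_one, one_mul]
  exact Real.enorm_exp_I_mul_ofReal_sub_one_le

theorem tendsto_integral_cexp [IsProbabilityMeasure P] {X : ℕ → Ω → ℝ} {Y : Ω → ℝ}
    (hX : ∀ n, AEMeasurable (X n) P)
    (hY : AEMeasurable Y P)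
    (hXY : Tendsto (fun n => eLpNorm (fun ω => X n ω - Y ω) 2 P) atTop (𝓝 0)) :
    Tendsto (fun n => ∫ ω, Complex.exp (((X n ω : ℝ) : ℂ) * Complex.I) ∂P) atTop
      (𝓝 (∫ ω, Complex.exp (((Y ω : ℝ) : ℂ) * Complex.I) ∂P)) := by
  have hint : ∀ {Z : Ω → ℝ}, AEMeasurable Z P →
      Integrable (fun ω => Complex.exp (((Z ω : ℝ) : ℂ) * Complex.I)) P := by
    intro Z hZ
    refine Integrable.of_bound (C := 1) (AEMeasurable.aestronglyMeasurable (by fun_prop)) ?_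
    exact ae_of_all _ fun ω => (Complex.norm_exp_ofReal_mul_I _).le
  rw [tendsto_iff_edist_tendsto_0]
  refine tendsto_of_tendsto_of_tendsto_of_le_of_le tendsto_const_nhds hXY
    (fun _ => zero_le) fun n => ?_
  rw [edist_eq_enorm_sub, ← integral_sub (hint (hX n)) (hint hY)]
  calc _ ≤ ∫⁻ ω, ‖Complex.exp (((X n ω : ℝ) : ℂ) * Complex.I) -
        Complex.exp (((Y ω : ℝ) : ℂ) * Complex.I)‖ₑ ∂P := enorm_integral_le_lintegral_enorm _
    _ ≤ ∫⁻ ω, ‖X n ω - Y ω‖ₑ ∂P := lintegral_mono fun ω => enorm_cexp_sub_le _ _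
    _ = eLpNorm (fun ω => X n ω - Y ω) 1 P := eLpNorm_one_eq_lintegral_enorm.symm
    _ ≤ eLpNorm (fun ω => X n ω - Y ω) 2 P :=
        eLpNorm_le_eLpNorm_of_exponent_le one_le_two ((hX n).sub hY).aestronglyMeasurable

/-- The characteristic function of a pairing. -/
theorem integral_cexp [IsProbabilityMeasure P] (hh : IsWholeSpaceLGF P h) {f : Rd d → ℝ} {Y : Ω → ℝ}
    (hf : IsPairing P h f Y) :
    ∫ ω, Complex.exp (((Y ω : ℝ) : ℂ) * Complex.I) ∂P =
      Complex.exp (-((hnegNorm f).toReal ^ 2 : ℝ) / 2) := by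
  have hfin := hf.hnegNorm_ne_top hh
  obtain ⟨hfi, hY, φ, h1, h2⟩ := hf
  rw [tendsto_normSqHNeg_iff] at h1
  have t1 := tendsto_integral_cexp (fun n => (hh.gaussian (φ n)).aemeasurable)
    hY.1.aemeasurable h2
  simp only [hh.integral_cexp] at t1
  have t2 := (ENNReal.tendsto_toReal hfin).comp (tendsto_hnegNorm hfi hfin h1)
  have hc : Continuous fun r : ℝ => Complex.exp (-((r ^ 2 : ℝ) : ℂ) / 2) := by fun_prop
  exact tendsto_nhds_unique t1 ((hc.tendsto _).comp t2)

/-- The law of a pairing. -/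
theorem map_eq_gaussianReal [IsProbabilityMeasure P] (hh : IsWholeSpaceLGF P h)
    {f : Rd d → ℝ} {Y : Ω → ℝ}
    (hf : IsPairing P h f Y) : P.map Y = gaussianReal 0 ((hnegNorm f).toNNReal ^ 2) := by
  have hm : AEMeasurable Y P := hf.2.1.1.aemeasurable
  have := Measure.isProbabilityMeasure_map hm
  refine Measure.ext_of_charFun ?_
  ext t
  rw [charFun_gaussianReal, charFun_apply_real,
    integral_map hm (Continuous.aestronglyMeasurable (by fun_prop))]
  have h1 := (hf.const_mul t).integral_cexp hh
  rw [hnegNorm_const_mul] at h1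
  simp only [Complex.ofReal_mul] at h1
  rw [h1]
  congr 1
  rw [ENNReal.toReal_mul, toReal_enorm, Real.norm_eq_abs, mul_pow, sq_abs]
  simp only [Complex.ofReal_zero, mul_zero, zero_mul, zero_sub, NNReal.coe_pow]
  push_cast
  ring

end IsPairing

end Pairing

/-! ### The white noise field -/

section WhiteNoise

variable {d : ℕ} {Ω : Type u} [MeasurableSpace Ω] {P : Measure Ω}
  {W : Lp ℝ 2 (spaceTime d) → Ω → ℝ}

namespace IsWhiteNoise

theorem covariance_eq_inner (hW : IsWhiteNoise P W) (f g : Lp ℝ 2 (spaceTime d)) :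
    cov[W f, W g; P] = inner ℝ f g := by
  rw [hW.cov_eq, L2.inner_def]
  congr 1; ext p
  simp [mul_comm]

theorem hasGaussianLaw_sum (hW : IsWhiteNoise P W) {ι : Type*} (s : Finset ι) (a : ι → ℝ)
    (f : ι → Lp ℝ 2 (spaceTime d)) : HasGaussianLaw (fun ω => ∑ i ∈ s, a i * W (f i) ω) P :=
  ((hW.gaussian.comp_right f).smul a).hasGaussianLaw_fun_sum

/-- The law of a linear combination of white noise integrals. -/
theorem map_sum_eq (hW : IsWhiteNoise P W) {ι : Type*} (s : Finset ι) (a : ι → ℝ)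
    (f : ι → Lp ℝ 2 (spaceTime d)) :
    P.map (fun ω => ∑ i ∈ s, a i * W (f i) ω) =
      gaussianReal 0 (‖∑ i ∈ s, a i • f i‖₊ ^ 2) := by
  have hP := hW.gaussian.isProbabilityMeasure
  have hm : ∀ i, MemLp (fun ω => a i * W (f i) ω) 2 P := fun i =>
    (hW.gaussian.hasGaussianLaw_eval (f i)).memLp_two.const_mul (a i)
  have h1 := (hW.hasGaussianLaw_sum s a f).map_eq_gaussianReal
  have h0 : ∫ ω, ∑ i ∈ s, a i * W (f i) ω ∂P = 0 := by
    rw [integral_finsetSum _ fun i _ => (hm i).integrable one_le_two]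
    refine Finset.sum_eq_zero fun i _ => ?_
    rw [integral_const_mul, hW.mean_zero, mul_zero]
  have hv : Var[fun ω => ∑ i ∈ s, a i * W (f i) ω; P] = ‖∑ i ∈ s, a i • f i‖ ^ 2 := by
    rw [← covariance_self (hW.hasGaussianLaw_sum s a f).aemeasurable,
      covariance_fun_sum_fun_sum' (fun i _ => hm i) fun i _ => hm i,
      ← real_inner_self_eq_norm_sq, sum_inner]
    refine Finset.sum_congr rfl fun i _ => ?_
    rw [inner_sum]
    refine Finset.sum_congr rfl fun j _ => ?_
    rw [covariance_const_mul_left, covariance_const_mul_right, hW.covariance_eq_inner,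
      real_inner_smul_left, real_inner_smul_right]
  rw [h1, h0, hv]
  congr 1
  ext
  rw [Real.coe_toNNReal _ (by positivity)]
  simp

/-- Linearity of the noise is not part of its definition; it follows from the covariance, since `W f
- W g - W (f - g)` is centred Gaussian with variance `‖f - g - (f - g)‖² = 0`. -/
theorem ae_sub_eq (hW : IsWhiteNoise P W) (f g : Lp ℝ 2 (spaceTime d)) :
    (fun ω => W f ω - W g ω) =ᵐ[P] W (f - g) := by
  have h := hW.map_sum_eq (Finset.univ : Finset (Fin 3)) ![1, -1, -1] ![f, g, f - g]
  have hm := (hW.hasGaussianLaw_sum (Finset.univ : Finset (Fin 3)) ![1, -1, -1]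
    ![f, g, f - g]).aemeasurable
  have e : ∑ i, (![1, -1, -1] : Fin 3 → ℝ) i • (![f, g, f - g] : Fin 3 → _) i = 0 := by
    rw [Fin.sum_univ_three]
    simp
    abel
  rw [e, nnnorm_zero, zero_pow two_ne_zero, gaussianReal_zero_var] at h
  have h2 : ∀ᵐ r ∂(P.map fun ω => ∑ i, (![1, -1, -1] : Fin 3 → ℝ) i *
      W ((![f, g, f - g] : Fin 3 → _) i) ω), r = 0 := by
    rw [h, ae_dirac_iff (measurableSet_eq)]
  filter_upwards [ae_of_ae_map hm h2] with ω hω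
  rw [Fin.sum_univ_three] at hω
  simp at hω
  linarith

end IsWhiteNoise

theorem waveSum_unit (x y : Rd d) : waveSum (Finset.univ : Finset Unit) (fun _ => 1)
    (fun _ => x) (fun _ => y) = fun ξ => waveChar x ξ - waveChar y ξ := by
  ext ξ
  simp [waveSum]

namespace IsAdmissibleKernel

variable [NeZero d] {k : Rd d → ℝ}

theorem nnnorm_sum_toLp_sq (hk : IsAdmissibleKernel k) {ε : ℝ} (hε : 0 < ε) {ι : Type*}
    (s : Finset ι) (a : ι → ℝ) (x y : ι → Rd d) :
    ‖∑ i ∈ s, a i • (hk.memLp_whiteNoiseIntegrand hε (x i) (y i)).toLp‖₊ ^ 2 =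
      (symbolVariance k ε (waveSum s a x y)).toNNReal := by
  set F : Lp ℝ 2 (spaceTime d) :=
    ∑ i ∈ s, a i • (hk.memLp_whiteNoiseIntegrand hε (x i) (y i)).toLp with hF
  have hco : F =ᵐ[spaceTime d] fun p => ∑ i ∈ s, a i * whiteNoiseIntegrand k ε (x i) (y i) p := by
    classical
    rw [hF]
    clear hF F
    induction s using Finset.induction_on with
    | empty =>
      simp only [Finset.sum_empty]
      exact Lp.coeFn_zero _ _ _
    | insert i s hi ih =>
      simp only [Finset.sum_insert hi]
      filter_upwards [ih, Lp.coeFn_add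
        (a i • (hk.memLp_whiteNoiseIntegrand hε (x i) (y i)).toLp)
        (∑ i ∈ s, a i • (hk.memLp_whiteNoiseIntegrand hε (x i) (y i)).toLp),
        Lp.coeFn_smul (a i) (hk.memLp_whiteNoiseIntegrand hε (x i) (y i)).toLp,
        (hk.memLp_whiteNoiseIntegrand hε (x i) (y i)).coeFn_toLp] with p h1 h2 h3 h4
      rw [h2, Pi.add_apply, h3, h1, Pi.smul_apply, h4, smul_eq_mul]
  have h1 : (‖F‖₊ : ℝ≥0∞) ^ 2 = symbolVariance k ε (waveSum s a x y) := by
    rw [← hk.lintegral_sum_whiteNoiseIntegrand hε, ← eLpNorm_two_sq, ← eLpNorm_congr_ae hco]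
    congr 1
    rw [Lp.nnnorm_def, ENNReal.coe_toNNReal (Lp.eLpNorm_ne_top F)]
  rw [← h1, ← ENNReal.coe_pow, ENNReal.toNNReal_coe]

/-- The law of a linear combination of increments of the white noise field. -/
theorem map_sum_whiteNoise (hk : IsAdmissibleKernel k) (hW : IsWhiteNoise P W) {ε : ℝ}
    (hε : 0 < ε) {ι : Type*} (s : Finset ι) (a : ι → ℝ) (x y : ι → Rd d) :
    P.map (fun ω => ∑ i ∈ s, a i * W (hk.memLp_whiteNoiseIntegrand hε (x i) (y i)).toLp ω) =
      gaussianReal 0 (symbolVariance k ε (waveSum s a x y)).toNNReal := by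
  rw [hW.map_sum_eq s a fun i => (hk.memLp_whiteNoiseIntegrand hε (x i) (y i)).toLp,
    hk.nnnorm_sum_toLp_sq hε]

/-- The variance of an increment is at most a constant times the squared distance. -/
theorem exists_symbolVariance_incr_le (hk : IsAdmissibleKernel k) {ε : ℝ} (hε : 0 < ε) :
    ∃ M : ℝ, 0 ≤ M ∧ ∀ x y : Rd d,
      ((symbolVariance k ε fun ξ => waveChar x ξ - waveChar y ξ).toNNReal : ℝ) ≤
        M * ‖x - y‖ ^ 2 := by
  obtain ⟨M, hM, h⟩ := hk.exists_symbolVariance_le hε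
  refine ⟨(2 * Real.pi) ^ 2 * M, by positivity, fun x y => ?_⟩
  have h1 := h (fun ξ => waveChar x ξ - waveChar y ξ) (2 * Real.pi * ‖x - y‖) (by positivity)
    (norm_waveChar_sub_le x y)
  have h2 := ENNReal.toReal_mono ENNReal.ofReal_ne_top h1
  rw [ENNReal.toReal_ofReal (by positivity)] at h2
  calc _ ≤ _ := h2
    _ = _ := by ring

/-- A random field whose increments are centred Gaussian with the variance of the mollified
log-correlated field has a continuous modification. -/
theorem exists_contModConst (hk : IsAdmissibleKernel k) {ε : ℝ} (hε : 0 < ε) {X : Rd d → Ω → ℝ}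
    (hX : ∀ x, AEMeasurable (X x) P)
    (hlaw : ∀ x y, P.map (fun ω => X x ω - X y ω) =
      gaussianReal 0 (symbolVariance k ε fun ξ => waveChar x ξ - waveChar y ξ).toNNReal) :
    ∃ A : Ω → ContModConst d, ∀ x y, (fun ω => incr x y (A ω)) =ᵐ[P] fun ω => X x ω - X y ω := by
  obtain ⟨M, hM, hv⟩ := hk.exists_symbolVariance_incr_le hε
  -- A Gaussian moment of order `4d` is the `2d`-th power of the variance `O(‖x - y‖²)`, hence `O(‖x
  -- - y‖^{4d})`, as the continuity criterion demands.
  obtain ⟨c, hc, hmom⟩ := exists_gaussian_moment.{u} (2 * d)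
  obtain ⟨A, hA⟩ := exists_continuous_modification (P := P) (X := X) hX
    (C := c * M ^ (2 * d)) (by positivity) fun x y => by
      have h1 := hmom ((hX x).sub (hX y)) (hlaw x y) (hv x y)
      have e : 2 * (2 * d) = 4 * d := by ring
      rw [e, mul_pow, ← pow_mul, e, ← mul_assoc] at h1
      exact h1
  refine ⟨fun ω => (constFunctions d).mkQ (A ω), fun x y => ?_⟩
  filter_upwards [hA x, hA y] with ω hx hy
  rw [incr_mk, hx, hy]

/-- The field `𝔥_ε` exists. -/
theorem exists_isWhiteNoiseField (hk : IsAdmissibleKernel k) (hW : IsWhiteNoise P W) {ε : ℝ}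
    (hε : 0 < ε) : ∃ A : Ω → ContModConst d, IsWhiteNoiseField P W k ε A := by
  have hsub : ∀ x y : Rd d, (hk.memLp_whiteNoiseIntegrand hε x 0).toLp -
      (hk.memLp_whiteNoiseIntegrand hε y 0).toLp = (hk.memLp_whiteNoiseIntegrand hε x y).toLp := by
    intro x y
    rw [← MemLp.toLp_sub]
    refine MemLp.toLp_congr _ _ (ae_of_all _ fun p => ?_)
    simp only [Pi.sub_apply, whiteNoiseIntegrand, Set.indicator]
    split_ifs <;> ring
  have hae : ∀ x y : Rd d, (fun ω => W (hk.memLp_whiteNoiseIntegrand hε x 0).toLp ω -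
      W (hk.memLp_whiteNoiseIntegrand hε y 0).toLp ω) =ᵐ[P]
      W (hk.memLp_whiteNoiseIntegrand hε x y).toLp := by
    intro x y
    rw [← hsub x y]
    exact hW.ae_sub_eq _ _
  obtain ⟨A, hA⟩ := hk.exists_contModConst hε (P := P)
    (X := fun x => W (hk.memLp_whiteNoiseIntegrand hε x 0).toLp)
    (fun x => hW.gaussian.aemeasurable _) fun x y => by
      rw [Measure.map_congr (hae x y)]
      have h := hk.map_sum_whiteNoise hW hε (Finset.univ : Finset Unit) (fun _ => 1)
        (fun _ => x) (fun _ => y)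
      rw [waveSum_unit] at h
      simpa using h
  exact ⟨A, fun x y => ⟨hk.memLp_whiteNoiseIntegrand hε x y, (hA x y).trans (hae x y)⟩⟩

end IsAdmissibleKernel

/-- The law of a linear combination of increments of `𝔥_ε`. -/
theorem IsWhiteNoiseField.map_sum_incr [NeZero d] {k : Rd d → ℝ} (hk : IsAdmissibleKernel k)
    (hW : IsWhiteNoise P W) {ε : ℝ} (hε : 0 < ε) {A : Ω → ContModConst d}
    (hA : IsWhiteNoiseField P W k ε A) {ι : Type*} (s : Finset ι) (a : ι → ℝ)
    (x y : ι → Rd d) :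
    P.map (fun ω => ∑ i ∈ s, a i * incr (x i) (y i) (A ω)) =
      gaussianReal 0 (symbolVariance k ε (waveSum s a x y)).toNNReal := by
  rw [← hk.map_sum_whiteNoise hW hε]
  refine Measure.map_congr ?_
  have : ∀ᵐ ω ∂P, ∀ i ∈ s, incr (x i) (y i) (A ω) =
      W (hk.memLp_whiteNoiseIntegrand hε (x i) (y i)).toLp ω := by
    refine (Finset.eventually_all s).2 fun i _ => ?_
    exact (hA (x i) (y i)).choose_spec
  filter_upwards [this] with ω hω
  exact Finset.sum_congr rfl fun i hi => by rw [hω i hi]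

theorem IsWhiteNoiseField.aemeasurable_incr {k : Rd d → ℝ} (hW : IsWhiteNoise P W) {ε : ℝ}
    {A : Ω → ContModConst d} (hA : IsWhiteNoiseField P W k ε A) (x y : Rd d) :
    AEMeasurable (fun ω => incr x y (A ω)) P :=
  (hW.gaussian.aemeasurable _).congr (hA x y).choose_spec.symm

end WhiteNoise

/-! ### The mollification of the log-correlated field -/

section Convolution

variable {d : ℕ}

/-- A radial Schwartz function is the Fourier transform of a real radial Schwartz function. -/
theorem IsRadial.exists_schwartzMap_fourierReal_eq {F : 𝓢(Rd d, ℝ)} (hF : IsRadial F) :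
    ∃ K : 𝓢(Rd d, ℝ), IsRadial K ∧ ∀ ξ, fourierReal K ξ = F ξ := by
  set G : 𝓢(Rd d, ℂ) := SchwartzMap.postcompCLM Complex.ofRealCLM F
  have hG : ∀ x, 𝓕 G x = fourierReal F x := fun x => rfl
  set K : 𝓢(Rd d, ℝ) := SchwartzMap.postcompCLM Complex.reCLM (𝓕 G)
  have hK : ∀ x, K x = (fourierReal F x).re := fun x => rfl
  refine ⟨K, fun x y h => ?_, fun ξ => ?_⟩
  · rw [hK, hK, hF.fourierReal_eq h]
  · have h1 : (fun x => (K x : ℂ)) = 𝓕 (fun x => (F x : ℂ)) := by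
      ext x
      rw [hK]
      exact hF.ofReal_re_fourierReal x
    have hc : Continuous fun x => (F x : ℂ) := Complex.continuous_ofReal.comp F.continuous
    have hi : Integrable (𝓕 fun x => (F x : ℂ)) := by
      rw [← h1]; exact K.integrable.ofReal
    have h2 := congrFun (hc.fourierInv_fourier_eq F.integrable.ofReal hi) (-ξ)
    rw [← h1, Real.fourierInv_eq_fourier_neg, neg_neg] at h2
    rw [fourierReal, h2, hF (-ξ) ξ (norm_neg ξ)]

/-- Increments of a rescaled Schwartz function are Schwartz functions. -/
theorem exists_schwartzMap_kernelIncr (K : 𝓢(Rd d, ℝ)) {ε : ℝ} (hε : 0 < ε) (x y : Rd d) :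
    ∃ φ : 𝓢(Rd d, ℝ), ∀ w, φ w = kernelIncr K ε x y w := by
  have hg : ∀ z : Rd d, (fun w : Rd d => ε⁻¹ • (z - w)).HasTemperateGrowth := by
    intro z; fun_prop
  have ha : ∀ z : Rd d, AntilipschitzWith ε.toNNReal fun w : Rd d => ε⁻¹ • (z - w) := by
    intro z
    refine AntilipschitzWith.of_le_mul_dist fun w w' => ?_
    rw [dist_smul₀, dist_sub_left, Real.norm_of_nonneg (inv_nonneg.2 hε.le),
      Real.coe_toNNReal _ hε.le, mul_inv_cancel_left₀ hε.ne']
  refine ⟨(ε ^ d)⁻¹ • (SchwartzMap.compCLMOfAntilipschitz ℝ (hg x) (ha x) K -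
    SchwartzMap.compCLMOfAntilipschitz ℝ (hg y) (ha y) K), fun w => ?_⟩
  simp [kernelIncr, rescale, mul_sub]

/-- The transform of the increment carries the factor `e^{-2πi x·ξ} - e^{-2πi y·ξ}`, which vanishes
at `ξ = 0`. Increments of Schwartz kernels are thus admissible test functions. -/
theorem integral_kernelIncr {K : Rd d → ℝ} (hK : Integrable K) (hr : IsRadial K) {ε : ℝ}
    (hε : 0 < ε) (x y : Rd d) : ∫ w, kernelIncr K ε x y w = 0 := by
  have h := fourierReal_kernelIncr hK hr hε x y 0
  rw [fourierReal_eq] at h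
  simp only [inner_zero_right, neg_zero, AddChar.map_zero_eq_one, one_smul, waveChar] at h
  rw [integral_complex_ofReal] at h
  simpa using h

variable [NeZero d] {k : Rd d → ℝ}

namespace IsAdmissibleKernel

/-- Regularizations of the symbol by Schwartz functions. -/
theorem exists_schwartzMap_tendsto_kernelSymbol (hk : IsAdmissibleKernel k) :
    ∃ F : ℕ → 𝓢(Rd d, ℝ), (∀ n, IsRadial (F n)) ∧
      (∀ n ζ, 0 ≤ F n ζ ∧ F n ζ ≤ kernelSymbol k ζ) ∧
      ∀ ζ, Tendsto (fun n => F n ζ) atTop (𝓝 (kernelSymbol k ζ)) := by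
  obtain ⟨g, hg⟩ := hk.exists_isEntireProfile
  have hδ : ∀ n : ℕ, (0:ℝ) < 1 / ((n:ℝ) + 1) := fun n => Nat.one_div_pos_of_nat
  choose F hF using fun n : ℕ => hg.exists_schwartzMap_comp (E := Rd d) (hδ n)
  refine ⟨F, fun n x y h => by rw [hF, hF, h], fun n ζ => ⟨?_, ?_⟩, fun ζ => ?_⟩
  · rw [hF]; exact Real.sqrt_nonneg _
  · rw [hF, kernelSymbol_eq]
    refine Real.sqrt_le_sqrt (hk.symbolProfile_antitoneOn (norm_nonneg _) (Real.sqrt_nonneg _) ?_)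
    exact Real.le_sqrt_of_sq_le (by linarith [hδ n])
  · have h1 : ∀ r : ℝ, 0 ≤ r → √(symbolProfile k r) =
        kernelSymbol k (r • EuclideanSpace.single (0 : Fin d) (1:ℝ)) := by
      intro r hr
      rw [kernelSymbol_eq, norm_smul, Real.norm_of_nonneg hr]
      simp
    have h2 : Tendsto (fun n : ℕ => √(‖ζ‖ ^ 2 + 1 / ((n:ℝ) + 1))) atTop (𝓝 ‖ζ‖) := by
      have := ((tendsto_one_div_add_atTop_nhds_zero_nat (𝕜 := ℝ)).const_add (‖ζ‖ ^ 2)).sqrt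
      rwa [add_zero, Real.sqrt_sq (norm_nonneg _)] at this
    have hc : Continuous fun r : ℝ =>
        kernelSymbol k (r • EuclideanSpace.single (0 : Fin d) (1:ℝ)) :=
      hk.continuous_kernelSymbol.comp (by fun_prop)
    rw [kernelSymbol_eq, h1 _ (norm_nonneg _)]
    refine ((hc.tendsto _).comp h2).congr fun n => ?_
    rw [hF, Function.comp_apply, h1 _ (Real.sqrt_nonneg _)]

/-- The increments of the mollifier are limits of test functions. -/
theorem exists_tendsto_normSqHNeg_kernelIncr (hk : IsAdmissibleKernel k) (hd : 2 ≤ d) {ε : ℝ}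
    (hε : 0 < ε) (x y : Rd d) :
    ∃ φ : ℕ → schwartzZero d, Tendsto (fun n => normSqHNeg fun w =>
      kernelIncr (convKernel k) ε x y w - (φ n : 𝓢(Rd d, ℝ)) w) atTop (𝓝 0) := by
  obtain ⟨F, hFr, hF, hlim⟩ := hk.exists_schwartzMap_tendsto_kernelSymbol
  choose K hKr hK using fun n => (hFr n).exists_schwartzMap_fourierReal_eq
  choose φ hφ using fun n => exists_schwartzMap_kernelIncr (K n) hε x y
  have h0 : ∀ n, φ n ∈ schwartzZero d := by
    intro n
    change ∫ w, φ n w = 0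
    simp only [hφ]
    exact integral_kernelIncr (K n).integrable (hKr n) hε x y
  refine ⟨fun n => ⟨φ n, h0 n⟩, ?_⟩
  have hcK := hk.integrable_convKernel hd
  have e : ∀ n, (normSqHNeg fun w => kernelIncr (convKernel k) ε x y w - φ n w) =
      ∫⁻ ξ, ‖waveChar x ξ - waveChar y ξ‖ₑ ^ 2 *
        ENNReal.ofReal ((kernelSymbol k (ε • ξ) - F n (ε • ξ)) ^ 2) * hnegWeight d ξ := by
    intro n
    rw [normSqHNeg_eq_lintegral]
    refine lintegral_congr fun ξ => ?_
    simp only [hφ]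
    rw [fourierReal_sub (integrable_kernelIncr hcK hε x y)
      (integrable_kernelIncr (K n).integrable hε x y),
      fourierReal_kernelIncr hcK (isRadial_convKernel k) hε,
      fourierReal_kernelIncr (K n).integrable (hKr n) hε, hk.fourierReal_convKernel hd, hK,
      ← mul_sub, enorm_mul, mul_pow, ← Complex.ofReal_sub,
      ← ofReal_norm (((kernelSymbol k (ε • ξ) - F n (ε • ξ) : ℝ) : ℂ)), Complex.norm_real,
      ← ENNReal.ofReal_pow (norm_nonneg _), Real.norm_eq_abs, sq_abs]
  simp only [e]
  -- Finiteness of the majorant: from `0 ≤ F n ≤ σ` one gets `(σ - F n)² ≤ σ²`, so the variance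
  -- integrand dominates.
  have hfin := hk.symbolVariance_waveSum_lt_top hε (Finset.univ : Finset Unit) (fun _ => 1)
    (fun _ => x) (fun _ => y)
  rw [waveSum_unit, symbolVariance] at hfin
  have hw : Measurable fun ξ : Rd d => ‖waveChar x ξ - waveChar y ξ‖ₑ ^ 2 :=
    ((continuous_waveChar x).sub (continuous_waveChar y)).enorm.measurable.pow_const 2
  rw [← lintegral_zero (μ := (volume : Measure (Rd d)))]
  refine tendsto_lintegral_of_dominated_convergence _ (fun n => ?_)
    (fun n => ae_of_all _ fun ξ => ?_) hfin.ne (ae_of_all _ fun ξ => ?_)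
  · refine (hw.mul (Measurable.ennreal_ofReal ?_)).mul (measurable_hnegWeight d)
    have := hk.continuous_kernelSymbol
    have := (F n).continuous
    exact Continuous.measurable (by fun_prop)
  · refine mul_le_mul_left (mul_le_mul_right (ENNReal.ofReal_le_ofReal ?_) _) _
    obtain ⟨h1, h2⟩ := hF n (ε • ξ)
    exact pow_le_pow_left₀ (by linarith) (by linarith) 2
  · have h1 : Tendsto (fun n => ENNReal.ofReal ((kernelSymbol k (ε • ξ) - F n (ε • ξ)) ^ 2)) atTop
        (𝓝 0) := by
      have := ENNReal.tendsto_ofReal (((hlim (ε • ξ)).const_sub (kernelSymbol k (ε • ξ))).pow 2)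
      simpa using this
    have h2 := ENNReal.Tendsto.mul_const (ENNReal.Tendsto.const_mul (a :=
      ‖waveChar x ξ - waveChar y ξ‖ₑ ^ 2) h1 (Or.inr (ENNReal.pow_ne_top enorm_ne_top)))
      (b := hnegWeight d ξ) (Or.inr ENNReal.ofReal_ne_top)
    simpa using h2

variable {Ω : Type u} [MeasurableSpace Ω] {P : Measure Ω} [IsProbabilityMeasure P]
  {h : Ω → GenFunModConst d}

theorem normSqHNeg_kernelIncr (hk : IsAdmissibleKernel k) (hd : 2 ≤ d) {ε : ℝ} (hε : 0 < ε)
    (x y : Rd d) : normSqHNeg (kernelIncr (convKernel k) ε x y) =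
      symbolVariance k ε fun ξ => waveChar x ξ - waveChar y ξ := by
  have h := hk.normSqHNeg_sum_kernelIncr hd hε (Finset.univ : Finset Unit) (fun _ => 1)
    (fun _ => x) (fun _ => y)
  rw [waveSum_unit] at h
  simpa using h

/-- The mollified field `h * K_ε` exists. -/
theorem exists_isConvolution (hk : IsAdmissibleKernel k) (hd : 2 ≤ d) (hh : IsWholeSpaceLGF P h)
    {ε : ℝ} (hε : 0 < ε) :
    ∃ B : Ω → ContModConst d, IsConvolution P h (rescale (convKernel k) ε) B := by
  -- The variable chosen for `x` plays the role of the increment between `x` and the origin, which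
  -- fixes the additive constant.
  have hex : ∀ x : Rd d, ∃ Y, IsPairing P h (kernelIncr (convKernel k) ε x 0) Y := by
    intro x
    obtain ⟨φ, hφ⟩ := hk.exists_tendsto_normSqHNeg_kernelIncr hd hε x 0
    exact hh.exists_isPairing (integrable_kernelIncr (hk.integrable_convKernel hd) hε x 0) hφ
  choose Y hY using hex
  have hsub : ∀ x y : Rd d, IsPairing P h (kernelIncr (convKernel k) ε x y)
      fun ω => Y x ω - Y y ω := by
    intro x y
    have h1 := (hY x).add hh ((hY y).const_mul (-1))
    have e1 : (fun w => kernelIncr (convKernel k) ε x 0 w +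
        -1 * kernelIncr (convKernel k) ε y 0 w) = kernelIncr (convKernel k) ε x y := by
      ext w; simp only [kernelIncr]; ring
    have e2 : (fun ω => Y x ω + -1 * Y y ω) = fun ω => Y x ω - Y y ω := by
      ext ω; ring
    rwa [e1, e2] at h1
  obtain ⟨B, hB⟩ := hk.exists_contModConst hε (P := P) (X := Y)
    (fun x => (hY x).2.1.1.aemeasurable) fun x y => by
      rw [(hsub x y).map_eq_gaussianReal hh, ← hk.normSqHNeg_kernelIncr hd hε, hnegNorm_sq,
        ENNReal.toNNReal_pow]
  exact ⟨B, fun x y => (hsub x y).congr_ae (hB x y).symm⟩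

/-- The white noise field and the mollified log-correlated field have the same law. -/
theorem identDistrib {Ω' : Type v} [MeasurableSpace Ω'] {P' : Measure Ω'} [IsProbabilityMeasure P']
    (hk : IsAdmissibleKernel k) (hd : 2 ≤ d) (hh : IsWholeSpaceLGF P h)
    {W : Lp ℝ 2 (spaceTime d) → Ω' → ℝ} (hW : IsWhiteNoise P' W) {ε : ℝ} (hε : 0 < ε)
    {A : Ω' → ContModConst d} {B : Ω → ContModConst d} (hA : IsWhiteNoiseField P' W k ε A)
    (hB : IsConvolution P h (rescale (convKernel k) ε) B) : IdentDistrib A B P' P := by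
  refine identDistrib_of_charFun_incr (fun x => hA.aemeasurable_incr hW x 0)
    (fun x => (hB x 0).2.1.1.aemeasurable) fun s a x => ?_
  have hp := IsPairing.sum hh s a fun i => hB (x i) 0
  have hv := hk.normSqHNeg_sum_kernelIncr hd hε s a x fun _ => 0
  rw [hp.integral_cexp hh]
  have hm : AEMeasurable (fun ω => ∑ i ∈ s, a i * incr (x i) 0 (A ω)) P' :=
    Finset.aemeasurable_fun_sum s fun i _ => (hA.aemeasurable_incr hW (x i) 0).const_mul _
  have h1 := congrArg (fun μ => charFun μ 1) (hA.map_sum_incr hk hW hε s a x fun _ => 0)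
  rw [charFun_gaussianReal, charFun_apply_real,
    integral_map hm (Continuous.aestronglyMeasurable (by fun_prop))] at h1
  simp only [Complex.ofReal_one, one_mul] at h1
  rw [h1, ← hv, hnegNorm_sq]
  congr 1
  rw [ENNReal.toNNReal_pow]
  simp only [NNReal.coe_pow]
  change _ = -(((hnegNorm fun w => ∑ i ∈ s, a i *
    kernelIncr (convKernel k) ε (x i) 0 w).toReal ^ 2 : ℝ) : ℂ) / 2
  rw [← ENNReal.coe_toNNReal_eq_toReal]
  push_cast
  ring

end IsAdmissibleKernel

end Convolution

theorem proposition1p7 (d : ℕ) [NeZero d] (hd : 2 ≤ d) (k : Rd d → ℝ)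
    (hk : IsAdmissibleKernel k) :
    Integrable (kernelSymbol k) ∧
    ∃ K : Rd d → ℝ,
      (∀ x, (K x : ℂ) = 𝓕⁻ (fun ζ => (kernelSymbol k ζ : ℂ)) x) ∧
      IsRadial K ∧
      Integrable K ∧ (∫ x, K x) = 1 ∧
      (∃ C : ℝ, ∀ x, |K x| ≤ C ∧ ‖x‖ ^ (2 * d - 1) * |K x| ≤ C) ∧
      (Even d → ∃ κ : 𝓢(Rd d, ℝ), ∀ x, κ x = K x) ∧
      ∀ (Ω : Type u) [MeasurableSpace Ω] (P : Measure Ω) [IsProbabilityMeasure P]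
        (h : Ω → GenFunModConst d) (_ : IsWholeSpaceLGF P h)
        (Ω' : Type v) [MeasurableSpace Ω'] (P' : Measure Ω') [IsProbabilityMeasure P']
        (W : Lp ℝ 2 (spaceTime d) → Ω' → ℝ) (_ : IsWhiteNoise P' W)
        (ε : ℝ) (_ : 0 < ε),
        (∃ A : Ω' → ContModConst d, IsWhiteNoiseField P' W k ε A) ∧
        (∃ B : Ω → ContModConst d, IsConvolution P h (rescale K ε) B) ∧
        ∀ (A : Ω' → ContModConst d) (B : Ω → ContModConst d),
          IsWhiteNoiseField P' W k ε A → IsConvolution P h (rescale K ε) B →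
            IdentDistrib A B P' P :=
  ⟨hk.integrable_kernelSymbol, convKernel k, IsAdmissibleKernel.convKernel_eq_fourierInv k,
    IsAdmissibleKernel.isRadial_convKernel k, hk.integrable_convKernel hd,
    hk.integral_convKernel hd, hk.exists_convKernel_le, hk.exists_schwartzMap_convKernel,
    fun _ _ _ _ _ hh _ _ _ _ _ hW _ hε =>
      ⟨hk.exists_isWhiteNoiseField hW hε, hk.exists_isConvolution hd hh hε,
        fun _ _ hA hB => hk.identDistrib hd hh hW hε hA hB⟩⟩
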